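/- Let $p$ be a prime, let $G$ be a finite abelian group, and let $EG \to BG = EG/G$ be a universal principal $G$-bundle, that is, $EG$ is a contractible space with a $G$-action for which $EG \to EG/G$ is a principal $G$-covering. All cochains and cohomology are singular, with $\mathbb{F}_p$-coefficients; $H^*(X) = \bigoplus_q H^q(X)$ is a ring under the cup product. For a $G$-space $A$ put $H^*_G(A) := H^*(EG \times_G A)$, and for $t \in H^*(BG)$ let $t_A \in H^*_G(A)$ be its image under the map induced by the projection $EG \times_G A \to BG$. Let $\Psi : C^*(EG) \to C^*(BG)$ be the additive map given by $\Psi(f)(\sigma) = \sum_{\tilde\sigma} f(\tilde\sigma)$, the sum running over the $|G|$ lifts $\tilde\sigma$ of the simplex $\sigma$ to $EG$; thus $\Psi$ sends the cochain dual to a simplex of $EG$ to the cochain dual to its image in $BG$. A class $t \in H^*(BG)$ is said to demonstrate the Shift Assumption for $(G, A)$ if (1) multiplication by $t$ is faithful on $H^*_G(A)$, i.e. the map $H^*_G(A) \to H^*_G(A)$, $x \mapsto x \cup t_A$, is injective; and (2) there is $\tilde t \in C^*(EG)$ such that $\Psi(\tilde t)$ is a cocycle and $t = [\Psi(\tilde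 t)]$. The Shift Assumption holds for $(G, A)$ if some $t \in H^*(BG)$ demonstrates it. Lemma. For every finite abelian group $G$ and $A = \{\mathrm{pt}\}$ the Shift Assumption holds. Moreover, it is demonstrated by every non-nilpotent element $t \in H^*(BG; \mathbb{F}_p)$. -/

import Mathlib

open CategoryTheory Simplicial DirectSum

universe u v w

noncomputable section

/-! ## Simplicial cochains and the cup product -/

/-- `n`-cochains of a simplicial set `S` with coefficients in `R`: functions on `n`-simplices. -/
def SSet.Cochain (S : SSet.{u}) (R : Type v) (n : ℕ) : Type (max u v) := S _⦋n⦌ → R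

namespace SSet.Cochain

variable {S T : SSet.{u}} {R : Type v} [CommRing R]

instance (n : ℕ) : AddCommGroup (S.Cochain R n) := inferInstanceAs (AddCommGroup (S _⦋n⦌ → R))

/-- The cup product of an `i`-cochain and a `j`-cochain: the value on an `n`-simplex, `n = i + j`,
is the product of the values on its front `i`-face and on its back `j`-face. -/
def cup {i j n : ℕ} (h : i + j = n) (f : S.Cochain R i) (g : S.Cochain R j) : S.Cochain R n :=
  fun σ ↦ f (S.map (SimplexCategory.subinterval 0 i (by omega)).op σ) *
    g (S.map (SimplexCategory.subinterval i j (by omega)).op σ)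

/-- The coboundary `(d f)(σ) = ∑ k, (-1) ^ k * f (k-th face of σ)`. -/
def d (n : ℕ) : S.Cochain R n →+ S.Cochain R (n + 1) where
  toFun f := fun σ ↦ ∑ k : Fin (n + 2), (-1) ^ (k : ℕ) * f (S.δ k σ)
  map_zero' := by
    funext σ
    exact Finset.sum_eq_zero fun k _ ↦ mul_zero _
  map_add' f g := by
    funext σ
    refine Eq.trans (Finset.sum_congr rfl fun k _ ↦ ?_) Finset.sum_add_distrib
    exact mul_add _ _ _

/-- Pullback of cochains along a map of simplicial sets. -/
def pullback (φ : S ⟶ T) (n : ℕ) : T.Cochain R n →+ S.Cochain R n where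
  toFun f := fun σ ↦ f (φ.app _ σ)
  map_zero' := rfl
  map_add' _ _ := rfl

lemma subinterval_apply {a m n : ℕ} (h : a + m ≤ n) (x : Fin (m + 1)) :
    ((SimplexCategory.subinterval a m h).toOrderHom x : ℕ) = x + a := rfl

lemma δ_apply {n : ℕ} (k : Fin (n + 2)) (x : Fin (n + 1)) :
    ((SimplexCategory.δ k).toOrderHom x : ℕ) = if (x : ℕ) < k then (x : ℕ) else x + 1 := by
  change ((k.succAbove x : Fin (n + 2)) : ℕ) = _
  simp only [Fin.succAbove, Fin.lt_def, Fin.val_castSucc]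
  split_ifs <;> rfl

lemma hom_ext_val {m n : ℕ} {f g : ⦋m⦌ ⟶ ⦋n⦌}
    (h : ∀ x : Fin (m + 1), (f.toOrderHom x : ℕ) = g.toOrderHom x) : f = g :=
  SimplexCategory.Hom.ext _ _ (OrderHom.ext _ _ (funext fun x ↦ Fin.ext (h x)))

lemma comp_val {l m n : ℕ} (f : ⦋l⦌ ⟶ ⦋m⦌) (g : ⦋m⦌ ⟶ ⦋n⦌) (x : Fin (l + 1)) :
    ((f ≫ g).toOrderHom x : ℕ) = g.toOrderHom (f.toOrderHom x) := rfl

lemma subinterval_comp {a b m n i j : ℕ} (h : a + m ≤ n) (h' : i + j ≤ m) (hb : b = a + i)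
    (h'' : b + j ≤ n) :
    SimplexCategory.subinterval i j h' ≫ SimplexCategory.subinterval a m h =
      SimplexCategory.subinterval b j h'' := by
  refine hom_ext_val fun x ↦ ?_
  rw [comp_val, subinterval_apply, subinterval_apply, subinterval_apply]
  omega

lemma subinterval_self {n : ℕ} (h : 0 + n ≤ n) :
    SimplexCategory.subinterval 0 n h = 𝟙 ⦋n⦌ :=
  hom_ext_val fun _ ↦ rfl

lemma subinterval_δ_low {a m n : ℕ} (h : a + m ≤ n) (k : Fin (n + 2)) (hk : (k : ℕ) ≤ a)
    (h' : a + 1 + m ≤ n + 1) :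
    SimplexCategory.subinterval a m h ≫ SimplexCategory.δ k =
      SimplexCategory.subinterval (a + 1) m h' := by
  refine hom_ext_val fun x ↦ ?_
  rw [comp_val, δ_apply, subinterval_apply, subinterval_apply]
  split_ifs <;> omega

lemma subinterval_δ_high {a m n : ℕ} (h : a + m ≤ n) (k : Fin (n + 2)) (hk : a + m < k)
    (h' : a + m ≤ n + 1) :
    SimplexCategory.subinterval a m h ≫ SimplexCategory.δ k =
      SimplexCategory.subinterval a m h' := by
  refine hom_ext_val fun x ↦ ?_
  rw [comp_val, δ_apply, subinterval_apply, subinterval_apply]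
  have := x.2
  split_ifs <;> omega

lemma subinterval_δ_mid {a m n : ℕ} (h : a + m ≤ n) (k : Fin (n + 2)) (k' : Fin (m + 2))
    (hk : (k : ℕ) = k' + a) (h' : a + (m + 1) ≤ n + 1) :
    SimplexCategory.subinterval a m h ≫ SimplexCategory.δ k =
      SimplexCategory.δ k' ≫ SimplexCategory.subinterval a (m + 1) h' := by
  refine hom_ext_val fun x ↦ ?_
  rw [comp_val, comp_val, δ_apply, subinterval_apply, subinterval_apply, δ_apply]
  split_ifs <;> omega

lemma map_map {l m n : ℕ} (f : ⦋l⦌ ⟶ ⦋m⦌) (g : ⦋m⦌ ⟶ ⦋n⦌) (σ : S _⦋n⦌) :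
    S.map f.op (S.map g.op σ) = S.map (f ≫ g).op σ := by
  simp

lemma map_subinterval_self {n : ℕ} (h : 0 + n ≤ n) (σ : S _⦋n⦌) :
    S.map (SimplexCategory.subinterval 0 n h).op σ = σ := by
  rw [subinterval_self]
  simp

lemma cup_assoc {i j k ij jk n : ℕ} (h₁ : i + j = ij) (h₂ : j + k = jk) (h : ij + k = n)
    (h' : i + jk = n) (f : S.Cochain R i) (g : S.Cochain R j) (e : S.Cochain R k) :
    cup h (cup h₁ f g) e = cup h' f (cup h₂ g e) := by
  funext σ
  simp only [cup, map_map, mul_assoc]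
  rw [subinterval_comp (b := 0) _ _ (by omega) (by omega),
    subinterval_comp (b := i) _ _ (by omega) (by omega),
    subinterval_comp (b := i) _ _ (by omega) (by omega),
    subinterval_comp (b := ij) _ _ (by omega) (by omega)]

lemma mk_cup {i j n : ℕ} (h : i + j = n) (f : S.Cochain R i) (g : S.Cochain R j) :
    (GradedMonoid.mk n (cup h f g) : GradedMonoid (S.Cochain R)) =
      GradedMonoid.mk (i + j) (cup rfl f g) := by
  subst h; rfl

instance : GradedMonoid.GMul (S.Cochain R) where
  mul f g := cup rfl f g

instance : GradedMonoid.GOne (S.Cochain R) where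
  one := fun _ ↦ 1

/-- Cochains of all degrees form a graded ring under the cup product; the unit is the constant
`0`-cochain `1`. -/
instance : DirectSum.GRing (S.Cochain R) where
  mul_zero f := funext fun _ ↦ mul_zero _
  zero_mul f := funext fun _ ↦ zero_mul _
  mul_add f g h := funext fun _ ↦ mul_add _ _ _
  add_mul f g h := funext fun _ ↦ add_mul _ _ _
  one_mul := by
    rintro ⟨n, f⟩
    refine (mk_cup (Nat.zero_add n) _ f).symm.trans (congrArg (GradedMonoid.mk n) (funext fun σ ↦ ?_))
    exact (one_mul _).trans (congrArg f (map_subinterval_self _ σ))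
  mul_one := by
    rintro ⟨n, f⟩
    refine congrArg (GradedMonoid.mk n) (funext fun σ ↦ ?_)
    exact (mul_one _).trans (congrArg f (map_subinterval_self _ σ))
  mul_assoc := by
    rintro ⟨i, f⟩ ⟨j, g⟩ ⟨k, e⟩
    exact (congrArg (GradedMonoid.mk _)
      (cup_assoc rfl rfl rfl (Nat.add_assoc i j k).symm f g e)).trans (mk_cup _ _ _)
  natCast n := fun _ ↦ (n : R)
  natCast_zero := funext fun _ ↦ Nat.cast_zero
  natCast_succ n := funext fun _ ↦ Nat.cast_succ n
  intCast n := fun _ ↦ (n : R)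
  intCast_ofNat n := funext fun _ ↦ Int.cast_natCast n
  intCast_negSucc_ofNat n := funext fun _ ↦ Int.cast_negSucc n

lemma δ_eq {n : ℕ} (k : Fin (n + 2)) (σ : S _⦋n + 1⦌) :
    S.δ k σ = S.map (SimplexCategory.δ k).op σ := rfl

lemma leibniz_sum {i j : ℕ} (A : Fin (i + j + 2) → R) (F : Fin (i + 2) → R) (G : Fin (j + 2) → R)
    (h₁ : ∀ k : Fin (i + 1), A ⟨k, by omega⟩ = F k.castSucc * G 0)
    (h₂ : ∀ k : Fin (j + 1), A ⟨i + 1 + k, by omega⟩ = F (Fin.last _) * G k.succ) :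
    ∑ k : Fin (i + j + 2), (-1) ^ (k : ℕ) * A k =
      (∑ k : Fin (i + 2), (-1) ^ (k : ℕ) * F k) * G 0 +
        (-1) ^ i * (F (Fin.last _) * ∑ k : Fin (j + 2), (-1) ^ (k : ℕ) * G k) := by
  rw [← Fin.sum_congr' _ (show (i + 1) + (j + 1) = i + j + 2 by omega), Fin.sum_univ_add,
    Fin.sum_univ_castSucc (n := i + 1), Fin.sum_univ_succ (n := j + 1)]
  have h₁' : ∀ k : Fin (i + 1), A (Fin.cast (by omega) (Fin.castAdd (j + 1) k)) =
    F k.castSucc * G 0 := h₁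
  have h₂' : ∀ k : Fin (j + 1), A (Fin.cast (by omega) (Fin.natAdd (i + 1) k)) =
    F (Fin.last _) * G k.succ := h₂
  simp only [h₁', h₂', Fin.val_cast, Fin.val_castAdd, Fin.val_natAdd, Fin.val_castSucc,
    Fin.val_last, Fin.val_succ, Fin.val_zero, add_mul, mul_add, Finset.sum_mul, Finset.mul_sum,
    pow_zero, one_mul]
  have e₁ : ∀ k : Fin (i + 1), (-1 : R) ^ (k : ℕ) * (F k.castSucc * G 0) =
    (-1) ^ (k : ℕ) * F k.castSucc * G 0 := fun k ↦ by ring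
  have e₂ : ∀ k : Fin (j + 1), (-1 : R) ^ (i + 1 + (k : ℕ)) * (F (Fin.last _) * G k.succ) =
    (-1) ^ i * (F (Fin.last _) * ((-1) ^ ((k : ℕ) + 1) * G k.succ)) := fun k ↦ by ring
  simp only [e₁, e₂]
  ring

/-- The Leibniz rule. -/
lemma d_cup {i j : ℕ} (f : S.Cochain R i) (g : S.Cochain R j) :
    d (i + j) (cup rfl f g) =
      cup (by omega) (d i f) g + (-1 : ℤ) ^ i • cup (by omega) f (d j g) := by
  funext σ
  have e₅ : SimplexCategory.δ (Fin.last (i + 1)) ≫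
        SimplexCategory.subinterval 0 (i + 1) (by omega : 0 + (i + 1) ≤ i + j + 1) =
      SimplexCategory.subinterval 0 i (by omega) := by
    refine hom_ext_val fun x ↦ ?_
    rw [comp_val, subinterval_apply, δ_apply, subinterval_apply, Fin.val_last, if_pos x.2]
  have e₆ : SimplexCategory.δ (0 : Fin (j + 2)) ≫
        SimplexCategory.subinterval i (j + 1) (by omega : i + (j + 1) ≤ i + j + 1) =
      SimplexCategory.subinterval (i + 1) j (by omega) := by
    refine hom_ext_val fun x ↦ ?_
    rw [comp_val, subinterval_apply, δ_apply, subinterval_apply, Fin.val_zero, if_neg (by omega)]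
    omega
  have key := leibniz_sum (R := R)
    (fun k ↦ cup rfl f g (S.δ k σ))
    (fun k ↦ f (S.δ k (S.map (SimplexCategory.subinterval 0 (i + 1) (by omega)).op σ)))
    (fun k ↦ g (S.δ k (S.map (SimplexCategory.subinterval i (j + 1) (by omega)).op σ)))
    (fun k ↦ by
      simp only [cup, δ_eq, map_map, e₆]
      rw [subinterval_δ_mid _ _ k.castSucc (by simp) (by omega),
        subinterval_δ_low _ _ (by simp; omega) (by omega)])
    (fun k ↦ by
      simp only [cup, δ_eq, map_map, e₅]
      rw [subinterval_δ_mid _ _ k.succ (by simp; omega) (by omega),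
        subinterval_δ_high _ _ (by simp; omega) (by omega)])
  refine key.trans ?_
  have e₅' : S.δ (Fin.last (i + 1))
      (S.map (SimplexCategory.subinterval 0 (i + 1) (by omega)).op σ) =
      S.map (SimplexCategory.subinterval 0 i (by omega)).op σ := by
    rw [δ_eq, map_map, e₅]
  have e₆' : S.δ 0 (S.map (SimplexCategory.subinterval i (j + 1) (by omega)).op σ) =
      S.map (SimplexCategory.subinterval (i + 1) j (by omega)).op σ := by
    rw [δ_eq, map_map, e₆]
  rw [e₅', e₆']
  refine congrArg₂ (· + ·) rfl ?_
  change _ = (-1 : ℤ) ^ i • (_ : R)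
  rw [zsmul_eq_mul, Int.cast_pow, Int.cast_neg, Int.cast_one]
  rfl

lemma d_one : d 0 (GradedMonoid.GOne.one : S.Cochain R 0) = 0 := by
  funext σ
  change ∑ k : Fin 2, (-1 : R) ^ (k : ℕ) * (1 : R) = 0
  simp

lemma pullback_d (φ : S ⟶ T) (n : ℕ) (f : T.Cochain R n) :
    pullback φ (n + 1) (d n f) = d n (pullback φ n f) := by
  funext σ
  change ∑ k : Fin (n + 2), (-1 : R) ^ (k : ℕ) * f _ = ∑ k : Fin (n + 2), (-1 : R) ^ (k : ℕ) * f _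
  refine Finset.sum_congr rfl fun k _ ↦ ?_
  exact congrArg (fun x ↦ (-1 : R) ^ (k : ℕ) * f x) (SSet.δ_naturality_apply φ k σ).symm

lemma pullback_cup (φ : S ⟶ T) {i j n : ℕ} (h : i + j = n) (f : T.Cochain R i)
    (g : T.Cochain R j) :
    pullback φ n (cup h f g) = cup h (pullback φ i f) (pullback φ j g) := by
  funext σ
  have e : ∀ {m : ℕ} (α : ⦋m⦌ ⟶ ⦋n⦌),
      T.map α.op (φ.app _ σ) = φ.app _ (S.map α.op σ) :=
    fun α ↦ (NatTrans.naturality_apply φ α.op σ).symm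
  exact congrArg₂ (· * ·) (congrArg f (e _)) (congrArg g (e _))

end SSet.Cochain

/-! ## The cohomology ring of a simplicial set -/

namespace SSet

variable (S : SSet.{u}) (R : Type v) [CommRing R]

/-- The ring `C^*(S; R) = ⨁ n, C^n(S; R)` of cochains of a simplicial set, under cup product. -/
abbrev Cochains : Type (max u v) := ⨁ n, S.Cochain R n

variable {S R}

/-- The coboundary on `C^*(S; R)`. -/
def coboundary : S.Cochains R →+ S.Cochains R :=
  DirectSum.toAddMonoid fun n ↦ (DirectSum.of (S.Cochain R) (n + 1)).comp (Cochain.d n)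

/-- The sign involution, `(-1) ^ n` in degree `n`. -/
def signInvolution : S.Cochains R →+ S.Cochains R :=
  DirectSum.toAddMonoid fun n ↦ (-1 : ℤ) ^ n • DirectSum.of (S.Cochain R) n

lemma coboundary_of {n : ℕ} (f : S.Cochain R n) :
    coboundary (DirectSum.of (S.Cochain R) n f) =
      DirectSum.of (S.Cochain R) (n + 1) (Cochain.d n f) := by
  simp [coboundary]

lemma signInvolution_of {n : ℕ} (f : S.Cochain R n) :
    signInvolution (DirectSum.of (S.Cochain R) n f) =
      (-1 : ℤ) ^ n • DirectSum.of (S.Cochain R) n f := by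
  simp [signInvolution]

lemma of_cup {i j n : ℕ} (h : i + j = n) (f : S.Cochain R i) (g : S.Cochain R j) :
    DirectSum.of (S.Cochain R) n (Cochain.cup h f g) =
      DirectSum.of (S.Cochain R) i f * DirectSum.of (S.Cochain R) j g := by
  subst h
  exact (DirectSum.of_mul_of _ _).symm

lemma coboundary_mul (a b : S.Cochains R) :
    coboundary (a * b) = coboundary a * b + signInvolution a * coboundary b := by
  induction a using DirectSum.induction_on with
  | zero => simp
  | add a a' ha ha' => simp only [add_mul, map_add, ha, ha']; abel
  | of i f =>
    induction b using DirectSum.induction_on with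
    | zero => simp
    | add b b' hb hb' => simp only [mul_add, map_add, hb, hb']; abel
    | of j g =>
      rw [← of_cup rfl, coboundary_of, Cochain.d_cup, map_add, map_zsmul, of_cup, of_cup,
        coboundary_of, coboundary_of, signInvolution_of, smul_mul_assoc]

lemma signInvolution_signInvolution (a : S.Cochains R) :
    signInvolution (signInvolution a) = a := by
  induction a using DirectSum.induction_on with
  | zero => simp
  | add a a' ha ha' => simp only [map_add, ha, ha']
  | of i f =>
    rw [signInvolution_of, map_zsmul, signInvolution_of, smul_smul, ← mul_pow]
    simp

lemma coboundary_signInvolution (a : S.Cochains R) :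
    coboundary (signInvolution a) = - signInvolution (coboundary a) := by
  induction a using DirectSum.induction_on with
  | zero => simp
  | add a a' ha ha' => simp only [map_add, ha, ha']; abel
  | of i f =>
    rw [signInvolution_of, map_zsmul, coboundary_of, signInvolution_of, pow_succ]
    simp

lemma coboundary_one : coboundary (1 : S.Cochains R) = 0 := by
  refine (coboundary_of _).trans ?_
  rw [Cochain.d_one, map_zero]

variable (S R)

/-- The ring of cocycles. -/
def cocycles : Subring (S.Cochains R) where
  carrier := {a | coboundary a = 0}
  mul_mem' {a b} ha hb := by
    change coboundary (a * b) = 0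
    rw [coboundary_mul, show coboundary a = 0 from ha, show coboundary b = 0 from hb]
    simp
  one_mem' := coboundary_one
  add_mem' {a b} ha hb := by
    change coboundary (a + b) = 0
    rw [map_add, show coboundary a = 0 from ha, show coboundary b = 0 from hb, add_zero]
  zero_mem' := map_zero _
  neg_mem' {a} ha := by
    change coboundary (-a) = 0
    rw [map_neg, show coboundary a = 0 from ha, neg_zero]

/-- The ideal of coboundaries in the ring of cocycles. -/
def coboundaries : Ideal (S.cocycles R) where
  carrier := {z | ∃ a, coboundary a = (z : S.Cochains R)}
  add_mem' := by
    rintro _ _ ⟨a, ha⟩ ⟨b, hb⟩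
    exact ⟨a + b, by rw [map_add, ha, hb]; rfl⟩
  zero_mem' := ⟨0, map_zero _⟩
  smul_mem' := by
    rintro ⟨z, hz⟩ x ⟨a, ha⟩
    refine ⟨signInvolution z * a, ?_⟩
    rw [coboundary_mul, coboundary_signInvolution, show coboundary z = 0 from hz,
      signInvolution_signInvolution, ha]
    simp

instance : (S.coboundaries R).IsTwoSided where
  mul_mem_of_left := by
    rintro x ⟨z, hz⟩ ⟨a, ha⟩
    refine ⟨a * z, ?_⟩
    rw [coboundary_mul, show coboundary z = 0 from hz, ha]
    simp

/-- The total cohomology ring `H^*(S; R)`: cocycles modulo coboundaries, with the cup product. -/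
def Cohomology : Type (max u v) := S.cocycles R ⧸ S.coboundaries R

instance : Ring (S.Cohomology R) := inferInstanceAs (Ring (S.cocycles R ⧸ S.coboundaries R))

/-- The cohomology class of a cocycle. -/
def cohomologyClass : S.cocycles R →+* S.Cohomology R := Ideal.Quotient.mk (S.coboundaries R)

variable {S} {T : SSet.{u}}

/-- The ring homomorphism on cochains induced by a map of simplicial sets. -/
def cochainsMap (φ : S ⟶ T) : T.Cochains R →+* S.Cochains R :=
  DirectSum.toSemiring (fun n ↦ (DirectSum.of (S.Cochain R) n).comp (Cochain.pullback φ n)) rfl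
    fun {i j} f g ↦ by
      refine (congrArg (DirectSum.of (S.Cochain R) (i + j))
        (Cochain.pullback_cup φ rfl f g)).trans ?_
      exact of_cup rfl _ _

lemma cochainsMap_of (φ : S ⟶ T) {n : ℕ} (f : T.Cochain R n) :
    cochainsMap R φ (DirectSum.of (T.Cochain R) n f) =
      DirectSum.of (S.Cochain R) n (Cochain.pullback φ n f) :=
  DirectSum.toAddMonoid_of
    (fun n ↦ (DirectSum.of (S.Cochain R) n).comp (Cochain.pullback φ n)) n f

lemma cochainsMap_coboundary (φ : S ⟶ T) (a : T.Cochains R) :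
    cochainsMap R φ (coboundary a) = coboundary (cochainsMap R φ a) := by
  induction a using DirectSum.induction_on with
  | zero => simp
  | add a a' ha ha' => simp only [map_add, ha, ha']
  | of i f =>
    rw [coboundary_of, cochainsMap_of, cochainsMap_of, coboundary_of, Cochain.pullback_d]

/-- The ring homomorphism on cocycles induced by a map of simplicial sets. -/
def cocyclesMap (φ : S ⟶ T) : T.cocycles R →+* S.cocycles R :=
  (cochainsMap R φ).restrict _ _ fun z hz ↦ by
    change coboundary (cochainsMap R φ z) = 0
    rw [← cochainsMap_coboundary, show coboundary z = 0 from hz, map_zero]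

/-- The ring homomorphism on cohomology induced by a map of simplicial sets. -/
def cohomologyMap (φ : S ⟶ T) : T.Cohomology R →+* S.Cohomology R :=
  Ideal.quotientMap (S.coboundaries R) (cocyclesMap R φ) (by
    rintro z ⟨a, ha⟩
    refine ⟨cochainsMap R φ a, ?_⟩
    rw [← cochainsMap_coboundary, ha]
    rfl)

/-- Summation over the fibres of a map `φ : S ⟶ T` of simplicial sets, on cochains:
`(transfer φ f)(τ)` is the sum of `f σ` over the simplices `σ` with `φ σ = τ`. When the fibres of
`φ` are finite, this is the additive map that sends the cochain dual to a simplex `σ` to the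
cochain dual to the simplex `φ σ`. -/
def transfer (φ : S ⟶ T) : S.Cochains R → T.Cochains R :=
  DFinsupp.mapRange
    (fun n (f : S.Cochain R n) (τ : T _⦋n⦌) ↦ ∑ᶠ σ : {σ : S _⦋n⦌ // φ.app _ σ = τ}, f σ)
    fun _ ↦ funext fun _ ↦ finsum_zero

end SSet

/-! ## Singular cohomology and homotopy quotients -/

/-- The ring of singular cochains `C^*(X; R)`. -/
abbrev SingularCochains (X : Type u) [TopologicalSpace X] (R : Type v) [CommRing R] :
    Type (max u v) :=
  (TopCat.toSSet.obj (TopCat.of X)).Cochains R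

/-- The ring of singular cocycles. -/
abbrev singularCocycles (X : Type u) [TopologicalSpace X] (R : Type v) [CommRing R] :
    Subring (SingularCochains X R) :=
  (TopCat.toSSet.obj (TopCat.of X)).cocycles R

/-- The singular cohomology ring `H^*(X; R)`, the direct sum over all degrees. -/
abbrev SingularCohomology (X : Type u) [TopologicalSpace X] (R : Type v) [CommRing R] :
    Type (max u v) :=
  (TopCat.toSSet.obj (TopCat.of X)).Cohomology R

/-- The class in `H^*(X; R)` of a singular cocycle. -/
abbrev singularClass (X : Type u) [TopologicalSpace X] (R : Type v) [CommRing R] :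
    singularCocycles X R →+* SingularCohomology X R :=
  (TopCat.toSSet.obj (TopCat.of X)).cohomologyClass R

/-- The ring homomorphism `H^*(Y; R) → H^*(X; R)` induced by a continuous map `X → Y`. -/
def singularCohomologyMap {X Y : Type u} [TopologicalSpace X] [TopologicalSpace Y] (R : Type v)
    [CommRing R] (f : C(X, Y)) : SingularCohomology Y R →+* SingularCohomology X R :=
  SSet.cohomologyMap R (TopCat.toSSet.map (TopCat.ofHom f))

section HomotopyQuotient

variable (G : Type w) [Group G] (E : Type u) [TopologicalSpace E] [MulAction G E]
  (A : Type u) [TopologicalSpace A] [MulAction G A]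

/-- `E` is a model of `EG`: a contractible space with an action of the discrete group `G` for which
`E → E / G` is a principal `G`-covering (in particular the action is free and continuous). -/
structure IsUniversalBundle : Prop where
  contractible : ContractibleSpace E
  covering : IsQuotientCoveringMap (Quotient.mk (MulAction.orbitRel G E)) G

/-- `BG`, the quotient of `E = EG` by `G`. -/
abbrev ClassifyingQuotient : Type u := MulAction.orbitRel.Quotient G E

/-- The homotopy quotient `EG ×_G A`, the quotient of `E × A` by the diagonal action of `G`. -/
abbrev HomotopyQuotient : Type u := MulAction.orbitRel.Quotient G (E × A)

/-- The projection `EG → BG`. -/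
def bundleProj : C(E, ClassifyingQuotient G E) where
  toFun := Quotient.mk _
  continuous_toFun := continuous_quot_mk

/-- The projection `EG ×_G A → BG`. -/
def homotopyQuotientProj : C(HomotopyQuotient G E A, ClassifyingQuotient G E) where
  toFun := Quotient.map Prod.fst (by
    rintro _ ⟨e, a⟩ ⟨g, rfl⟩
    exact ⟨g, rfl⟩)
  continuous_toFun := continuous_fst.quotient_map' _

/-- The map `Ψ : C^*(EG; R) → C^*(BG; R)` that sends the cochain dual to a simplex of `EG` to the
cochain dual to its image in `BG`. Every simplex of `BG` has exactly `|G|` lifts, over which `Ψ`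
sums. -/
def lowerCochain (R : Type v) [CommRing R] :
    SingularCochains E R → SingularCochains (ClassifyingQuotient G E) R :=
  SSet.transfer R (TopCat.toSSet.map (TopCat.ofHom (bundleProj G E)))

variable {G E} in
/-- The class `t ∈ H^*(BG; F_p)` demonstrates the shift assumption for the `G`-space `A`: the
shift map `x ↦ x ∪ t_A` on `H^*_G(A; F_p)` is faithful, where `t_A` is the image of `t` under
`H^*(BG; F_p) → H^*_G(A; F_p)`, and `t = [Ψ(t')]` for some `t' ∈ C^*(EG; F_p)`. -/
structure DemonstratesShift {p : ℕ} (t : SingularCohomology (ClassifyingQuotient G E) (ZMod p)) :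
    Prop where
  faithful : Function.Injective fun x : SingularCohomology (HomotopyQuotient G E A) (ZMod p) ↦
    x * singularCohomologyMap (ZMod p) (homotopyQuotientProj G E A) t
  represented : ∃ (t' : SingularCochains E (ZMod p))
    (h : lowerCochain G E (ZMod p) t' ∈ singularCocycles (ClassifyingQuotient G E) (ZMod p)),
    singularClass (ClassifyingQuotient G E) (ZMod p) ⟨_, h⟩ = t

/-- The shift assumption for the `G`-space `A` at the prime `p`. -/
def ShiftAssumption (p : ℕ) : Prop :=
  ∃ t : SingularCohomology (ClassifyingQuotient G E) (ZMod p), DemonstratesShift A t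

end HomotopyQuotient

end

/-! For a one-point space, the projection from the homotopy quotient to BG is a homeomorphism, so
faithfulness says that a non-nilpotent `t` is regular in H^*(BG). Condition (2) is free: putting the
value of a cochain on one chosen lift of each simplex shows that Ψ is surjective
(`transfer_surjective`). As H^*(BG) is nonzero, the class 1 is not nilpotent, so some class
demonstrates the assumption.

Classically, H^*(BG) is free over a polynomial ring that contains a p-power of every class. Instead
of computing the ring, the proof carries the property `IsFrobeniusRegular` through an induction:
every element has an iterated p-th power in a central subring P whose nonzero elements are regular.
If `a * t = 0` and `t` is not nilpotent, a power of `t` is a nonzero element of P that kills `a`, so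
`a = 0`.

The induction splits off a cyclic factor, G = ℤ/n × K. Let A be the K-invariant cochains on tuples
of G, with the generator `g` of ℤ/n acting and invariants B. Inflation from K to A is a
quasi-isomorphism. If n is prime to p, averaging shows that B has the cohomology of K. If p divides
n, take `e` of norm 1, `c` with `g c = c + 1` and `w` with `w - g w = d e`; then `y = d c` and `x =
d w` are invariant cocycles. Descent with Hilbert 90 (`cyclic_generation`, `cyclic_injectivity`)
writes every class of B uniquely as `s r + y * s r' + x * β`, with `r`, `r'` from K and β of lower
degree. With `x` central and `y` graded central, this lets the property pass from K to G (`step`).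
For odd p, `y * y = 0` by anticommutation; for p = 2 it is 0 or `x`, by an explicit cochain
computation.

Both uses of topology or freeness rest on `toTuples_isQuasiIso`: a simplicial set with a cone
operator and an equivariant map from its vertices to the group has invariant cochains that compute
group cohomology as a ring. It applies to K acting on tuples of ℤ/n × K, and to the singular
simplices of EG, where a contraction supplies cones and unique lifting identifies invariant cochains
with cochains of BG. -/

/-! ## Rings whose non-nilpotent elements are regular -/

/-- A ring `R` with a sign automorphism `ε`, commutative in the graded sense, every element of which
has an iterated `p`-th power in a central subring whose nonzero elements are regular. -/
structure IsFrobeniusRegular (p : ℕ) (R : Type*) [Ring R] (ε : R →+* R) : Prop where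
  exists_subring : ∃ P : Subring R, (∀ f ∈ P, (∀ a, f * a = a * f) ∧ ε f = f) ∧
    (∀ f ∈ P, f ≠ 0 → ∀ a, f * a = 0 → a = 0) ∧ ∀ t, ∃ m : ℕ, t ^ p ^ m ∈ P
  exists_even_add_odd : ∀ b, ∃ b₀ b₁, b = b₀ + b₁ ∧ ε b₀ = b₀ ∧ ε b₁ = -b₁ ∧
    (∀ a, b₀ * a = a * b₀) ∧ ∀ a, b₁ * a = ε a * b₁

namespace IsFrobeniusRegular

variable {p : ℕ} {R S : Type*} [Ring R] [Ring S] {ε : R →+* R} {ε' : S →+* S}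

/-- The exponent `p ^ m` is positive, so the power of `t` in P is a multiple of `t` and still kills
`a`; it is nonzero because `t` is not nilpotent. -/
lemma eq_zero_of_mul_eq_zero [hpp : Fact p.Prime] (h : IsFrobeniusRegular p R ε) {t : R} (ht : ¬ IsNilpotent t) {a : R}
    (ha : a * t = 0) : a = 0 := by
  obtain ⟨P, hP, hreg, hpow⟩ := h.exists_subring
  obtain ⟨m, hm⟩ := hpow t
  refine hreg _ hm (fun h0 ↦ ht ⟨_, h0⟩) a ?_
  obtain ⟨k, hk⟩ := Nat.exists_eq_succ_of_ne_zero (pow_ne_zero m hpp.out.ne_zero)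
  rw [(hP _ hm).1, hk, pow_succ', ← mul_assoc, ha, zero_mul]

lemma of_ringEquiv (h : IsFrobeniusRegular p R ε) (e : R ≃+* S) (he : ∀ a, e (ε a) = ε' (e a)) :
    IsFrobeniusRegular p S ε' where
  exists_subring := by
    obtain ⟨P, hP, hreg, hpow⟩ := h.exists_subring
    refine ⟨P.map (e : R →+* S), ?_, ?_, fun t ↦ ?_⟩
    · rintro _ ⟨f, hf, rfl⟩
      refine ⟨fun a ↦ ?_, ?_⟩
      · obtain ⟨a, rfl⟩ := e.surjective a
        simpa using congrArg e ((hP f hf).1 a)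
      · simpa [(hP f hf).2] using (he f).symm
    · rintro _ ⟨f, hf, rfl⟩ h0 a ha
      obtain ⟨a, rfl⟩ := e.surjective a
      have : a = 0 := hreg f hf (by rintro rfl; simp at h0) a (e.injective (by simpa using ha))
      simp [this]
    · obtain ⟨t, rfl⟩ := e.surjective t
      obtain ⟨m, hm⟩ := hpow t
      exact ⟨m, _, hm, by simp⟩
  exists_even_add_odd b := by
    obtain ⟨b, rfl⟩ := e.surjective b
    obtain ⟨b₀, b₁, rfl, h₀, h₁, c₀, c₁⟩ := h.exists_even_add_odd b
    refine ⟨e b₀, e b₁, map_add _ _ _, by rw [← he, h₀], by rw [← he, h₁, map_neg], ?_, ?_⟩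
    · intro a
      obtain ⟨a, rfl⟩ := e.surjective a
      rw [← map_mul, c₀, map_mul]
    · intro a
      obtain ⟨a, rfl⟩ := e.surjective a
      rw [← map_mul, c₁, map_mul, he]


end IsFrobeniusRegular

/-! ### Additivity of the p-th power under graded commutativity -/

lemma mul_self_eq_zero_of_anticommute {p : ℕ} (hodd : Odd p) {R : Type*} [Ring R]
    (hp : (p : R) = 0) {b : R} (hb : b * b = -(b * b)) : b * b = 0 := by
  obtain ⟨k, rfl⟩ := hodd
  have h2 : b * b + b * b = 0 := by nth_rewrite 1 [hb]; exact neg_add_cancel _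
  have h3 : ((2 * k + 1 : ℕ) : R) * (b * b) = k * (b * b + b * b) + b * b := by
    push_cast; noncomm_ring
  rw [hp, h2] at h3
  simpa using h3.symm

lemma Commute.add_pow_prime_of_natCast_eq_zero {p : ℕ} (hp : p.Prime) {R : Type*} [Ring R]
    (hR : (p : R) = 0) {a b : R} (h : Commute a b) : (a + b) ^ p = a ^ p + b ^ p := by
  obtain ⟨r, hr⟩ := h.exists_add_pow_prime_eq hp
  rw [hr, hR]
  simp

namespace IsFrobeniusRegular

variable {p : ℕ} {R : Type*} [Ring R] {ε : R →+* R}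

/-- For p = 2 the sign is trivial and the ring is commutative. For odd p an odd element squares to
zero, so the p-th power only sees the even part, which is central. -/
lemma add_pow_prime [hpp : Fact p.Prime]
    (h : ∀ b, ∃ b₀ b₁, b = b₀ + b₁ ∧ ε b₀ = b₀ ∧ ε b₁ = -b₁ ∧
      (∀ a, b₀ * a = a * b₀) ∧ ∀ a, b₁ * a = ε a * b₁)
    (hR : (p : R) = 0) (hε : p = 2 → ∀ a, ε a = a) (a b : R) :
    (a + b) ^ p = a ^ p + b ^ p := by
  obtain ⟨a₀, a₁, rfl, -, h₁, c₀, c₁⟩ := h a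
  obtain ⟨b₀, b₁, rfl, -, h₁', c₀', c₁'⟩ := h b
  have hp : p.Prime := hpp.out
  rcases hp.eq_two_or_odd' with h2 | hodd
  · refine Commute.add_pow_prime_of_natCast_eq_zero hp hR ?_
    change (a₀ + a₁) * (b₀ + b₁) = (b₀ + b₁) * (a₀ + a₁)
    rw [add_mul, c₀, c₁, hε h2, mul_add]
  · have key : ∀ c₀ c₁ : R, (∀ a, c₀ * a = a * c₀) → c₁ * c₁ = -(c₁ * c₁) →
        (c₀ + c₁) ^ p = c₀ ^ p := by
      intro c₀ c₁ h₀ h₁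
      rw [Commute.add_pow_prime_of_natCast_eq_zero hp hR (h₀ c₁)]
      obtain ⟨k, hk⟩ := Nat.exists_eq_add_of_le hp.two_le
      have := mul_self_eq_zero_of_anticommute hodd hR h₁
      rw [hk, pow_add c₁, sq c₁, this, zero_mul, add_zero]
    have e₁ : a₁ * a₁ = -(a₁ * a₁) := by
      conv_lhs => rw [c₁, h₁, neg_mul]
    have e₂ : b₁ * b₁ = -(b₁ * b₁) := by
      conv_lhs => rw [c₁', h₁', neg_mul]
    have e₃ : (a₁ + b₁) * (a₁ + b₁) = -((a₁ + b₁) * (a₁ + b₁)) := by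
      conv_lhs => rw [add_mul, c₁, c₁', map_add, h₁, h₁', ← mul_add]
      noncomm_ring
    rw [key _ _ c₀ e₁, key _ _ c₀' e₂, add_add_add_comm, key _ _ _ e₃,
      Commute.add_pow_prime_of_natCast_eq_zero hp hR (c₀ b₀)]
    intro a
    rw [add_mul, c₀, c₀', mul_add]

lemma add_pow_prime_pow (hadd : ∀ a b : R, (a + b) ^ p = a ^ p + b ^ p) (m : ℕ) (a b : R) :
    (a + b) ^ p ^ m = a ^ p ^ m + b ^ p ^ m := by
  induction m with
  | zero => simp
  | succ m ih => rw [pow_succ, pow_mul, ih, hadd, ← pow_mul, ← pow_mul]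

/-! ### Adjoining an odd class y and an even class x -/

section Step

variable {H : Type*} [Ring H] {εH : H →+* H} (s : R →+* H) {x y : H} {F : ℕ → Set H}

/-- Strong induction along the filtration reduces commutation with `z`, twisted by `φ`, to the
generators `s r`, `y` and `x`. The identity gives centrality, the sign graded centrality. -/
lemma mul_eq_map_mul (φ : H →+* H)
    (hF₀ : ∀ h ∈ F 0, h = 0) (hF : ∀ h, ∃ N, h ∈ F N)
    (gen : ∀ N, ∀ h ∈ F (N + 1), ∃ r r' β, β ∈ F (N - 1) ∧ h = s r + y * s r' + x * β)
    {z : H} (hs : ∀ r, z * s r = φ (s r) * z) (hy : z * y = φ y * z) (hx : z * x = φ x * z) (a : H) :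
    z * a = φ a * z := by
  obtain ⟨N, hN⟩ := hF a
  induction N using Nat.strong_induction_on generalizing a with
  | _ N ih =>
    cases N with
    | zero => simp [hF₀ a hN]
    | succ N =>
      obtain ⟨r, r', β, hβ, rfl⟩ := gen N a hN
      have := ih (N - 1) (by omega) β hβ
      rw [mul_add, mul_add, hs, ← mul_assoc, hy, mul_assoc, hs, ← mul_assoc z x, hx,
        mul_assoc _ z, this]
      simp only [map_add, map_mul, add_mul, mul_assoc]

/-- By `gen` and `inj`, elements of `H` have unique expansions in powers of `x` with coefficients in
`s R + y * s R`. The central subring is the copy of P[x] inside `H`; a product vanishes only if its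
lowest coefficient does. -/
lemma step [hpp : Fact p.Prime] (h : IsFrobeniusRegular p R ε) (hεs : ∀ r, εH (s r) = s (ε r))
    (hεx : εH x = x) (hεy : εH y = -y) (hεε : ∀ a, εH (εH a) = a)
    (hx : ∀ a, x * a = a * x) (hy : ∀ a, y * a = εH a * y)
    (hF₀ : ∀ h ∈ F 0, h = 0) (hF : ∀ h, ∃ N, h ∈ F N)
    (gen : ∀ N, ∀ h ∈ F (N + 1), ∃ r r' β, β ∈ F (N - 1) ∧ h = s r + y * s r' + x * β)
    (inj : ∀ r r' β, s r + y * s r' + x * β = 0 → r = 0 ∧ r' = 0 ∧ β = 0)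
    (hH : (p : H) = 0) (hε : p = 2 → ∀ a, εH a = a) (hyy : p = 2 → y * y = 0 ∨ y * y = x) :
    IsFrobeniusRegular p H εH := by
  have hp : p.Prime := hpp.out
  have hdec : ∀ b, ∃ b₀ b₁, b = b₀ + b₁ ∧ εH b₀ = b₀ ∧ εH b₁ = -b₁ ∧
      (∀ a, b₀ * a = a * b₀) ∧ ∀ a, b₁ * a = εH a * b₁ := by
    have hev : ∀ r, ε r = r → (∀ a, r * a = a * r) → ∀ a, s r * a = a * s r := fun r h₀ hc a ↦ by
      refine mul_eq_map_mul s (RingHom.id H) hF₀ hF gen (z := s r) (fun a ↦ ?_) ?_ ?_ a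
      · simp only [RingHom.id_apply, ← map_mul, hc]
      · rw [RingHom.id_apply, hy, hεs, h₀]
      · rw [RingHom.id_apply, hx]
    have hod : ∀ r, ε r = -r → (∀ a, r * a = ε a * r) → ∀ a, s r * a = εH a * s r :=
      fun r h₀ hc a ↦ by
        refine mul_eq_map_mul s εH hF₀ hF gen (z := s r) (fun a ↦ ?_) ?_ ?_ a
        · rw [← map_mul, hc, hεs, map_mul]
        · rw [hεy, neg_mul, hy, hεs, h₀, map_neg, neg_mul, neg_neg]
        · rw [hεx, hx]
    intro b
    obtain ⟨N, hN⟩ := hF b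
    induction N using Nat.strong_induction_on generalizing b with
    | _ N ih =>
      cases N with
      | zero => exact ⟨0, 0, by simp [hF₀ b hN], by simp, by simp, by simp, by simp⟩
      | succ N =>
        obtain ⟨r, r', β, hβ, rfl⟩ := gen N b hN
        obtain ⟨β₀, β₁, rfl, h₀, h₁, c₀, c₁⟩ := ih (N - 1) (by omega) β hβ
        obtain ⟨r₀, r₁, rfl, h₀', h₁', c₀', c₁'⟩ := h.exists_even_add_odd r
        obtain ⟨s₀, s₁, rfl, h₀'', h₁'', c₀'', c₁''⟩ := h.exists_even_add_odd r'
        -- Since `y` is odd, multiplication by it exchanges the even and odd parts of `r'`.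
        refine ⟨s r₀ + y * s s₁ + x * β₀, s r₁ + y * s s₀ + x * β₁, ?_, ?_, ?_, ?_, ?_⟩
        · simp only [map_add, mul_add]; abel
        · simp [hεs, hεx, hεy, h₀, h₀', h₁'']
        · simp only [map_add, map_mul, hεs, hεx, hεy, h₁, h₁', h₀'', map_neg]
          noncomm_ring
        · intro a
          rw [add_mul, add_mul, mul_add, mul_add, hev r₀ h₀' c₀', mul_assoc, hod s₁ h₁'' c₁'',
            ← mul_assoc y, hy, hεε, mul_assoc a, mul_assoc x, c₀, ← mul_assoc x, hx, mul_assoc a]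
        · intro a
          rw [add_mul, add_mul, mul_add, mul_add, hod r₁ h₁' c₁', mul_assoc, hev s₀ h₀'' c₀'',
            ← mul_assoc y, hy, mul_assoc _ y, mul_assoc x, c₁, ← mul_assoc x, hx, mul_assoc _ x]
  refine ⟨?_, hdec⟩
  have hfrob := add_pow_prime_pow (add_pow_prime hdec hH hε)
  obtain ⟨P, hP, hreg, hpow⟩ := h.exists_subring
  let Q := Subring.closure (s '' P ∪ {x})
  have hsQ : ∀ f ∈ P, s f ∈ Q := fun f hf ↦ Subring.subset_closure (.inl ⟨f, hf, rfl⟩)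
  have hxQ : x ∈ Q := Subring.subset_closure (.inr rfl)
  have hQ : ∀ f ∈ Q, (∀ a, f * a = a * f) ∧ εH f = f := by
    intro f hf
    induction hf using Subring.closure_induction with
    | mem f hf =>
      rcases hf with ⟨f, hf, rfl⟩ | rfl
      · have hc : ∀ a, s f * a = a * s f := fun a ↦ by
          refine mul_eq_map_mul s (RingHom.id H) hF₀ hF gen (z := s f) (fun a ↦ ?_) ?_ ?_ a
          · simp only [RingHom.id_apply, ← map_mul, (hP f hf).1]
          · rw [RingHom.id_apply, hy, hεs, (hP f hf).2]
          · rw [RingHom.id_apply, hx]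
        exact ⟨hc, by rw [hεs, (hP f hf).2]⟩
      · exact ⟨hx, hεx⟩
    | zero => simp
    | one => simp
    | add a b _ _ ha hb => exact ⟨fun c ↦ by rw [add_mul, ha.1, hb.1, mul_add], by
        rw [map_add, ha.2, hb.2]⟩
    | neg a _ ha => exact ⟨fun c ↦ by rw [neg_mul, ha.1, mul_neg], by rw [map_neg, ha.2]⟩
    | mul a b _ _ ha hb => exact ⟨fun c ↦ by
        rw [mul_assoc, hb.1, ← mul_assoc, ha.1, mul_assoc], by rw [map_mul, ha.2, hb.2]⟩
  -- Each element of `Q` has a constant term in P, and the remainder is divisible by `x` within `Q`.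
  have hQform : ∀ f ∈ Q, ∃ f₀ ∈ P, ∃ f₁ ∈ Q, f = s f₀ + x * f₁ := by
    intro f hf
    induction hf using Subring.closure_induction with
    | mem f hf =>
      rcases hf with ⟨f, hf, rfl⟩ | rfl
      · exact ⟨f, hf, 0, zero_mem _, by simp⟩
      · exact ⟨0, zero_mem _, 1, one_mem _, by simp⟩
    | zero => exact ⟨0, zero_mem _, 0, zero_mem _, by simp⟩
    | one => exact ⟨1, one_mem _, 0, zero_mem _, by simp⟩
    | add a b _ _ ha hb =>
      obtain ⟨a₀, ha₀, a₁, ha₁, rfl⟩ := ha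
      obtain ⟨b₀, hb₀, b₁, hb₁, rfl⟩ := hb
      exact ⟨_, add_mem ha₀ hb₀, _, add_mem ha₁ hb₁, by simp only [map_add, mul_add]; abel⟩
    | neg a _ ha =>
      obtain ⟨a₀, ha₀, a₁, ha₁, rfl⟩ := ha
      exact ⟨_, neg_mem ha₀, _, neg_mem ha₁, by simp only [map_neg, mul_neg]; abel⟩
    | mul a b ha' hb' ha hb =>
      obtain ⟨a₀, ha₀, a₁, ha₁, rfl⟩ := ha
      obtain ⟨b₀, hb₀, b₁, hb₁, rfl⟩ := hb
      refine ⟨_, mul_mem ha₀ hb₀, s a₀ * b₁ + a₁ * (s b₀ + x * b₁), ?_, ?_⟩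
      · exact add_mem (mul_mem (hsQ _ ha₀) hb₁) (mul_mem ha₁ hb')
      · rw [add_mul, mul_add, map_mul, ← mul_assoc (s a₀), ← hx (s a₀), mul_add x]
        simp only [mul_assoc, add_assoc]
  refine ⟨Q, hQ, ?_, fun t ↦ ?_⟩
  · intro f hf hf0 z hz
    obtain ⟨M, hM⟩ := hF f
    induction M using Nat.strong_induction_on generalizing f with
    | _ M ihM =>
      obtain ⟨f₀, hf₀, f₁, hf₁, hff⟩ := hQform f hf
      -- If the constant term vanishes, `f = x * f₁`. Uniqueness identifies `f₁` with the `β` of the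
      -- expansion of `f`, so it has lower level, and `x` cancels from `f * z = 0`.
      by_cases h0 : f₀ = 0
      · have hff' : f = x * f₁ := by simpa [h0] using hff
        cases M with
        | zero => exact absurd (hF₀ f hM) hf0
        | succ M =>
          obtain ⟨r, r', β, hβ, e⟩ := gen M f hM
          obtain ⟨-, -, e'⟩ := inj r r' (β - f₁) (by rw [mul_sub, ← hff', e]; abel)
          obtain rfl := sub_eq_zero.mp e'
          refine ihM (M - 1) (by omega) β hf₁ (by rintro rfl; simp at hff'; exact hf0 hff') ?_ hβ
          exact (inj 0 0 (β * z) (by rw [← mul_assoc, ← hff', hz]; simp)).2.2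
      -- Otherwise `f₀` is regular in `R`. Comparing expansions in `f * z = 0` kills the two leading
      -- coefficients of `z`, so `z = x * β` with `f * β = 0`, and induction runs on the level of
      -- `z`.
      · clear ihM
        obtain ⟨N, hN⟩ := hF z
        induction N using Nat.strong_induction_on generalizing z with
        | _ N ihN =>
          cases N with
          | zero => exact hF₀ z hN
          | succ N =>
            obtain ⟨r, r', β, hβ, rfl⟩ := gen N z hN
            have e := inj (f₀ * r) (f₀ * r') (s f₀ * β + f₁ * (s r + y * s r' + x * β)) (by
              refine Eq.trans ?_ ((congrArg (· * (s r + y * s r' + x * β)) hff.symm).trans hz)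
              have : y * s f₀ = s f₀ * y := by rw [hy, hεs, (hP f₀ hf₀).2]
              change _ = (s f₀ + x * f₁) * (s r + y * s r' + x * β)
              rw [map_mul, map_mul, ← mul_assoc y, this, mul_add x, ← mul_assoc x (s f₀),
                hx (s f₀), ← mul_assoc x f₁, add_mul (s f₀), mul_add (s f₀), mul_add (s f₀)]
              simp only [mul_assoc]; abel)
            obtain rfl := hreg f₀ hf₀ h0 _ e.1
            obtain rfl := hreg f₀ hf₀ h0 _ e.2.1
            have hβ0 : f * β = 0 := (inj 0 0 (f * β) (by
              have : f * (x * β) = 0 := by simpa using hz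
              rw [← mul_assoc, hx f, mul_assoc, this]; simp)).2.2
            have := ihN (N - 1) (by omega) β hβ0 hβ
            simp [this]
  · have hmono : ∀ a : H, ∀ m k : ℕ, m ≤ k → a ^ p ^ m ∈ Q → a ^ p ^ k ∈ Q := by
      intro a m k hmk ha
      obtain ⟨j, rfl⟩ := Nat.exists_eq_add_of_le hmk
      rw [pow_add, pow_mul]
      exact pow_mem ha _
    have hpowadd : ∀ a b : H, (∃ m, a ^ p ^ m ∈ Q) → (∃ m, b ^ p ^ m ∈ Q) →
        ∃ m, (a + b) ^ p ^ m ∈ Q := by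
      rintro a b ⟨m, hm⟩ ⟨k, hk⟩
      refine ⟨max m k, ?_⟩
      rw [hfrob]
      exact add_mem (hmono a m _ (le_max_left _ _) hm) (hmono b k _ (le_max_right _ _) hk)
    have hpows : ∀ r, ∃ m, s r ^ p ^ m ∈ Q := fun r ↦ by
      obtain ⟨m, hm⟩ := hpow r
      exact ⟨m, by rw [← map_pow]; exact hsQ _ hm⟩
    obtain ⟨N, hN⟩ := hF t
    induction N using Nat.strong_induction_on generalizing t with
    | _ N ih =>
      cases N with
      | zero => exact ⟨0, by simp [hF₀ t hN]⟩
      | succ N =>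
        obtain ⟨r, r', β, hβ, rfl⟩ := gen N t hN
        -- Iterated p-th powers are additive, so the three summands may be treated separately.
        refine hpowadd _ _ (hpowadd _ _ (hpows r) ?_) ?_
        · rcases hp.eq_two_or_odd' with h2 | hodd
          · obtain ⟨m, hm⟩ := hpows r'
            refine ⟨m + 1, ?_⟩
            have hc : Commute y (s r') := by
              change y * s r' = s r' * y
              rw [hy, hε h2]
            rw [hc.mul_pow]
            refine mul_mem (hmono y 1 _ (by omega) ?_) (hmono _ m _ (by omega) hm)
            rw [pow_one]
            nth_rewrite 1 [h2]
            rw [sq]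
            rcases hyy h2 with e | e <;> rw [e]
            exacts [zero_mem _, hxQ]
          · refine ⟨1, ?_⟩
            have hyy0 : y * y = 0 := mul_self_eq_zero_of_anticommute hodd hH (by
              conv_lhs => rw [hy, hεy, neg_mul])
            obtain ⟨k, hk⟩ := Nat.exists_eq_add_of_le hp.two_le
            -- Moving `y` past `s r'` costs only a sign twist and produces `y * y = 0`.
            have : (y * s r') ^ 2 = 0 := by
              rw [sq, mul_assoc, ← mul_assoc (s r'), ← hεε (s r'), ← hy, hεε, mul_assoc y,
                ← mul_assoc, hyy0, zero_mul]
            rw [pow_one, hk, pow_add, this, zero_mul]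
            exact zero_mem _
        · obtain ⟨m, hm⟩ := ih (N - 1) (by omega) β hβ
          refine ⟨m, ?_⟩
          rw [(show Commute x β from hx β).mul_pow]
          exact mul_mem (pow_mem hxQ _) hm

end Step

end IsFrobeniusRegular

/-! ## Differential graded rings -/

/-- A differential graded ring, presented by its differential, its sign involution `(-1) ^ degree`
and the projections `trunc N` to the components of degree less than `N`. -/
class DGRing (A : Type*) [Ring A] where
  d : A →+ A
  sgn : A →+* A
  trunc : ℕ → A →+ A
  d_mul (a b : A) : d (a * b) = d a * b + sgn a * d b
  d_d (a : A) : d (d a) = 0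
  sgn_sgn (a : A) : sgn (sgn a) = a
  d_sgn (a : A) : d (sgn a) = -sgn (d a)
  trunc_zero (a : A) : trunc 0 a = 0
  trunc_trunc (N : ℕ) (a : A) : trunc N (trunc N a) = trunc N a
  d_trunc (N : ℕ) (a : A) : d (trunc N a) = trunc (N + 1) (d a)
  exists_trunc (a : A) : ∃ N, trunc N a = a

namespace DGRing

section Basic

variable (A : Type*) [Ring A] [DGRing A]

/-- The ring of cocycles. -/
def cocycles : Subring A where
  carrier := {a | d a = 0}
  mul_mem' {a b} ha hb := by
    change d (a * b) = 0
    rw [d_mul, show d a = 0 from ha, show d b = 0 from hb]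
    simp
  one_mem' := by
    have h : d (1 * 1 : A) = d 1 * 1 + sgn 1 * d 1 := d_mul 1 1
    rw [map_one sgn, mul_one, mul_one, one_mul] at h
    exact left_eq_add.mp h
  add_mem' {a b} ha hb := by
    change d (a + b) = 0
    rw [map_add, show d a = 0 from ha, show d b = 0 from hb, add_zero]
  zero_mem' := map_zero _
  neg_mem' {a} ha := by
    change d (-a) = 0
    rw [map_neg, show d a = 0 from ha, neg_zero]

/-- The ideal of coboundaries. -/
def coboundaries : Ideal (cocycles A) where
  carrier := {z | ∃ a, d a = (z : A)}
  add_mem' := by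
    rintro _ _ ⟨a, ha⟩ ⟨b, hb⟩
    exact ⟨a + b, by rw [map_add, ha, hb]; rfl⟩
  zero_mem' := ⟨0, map_zero _⟩
  smul_mem' := by
    rintro ⟨z, hz⟩ x ⟨a, ha⟩
    refine ⟨sgn z * a, ?_⟩
    rw [d_mul, d_sgn, show d z = 0 from hz, sgn_sgn, ha]
    simp

instance : (coboundaries A).IsTwoSided where
  mul_mem_of_left := by
    rintro x ⟨z, hz⟩ ⟨a, ha⟩
    refine ⟨a * z, ?_⟩
    rw [d_mul, show d z = 0 from hz, ha]
    simp

/-- The cohomology ring of a differential graded ring. -/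
def Cohomology : Type _ := cocycles A ⧸ coboundaries A

instance : Ring (Cohomology A) := inferInstanceAs (Ring (cocycles A ⧸ coboundaries A))

/-- The class of a cocycle. -/
def cls : cocycles A →+* Cohomology A := Ideal.Quotient.mk (coboundaries A)

variable {A}

lemma cls_surjective : Function.Surjective (cls A) := Ideal.Quotient.mk_surjective

lemma cls_eq_zero_iff {z : cocycles A} : cls A z = 0 ↔ ∃ a, d a = (z : A) :=
  Ideal.Quotient.eq_zero_iff_mem

lemma cls_eq_of_eq_add {z z' : cocycles A} {a : A} (h : (z : A) = z' + d a) :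
    cls A z = cls A z' := by
  rw [← sub_eq_zero, ← map_sub, cls_eq_zero_iff]
  exact ⟨a, by simp [h]⟩

end Basic

/-! ### Homomorphisms and quasi-isomorphisms -/

variable {A B C : Type*} [Ring A] [DGRing A] [Ring B] [DGRing B] [Ring C] [DGRing C]

/-- A ring homomorphism that respects the differential graded structures. -/
structure IsDGHom (f : A →+* B) : Prop where
  map_d (a : A) : f (d a) = d (f a)
  map_sgn (a : A) : f (sgn a) = sgn (f a)
  map_trunc (N : ℕ) (a : A) : f (trunc N a) = trunc N (f a)

/-- The map on cocycles induced by a ring homomorphism that commutes with the differential. -/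
def cocyclesMap (f : A →+* B) (hf : ∀ a, f (d a) = d (f a)) : cocycles A →+* cocycles B :=
  f.restrict _ _ fun a ha ↦ by
    change d (f a) = 0
    rw [← hf, show d a = 0 from ha, map_zero]

/-- The map on cohomology induced by a ring homomorphism that commutes with the differential. -/
def IsDGHom.cohomologyMap {f : A →+* B} (hf : IsDGHom f) : Cohomology A →+* Cohomology B :=
  Ideal.quotientMap (coboundaries B) (cocyclesMap f hf.map_d) (by
    rintro z ⟨a, ha⟩
    refine ⟨f a, ?_⟩
    rw [← hf.map_d, ha]
    rfl)

lemma IsDGHom.cohomologyMap_cls {f : A →+* B} (hf : IsDGHom f) (z : cocycles A) :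
    hf.cohomologyMap (cls A z) = cls B (cocyclesMap f hf.map_d z) := rfl

lemma sgn_mem_cocycles {a : A} (ha : a ∈ cocycles A) : sgn a ∈ cocycles A := by
  change d (sgn a) = 0
  rw [d_sgn, show d a = 0 from ha, map_zero, neg_zero]

variable (A) in
/-- The sign involution on cohomology. -/
def cohomologySgn : Cohomology A →+* Cohomology A :=
  Ideal.quotientMap (coboundaries A)
    ((sgn : A →+* A).restrict _ _ fun _ ↦ sgn_mem_cocycles) (by
      rintro z ⟨a, ha⟩
      refine ⟨-sgn a, ?_⟩
      rw [map_neg, d_sgn, ha, neg_neg]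
      rfl)

lemma cohomologySgn_cls (z : cocycles A) :
    cohomologySgn A (cls A z) = cls A ⟨sgn (z : A), sgn_mem_cocycles z.2⟩ := rfl

/-- A quasi-isomorphism of differential graded rings. -/
structure IsQuasiIso (f : A →+* B) : Prop extends IsDGHom f where
  exists_eq_add (b : B) (hb : d b = 0) : ∃ a b', d a = 0 ∧ b = f a + d b'
  exists_eq_d (a : A) (ha : d a = 0) (b : B) (hab : f a = d b) : ∃ a', a = d a'

/-- The retraction `r` and the homotopy `h` need only be additive: the ring structure is compared by
`f` alone. -/
lemma IsQuasiIso.of_homotopy {f : A →+* B} (hf : IsDGHom f) (r : B →+ A) (h : B →+ B)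
    (hr : ∀ b, r (d b) = d (r b)) (hrf : ∀ a, r (f a) = a)
    (hh : ∀ b, d (h b) + h (d b) = b - f (r b)) : IsQuasiIso f where
  toIsDGHom := hf
  exists_eq_add b hb := ⟨r b, h b, by rw [← hr, hb, map_zero], by
    have := hh b
    rw [hb, map_zero, add_zero] at this
    rw [this]; abel⟩
  exists_eq_d a _ b hab := ⟨r b, by rw [← hr, ← hab, hrf]⟩

/-- As `d` raises degree by one, truncating `b'` one step earlier than `b` keeps the equation. This
bound makes the later induction on degree terminate. -/
lemma IsQuasiIso.exists_eq_add_trunc {f : A →+* B} (hf : IsQuasiIso f) {N : ℕ} {b : B}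
    (hb : d b = 0) (hN : trunc N b = b) :
    ∃ a b', d a = 0 ∧ trunc (N - 1) b' = b' ∧ b = f a + d b' := by
  cases N with
  | zero => exact ⟨0, 0, by simp, by simp, by rw [← hN, trunc_zero]; simp⟩
  | succ N =>
    obtain ⟨a, b', ha, e⟩ := hf.exists_eq_add b hb
    refine ⟨trunc (N + 1) a, trunc N b', ?_, trunc_trunc _ _, ?_⟩
    · rw [d_trunc, ha, map_zero]
    · rw [hf.map_trunc, d_trunc, ← map_add, ← e, hN]

lemma IsQuasiIso.cohomologyMap_bijective {f : A →+* B} (hf : IsQuasiIso f) :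
    Function.Bijective hf.cohomologyMap := by
  constructor
  · rw [injective_iff_map_eq_zero]
    intro x hx
    obtain ⟨z, rfl⟩ := cls_surjective x
    obtain ⟨b, hb⟩ := cls_eq_zero_iff.mp hx
    obtain ⟨a, ha⟩ := hf.exists_eq_d z z.2 b hb.symm
    exact cls_eq_zero_iff.mpr ⟨a, ha.symm⟩
  · intro x
    obtain ⟨z, rfl⟩ := cls_surjective x
    obtain ⟨a, b, ha, e⟩ := hf.exists_eq_add z z.2
    exact ⟨cls A ⟨a, ha⟩, (cls_eq_of_eq_add e).symm⟩

/-- The cohomology of `A` is Frobenius regular. -/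
def IsRegular (p : ℕ) (A : Type*) [Ring A] [DGRing A] : Prop :=
  IsFrobeniusRegular p (Cohomology A) (cohomologySgn A)

lemma IsQuasiIso.cohomologyMap_sgn {f : A →+* B} (hf : IsQuasiIso f) (x : Cohomology A) :
    hf.cohomologyMap (cohomologySgn A x) = cohomologySgn B (hf.cohomologyMap x) := by
  obtain ⟨z, rfl⟩ := cls_surjective x
  exact congrArg (cls B) (Subtype.ext (hf.map_sgn _))

lemma IsQuasiIso.isRegular_iff {p : ℕ} {f : A →+* B} (hf : IsQuasiIso f) :
    IsRegular p A ↔ IsRegular p B := by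
  let e := RingEquiv.ofBijective _ hf.cohomologyMap_bijective
  refine ⟨fun h ↦ h.of_ringEquiv e hf.cohomologyMap_sgn, fun h ↦ h.of_ringEquiv e.symm fun b ↦ ?_⟩
  obtain ⟨a, rfl⟩ := e.surjective b
  rw [e.symm_apply_apply, e.symm_apply_eq]
  exact (hf.cohomologyMap_sgn a).symm

/-! ## Invariants of a cyclic group -/

section Cyclic

variable {A₀ : Type*} [Ring A₀] [DGRing A₀] {ι : B →+* A} {g : A →+* A} {n : ℕ} {s : A₀ →+* B}

/-- The norm `1 + g + ⋯ + g ^ (n - 1)`. -/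
def cyclicNorm (g : A →+* A) (n : ℕ) : A →+ A := ∑ j ∈ Finset.range n, ((g ^ j : A →+* A) : A →+ A)

omit [DGRing A] in
lemma cyclicNorm_apply (a : A) : cyclicNorm g n a = ∑ j ∈ Finset.range n, (g ^ j) a := by
  simp [cyclicNorm]

omit [DGRing A] in
lemma pow_apply_of_fixed {a : A} (ha : g a = a) (j : ℕ) : (g ^ j) a = a := by
  induction j with
  | zero => rfl
  | succ j ih => rw [pow_succ, RingHom.mul_def, RingHom.comp_apply, ha, ih]

omit [DGRing A] in
lemma cyclicNorm_of_fixed {a : A} (ha : g a = a) : cyclicNorm g n a = n * a := by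
  simp [cyclicNorm_apply, pow_apply_of_fixed ha]

omit [DGRing A] in
lemma cyclicNorm_mul_of_fixed {a b : A} (hb : g b = b) :
    cyclicNorm g n (a * b) = cyclicNorm g n a * b := by
  simp only [cyclicNorm_apply, Finset.sum_mul, map_mul, pow_apply_of_fixed hb]

omit [DGRing A] in
lemma mul_cyclicNorm_of_fixed {a b : A} (hb : g b = b) :
    cyclicNorm g n (b * a) = b * cyclicNorm g n a := by
  simp only [cyclicNorm_apply, Finset.mul_sum, map_mul, pow_apply_of_fixed hb]

omit [DGRing A] in
lemma pow_succ_apply (j : ℕ) (a : A) : (g ^ (j + 1)) a = g ((g ^ j) a) := by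
  rw [pow_succ', RingHom.mul_def, RingHom.comp_apply]

omit [DGRing A] in
lemma pow_succ_apply' (j : ℕ) (a : A) : (g ^ (j + 1)) a = (g ^ j) (g a) := by
  rw [pow_succ, RingHom.mul_def, RingHom.comp_apply]

omit [DGRing A] in
lemma cyclicNorm_map (hn : g ^ n = 1) (a : A) : cyclicNorm g n (g a) = cyclicNorm g n a := by
  have h : (g ^ n) a = (g ^ 0) a := by rw [hn]; rfl
  simp only [cyclicNorm_apply, ← pow_succ_apply']
  have := Finset.sum_range_succ' (fun j ↦ (g ^ j) a) n
  rw [Finset.sum_range_succ, h] at this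
  exact (add_right_cancel this).symm

omit [DGRing A] in
lemma map_cyclicNorm (hn : g ^ n = 1) (a : A) : g (cyclicNorm g n a) = cyclicNorm g n a := by
  conv_rhs => rw [← cyclicNorm_map hn]
  simp only [cyclicNorm_apply, map_sum, ← pow_succ_apply, ← pow_succ_apply']

lemma d_cyclicNorm (hg : IsDGHom g) (a : A) : d (cyclicNorm g n a) = cyclicNorm g n (d a) := by
  have : ∀ j : ℕ, d ((g ^ j) a) = (g ^ j) (d a) := fun j ↦ by
    induction j with
    | zero => rfl
    | succ j ih => rw [pow_succ_apply, ← hg.map_d, ih, ← pow_succ_apply]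
  simp only [cyclicNorm_apply, map_sum, this]

lemma trunc_cyclicNorm (hg : IsDGHom g) (N : ℕ) (a : A) :
    trunc N (cyclicNorm g n a) = cyclicNorm g n (trunc N a) := by
  have : ∀ j : ℕ, trunc N ((g ^ j) a) = (g ^ j) (trunc N a) := fun j ↦ by
    induction j with
    | zero => rfl
    | succ j ih => rw [pow_succ_apply, ← hg.map_trunc, ih, ← pow_succ_apply]
  simp only [cyclicNorm_apply, map_sum, this]

omit [DGRing A] in
/-- Hilbert 90: in presence of an element of norm `1`, the elements of norm `0` are the differences
`b - g b`. -/
lemma exists_eq_sub_of_cyclicNorm_eq_zero (hn : g ^ n = 1) {e : A} (he : cyclicNorm g n e = 1)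
    {a : A} (ha : cyclicNorm g n a = 0) : ∃ b, a = b - g b := by
  -- The witness is the sum over `k < n` of `g ^ k e` times the partial norm `S k` of `a`. Under `1
  -- - g` it telescopes: `T 0 = 0` is an empty sum, `T n = 0` because `a` has norm 0, and the
  -- remaining coefficients of `a` add up to the norm of `e`.
  let S : ℕ → A := fun k ↦ ∑ j ∈ Finset.range k, (g ^ j) a
  have hS : ∀ k, S (k + 1) = a + g (S k) := fun k ↦ by
    simp only [S]
    rw [Finset.sum_range_succ', map_sum, add_comm]
    simp only [pow_succ_apply]
    rfl
  let T : ℕ → A := fun k ↦ (g ^ k) e * S k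
  have hT : ∀ k, g (T k) = T (k + 1) - (g ^ (k + 1)) e * a := fun k ↦ by
    simp only [T, map_mul, hS, pow_succ_apply]
    rw [mul_add]; abel
  refine ⟨∑ k ∈ Finset.range n, T k, ?_⟩
  have hT0 : T 0 = 0 := by simp [T, S]
  have hTn : T n = 0 := by
    have : S n = 0 := by rw [← ha, cyclicNorm_apply]
    simp [T, this]
  have h1 : ∑ k ∈ Finset.range n, T (k + 1) = ∑ k ∈ Finset.range n, T k := by
    have := Finset.sum_range_succ' T n
    rw [Finset.sum_range_succ, hT0, hTn] at this
    simpa using this.symm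
  have h2 : ∑ k ∈ Finset.range n, (g ^ (k + 1)) e * a = a := by
    rw [← Finset.sum_mul]
    have : ∑ k ∈ Finset.range n, (g ^ (k + 1)) e = 1 := by
      rw [← he, ← cyclicNorm_map hn, cyclicNorm_apply]
      simp only [pow_succ_apply']
    rw [this, one_mul]
  rw [map_sum]
  simp only [hT, Finset.sum_sub_distrib, h1, h2]
  abel

/-- If the order of the cyclic group is invertible, then passing to invariants commutes with
cohomology. -/
lemma IsQuasiIso.of_cyclic_of_coprime (hs : IsDGHom s) (hι : IsDGHom ι)
    (hinj : Function.Injective ι) (hfix : ∀ a, g a = a ↔ ∃ b, ι b = a) (hg : IsDGHom g)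
    (hn : g ^ n = 1) (hq : IsQuasiIso (ι.comp s)) {k : ℕ} (hk : (k : A) * n = 1) :
    IsQuasiIso s where
  toIsDGHom := hs
  exists_eq_add b hb := by
    obtain ⟨r, a, hr, e⟩ := hq.exists_eq_add (ι b) (by rw [← hι.map_d, hb, map_zero])
    obtain ⟨b', hb'⟩ := (hfix _).mp (map_cyclicNorm hn a)
    -- The norm multiplies the invariant terms of `e` by `n`, which `k` inverts, and turns the
    -- primitive `a` into the invariant `b'`.
    refine ⟨r, k * b', hr, hinj ?_⟩
    have e' := congrArg (cyclicNorm g n) e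
    rw [map_add, ← d_cyclicNorm hg, cyclicNorm_of_fixed ((hfix _).mpr ⟨_, rfl⟩), RingHom.comp_apply,
      cyclicNorm_of_fixed ((hfix _).mpr ⟨_, rfl⟩), ← hb'] at e'
    have e'' := congrArg ((k : A) * ·) e'
    simp only [mul_add, ← mul_assoc, hk, one_mul] at e''
    rw [e'', map_add, ← nsmul_eq_mul, ← nsmul_eq_mul, map_nsmul, map_nsmul, hι.map_d]
  exists_eq_d a ha b hab := hq.exists_eq_d a ha (ι b) (by
    rw [RingHom.comp_apply, hab, hι.map_d])

/-! ### The case where the order of the cyclic group is zero in the ring -/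

variable (hs : IsDGHom s) (hι : IsDGHom ι) (hinj : Function.Injective ι)
  (hfix : ∀ a, g a = a ↔ ∃ b, ι b = a) (hg : IsDGHom g) (hn : g ^ n = 1)
  (hq : IsQuasiIso (ι.comp s)) {e c w : A} {x y : B}
  (he : cyclicNorm g n e = 1) (hc : g c = c + 1) (hw : w - g w = d e) (hy : ι y = d c)
  (hx : ι x = d w) (hnA : (n : A) = 0) (hsc : sgn c = c) (hsw : sgn w = -w)

include hs hι hinj hfix hg hn hq he hc hw hy hx hnA hsc hsw

-- In `A`, `ι b` is `s r` up to some `d a`. The defect `a - g a` is a cocycle, hence `s r'` up to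
-- some `d α`, and the norm of `α` is an invariant cocycle `β`. Each primitive lowers the degree
-- bound by one, so `β` lies two steps below `b`. Correcting `a` by `c`, `w` and Hilbert 90 makes it
-- invariant, and its coboundary gives the formula.
omit hsc hsw in
lemma cyclic_generation {M : ℕ} {b : B} (hb : d b = 0) (hM : trunc (M + 1) b = b) :
    ∃ r r' β b', d r = 0 ∧ d r' = 0 ∧ d β = 0 ∧ trunc (M - 1) β = β ∧
      b = s r + y * s r' + x * β + d b' := by
  have hgι : ∀ b, g (ι b) = ι b := fun b ↦ (hfix _).mpr ⟨b, rfl⟩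
  obtain ⟨r, a, hr, ha, e₁⟩ := hq.exists_eq_add_trunc (N := M + 1) (b := ι b)
    (by rw [← hι.map_d, hb, map_zero]) (by rw [← hι.map_trunc, hM])
  rw [Nat.add_sub_cancel] at ha
  rw [RingHom.comp_apply] at e₁
  have hda : d a = ι (b - s r) := by rw [map_sub, e₁]; abel
  obtain ⟨r', α, hr', hα, e₂⟩ := hq.exists_eq_add_trunc (N := M) (b := a - g a)
    (by rw [map_sub, ← hg.map_d, hda, hgι, sub_self]) (by rw [map_sub, ← hg.map_trunc, ha])
  rw [RingHom.comp_apply] at e₂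
  obtain ⟨β, hβ⟩ := (hfix _).mp (map_cyclicNorm hn α)
  have hdα : d α = a - g a - ι (s r') := by rw [e₂]; abel
  have hdβ : d β = 0 := hinj (by
    rw [hι.map_d, hβ, d_cyclicNorm hg, hdα, map_sub, map_sub, cyclicNorm_map hn,
      cyclicNorm_of_fixed (hgι _), hnA]
    simp)
  -- Subtracting `e * ι β` removes the norm of `α`, since `e` has norm 1.
  obtain ⟨γ, hγ⟩ := exists_eq_sub_of_cyclicNorm_eq_zero hn he (a := α - e * ι β) (by
    rw [map_sub, cyclicNorm_mul_of_fixed (hgι _), he, hβ, one_mul, sub_self])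
  -- Under `1 - g` the four terms contribute `ι (s r') + d α`, `-ι (s r')`, `-d e * ι β` and `-(d α
  -- - d e * ι β)`, which cancel.
  obtain ⟨b', hb'⟩ := (hfix (a + c * ι (s r') - w * ι β - d γ)).mp (by
    have h₁ : g a = a - ι (s r') - d α := by rw [hdα]; abel
    have h₂ : g w = w - d e := by rw [← hw]; abel
    have h₃ : g (d γ) = d γ - d α + d e * ι β := by
      have := congrArg d hγ
      rw [map_sub, map_sub, d_mul, ← hι.map_d, hdβ, map_zero, mul_zero, add_zero] at this
      rw [hg.map_d, ← sub_eq_zero, ← sub_eq_zero.mpr this]; abel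
    rw [map_sub, map_sub, map_add, map_mul, map_mul, hgι, hgι, h₁, h₂, h₃, hc]
    noncomm_ring)
  refine ⟨r, -r', β, b', hr, by rw [map_neg, hr', neg_zero], hdβ, hinj ?_, hinj ?_⟩
  · rw [hι.map_trunc, hβ, trunc_cyclicNorm hg, hα]
  · have h₁ : d (ι (s r')) = 0 := by rw [← hι.map_d, ← hs.map_d, hr', map_zero, map_zero]
    have h₂ : d (ι β) = 0 := by rw [← hι.map_d, hdβ, map_zero]
    rw [map_add, map_add, map_add, map_mul, map_mul, hι.map_d, hb', hy, hx, map_sub, map_sub,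
      map_add, d_d, d_mul, d_mul, h₁, h₂, map_neg, map_neg, hda, map_sub]
    noncomm_ring

-- In `A` the classes `y` and `x` bound `c` and `w`, so the relation makes `s r`, hence `r`, a
-- coboundary. Subtracting primitives leaves a cocycle of `A`; applying `1 - g` to it isolates `s
-- r'`. A second round with `r'` already a coboundary, followed by the norm, isolates `β`.
omit hsw in
lemma cyclic_injectivity {r r' : A₀} {β b : B} (hr : d r = 0) (hr' : d r' = 0) (hβ : d β = 0)
    (h : s r + y * s r' + x * β = d b) :
    (∃ a, r = d a) ∧ (∃ a, r' = d a) ∧ ∃ a, β = d a := by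
  have hgι : ∀ b, g (ι b) = ι b := fun b ↦ (hfix _).mpr ⟨b, rfl⟩
  have hd₁ : d (ι (s r')) = 0 := by rw [← hι.map_d, ← hs.map_d, hr', map_zero, map_zero]
  have hd₂ : d (ι β) = 0 := by rw [← hι.map_d, hβ, map_zero]
  have hgw : g w = w - d e := by rw [← hw]; abel
  have h' : ι (s r) + d c * ι (s r') + d w * ι β = d (ι b) := by
    rw [← hι.map_d, ← h, ← hy, ← hx]; simp
  obtain ⟨r₀, hr₀⟩ := hq.exists_eq_d r hr (ι b - c * ι (s r') - w * ι β) (by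
    rw [map_sub, map_sub, ← h', d_mul, d_mul, hd₁, hd₂, RingHom.comp_apply]
    noncomm_ring)
  have hd₃ : ι (s r) = d (ι (s r₀)) := by rw [hr₀, hs.map_d, hι.map_d]
  obtain ⟨b₁, α, hb₁, e₁⟩ := hq.exists_eq_add (ι b - ι (s r₀) - c * ι (s r') - w * ι β) (by
    rw [map_sub, map_sub, map_sub, ← h', d_mul, d_mul, hd₁, hd₂, hd₃]
    noncomm_ring)
  obtain ⟨r₁, hr₁⟩ := hq.exists_eq_d r' hr' (α - g α + e * ι β) (by
    have := congrArg (fun a ↦ a - g a) e₁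
    simp only [map_sub, map_add, map_mul, hgι, hc, hgw, RingHom.comp_apply] at this
    rw [RingHom.comp_apply, map_add, map_sub, ← hg.map_d, d_mul, hd₂, mul_zero, add_zero]
    have h₂ : d α - g (d α) = ι (s b₁) + d α - (ι (s b₁) + g (d α)) := by abel
    rw [h₂, ← this]
    noncomm_ring)
  refine ⟨⟨r₀, hr₀⟩, ⟨r₁, hr₁⟩, ?_⟩
  have hd₄ : ι (s r') = d (ι (s r₁)) := by rw [hr₁, hs.map_d, hι.map_d]
  have hsy : sgn (ι y) = - ι y := by
    rw [hy, ← neg_eq_iff_eq_neg.mpr (d_sgn c), hsc]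
  have hdy : d (ι y) = 0 := by rw [hy, d_d]
  -- The term `ι y * ι (s r₁)` replaces `-c * ι (s r')`: it has the same coboundary because `y` is
  -- odd, but it is invariant and so disappears under `1 - g`.
  obtain ⟨b₂, α₂, hb₂, e₂⟩ := hq.exists_eq_add (ι b - ι (s r₀) + ι y * ι (s r₁) - w * ι β) (by
    rw [map_sub, map_add, map_sub, ← h', d_mul, d_mul, hd₂, hd₃, hdy, hsy, hd₄, hy]
    noncomm_ring)
  have e₃ : d (e * ι β + α₂ - g α₂) = 0 := by
    have := congrArg (fun a ↦ a - g a) e₂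
    simp only [map_sub, map_add, map_mul, hgι, hgw, RingHom.comp_apply] at this
    rw [map_sub, map_add, ← hg.map_d, d_mul, hd₂, mul_zero, add_zero]
    have h₂ : d e * ι β + d α₂ - g (d α₂) =
      d e * ι β + (ι (s b₂) + d α₂ - (ι (s b₂) + g (d α₂))) := by abel
    rw [h₂, ← this]
    noncomm_ring
  obtain ⟨b₃, α₃, hb₃, e₄⟩ := hq.exists_eq_add _ e₃
  obtain ⟨b₄, hb₄⟩ := (hfix _).mp (map_cyclicNorm hn α₃)
  refine ⟨b₄, hinj ?_⟩
  -- The norm kills `α₂ - g α₂`, and it kills `ι (s b₃)` because `n = 0`; only `β` and a coboundary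
  -- survive.
  have := congrArg (cyclicNorm g n) e₄
  rw [map_sub, map_add, map_add, cyclicNorm_map hn, cyclicNorm_mul_of_fixed (hgι _), he, one_mul,
    RingHom.comp_apply, cyclicNorm_of_fixed (hgι _), hnA, zero_mul, zero_add,
    add_sub_cancel_right, ← d_cyclicNorm hg, ← hb₄, ← hι.map_d] at this
  exact this

-- The commutator of `e` with an invariant element has norm 0, so it is `γ - g γ` by Hilbert 90; `d
-- γ` then corrects the graded commutator of `w` with `b` to an invariant primitive.
omit hs hq hc hy hnA hsc hsw in
lemma cyclic_even_central {b : B} (hb : d b = 0) : ∃ b', x * b - b * x = d b' := by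
  have hgι : ∀ b, g (ι b) = ι b := fun b ↦ (hfix _).mpr ⟨b, rfl⟩
  have hgw : g w = w - d e := by rw [← hw]; abel
  have hdb : d (ι b) = 0 := by rw [← hι.map_d, hb, map_zero]
  obtain ⟨γ, hγ⟩ := exists_eq_sub_of_cyclicNorm_eq_zero hn he (a := e * ι b - ι b * e) (by
    rw [map_sub, cyclicNorm_mul_of_fixed (hgι _), mul_cyclicNorm_of_fixed (hgι _), he]
    simp)
  have hdγ : g (d γ) = d γ - (d e * ι b - sgn (ι b) * d e) := by
    have := congrArg d hγ
    rw [map_sub, map_sub, d_mul, d_mul, hdb, mul_zero, zero_mul, add_zero, zero_add] at this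
    rw [this, hg.map_d]; abel
  obtain ⟨b', hb'⟩ := (hfix (w * ι b - sgn (ι b) * w - d γ)).mp (by
    have h₁ : g (sgn (ι b)) = sgn (ι b) := by rw [hg.map_sgn, hgι]
    rw [map_sub, map_sub, map_mul, map_mul, hgι, h₁, hgw, hdγ]
    noncomm_ring)
  refine ⟨b', hinj ?_⟩
  rw [hι.map_d, hb', map_sub (d (A := A)), map_sub (d (A := A)), d_d, d_mul, d_mul, hdb, d_sgn, hdb, sgn_sgn, map_sub,
    map_mul, map_mul, hx]
  simp

-- The commutator of `c` with an invariant element is invariant, because the summand 1 in `g c = c +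
-- 1` is central.
omit hs hg hn hq he hw hx hnA hsc hsw in
lemma cyclic_odd_central {b : B} (hb : d b = 0) : ∃ b', y * b - sgn b * y = d b' := by
  have hgι : ∀ b, g (ι b) = ι b := fun b ↦ (hfix _).mpr ⟨b, rfl⟩
  have hdb : d (ι b) = 0 := by rw [← hι.map_d, hb, map_zero]
  obtain ⟨b', hb'⟩ := (hfix (c * ι b - ι b * c)).mp (by
    rw [map_sub, map_mul, map_mul, hgι, hc]
    noncomm_ring)
  refine ⟨b', hinj ?_⟩
  rw [hι.map_d, hb', map_sub (d (A := A)), d_mul, d_mul, hdb, map_sub, map_mul, map_mul, hy, hι.map_sgn]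
  simp

/-- The cohomology of the invariants of a cyclic group acting on a differential graded ring, in the
presence of a norm `1` element, is Frobenius regular if the cohomology of the ring is so and lifts
multiplicatively to invariants. -/
theorem IsRegular.of_cyclic {p : ℕ} [Fact p.Prime] (h₀ : IsRegular p A₀) (hpB : (p : B) = 0)
    (hsgn : p = 2 → ∀ b : B, sgn b = b)
    (hyy : p = 2 → ∃ q, y * y = d q ∨ y * y = x + d q) : IsRegular p B := by
  have hdy : d y = 0 := hinj (by rw [hι.map_d, hy, d_d, map_zero])
  have hdx : d x = 0 := hinj (by rw [hι.map_d, hx, d_d, map_zero])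
  have hsy : sgn y = -y := hinj (by
    rw [hι.map_sgn, hy, ← neg_eq_iff_eq_neg.mpr (d_sgn c), hsc, map_neg, hy])
  have hsx : sgn x = x := hinj (by
    rw [hι.map_sgn, hx, ← neg_eq_iff_eq_neg.mpr (d_sgn w), hsw, map_neg, neg_neg])
  let X : cocycles B := ⟨x, hdx⟩
  let Y : cocycles B := ⟨y, hdy⟩
  have hrep : ∀ b : cocycles B, ∃ N, trunc N (b : B) = b := fun b ↦ exists_trunc _
  -- Level `N` of the filtration holds the classes with a representative in degrees below `N`.
  refine IsFrobeniusRegular.step (F := fun N ↦ {h | ∃ z : cocycles B, trunc N (z : B) = z ∧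
    cls B z = h}) hs.cohomologyMap (x := cls B X) (y := cls B Y) h₀
    (fun r ↦ ?_) ?_ ?_ (fun a ↦ ?_) (fun a ↦ ?_) (fun a ↦ ?_) ?_ (fun h ↦ ?_) ?_ ?_ ?_
    (fun h2 a ↦ ?_) (fun h2 ↦ ?_)
  · obtain ⟨z, rfl⟩ := cls_surjective r
    exact congrArg (cls B) (Subtype.ext (hs.map_sgn _).symm)
  · exact congrArg (cls B) (Subtype.ext hsx)
  · rw [← map_neg]
    exact congrArg (cls B) (Subtype.ext hsy)
  · obtain ⟨z, rfl⟩ := cls_surjective a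
    exact congrArg (cls B) (Subtype.ext (sgn_sgn _))
  · obtain ⟨z, rfl⟩ := cls_surjective a
    rw [← map_mul, ← map_mul, ← sub_eq_zero, ← map_sub, cls_eq_zero_iff]
    obtain ⟨b', hb'⟩ := cyclic_even_central hι hinj hfix hg hn he hw hx
      z.2
    exact ⟨b', hb'.symm⟩
  · obtain ⟨z, rfl⟩ := cls_surjective a
    rw [cohomologySgn_cls, ← map_mul, ← map_mul, ← sub_eq_zero, ← map_sub, cls_eq_zero_iff]
    obtain ⟨b', hb'⟩ := cyclic_odd_central hι hinj hfix hc hy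
      z.2
    exact ⟨b', hb'.symm⟩
  · rintro h ⟨z, hz, rfl⟩
    rw [trunc_zero] at hz
    rw [show z = 0 from Subtype.ext hz.symm, map_zero]
  · obtain ⟨z, rfl⟩ := cls_surjective h
    obtain ⟨N, hN⟩ := hrep z
    exact ⟨N, z, hN, rfl⟩
  · rintro N h ⟨z, hz, rfl⟩
    obtain ⟨r, r', β, b', hr, hr', hβ, hβN, e⟩ := cyclic_generation hs hι hinj hfix hg hn hq he hc
      hw hy hx hnA z.2 hz
    refine ⟨cls A₀ ⟨r, hr⟩, cls A₀ ⟨r', hr'⟩, cls B ⟨β, hβ⟩, ⟨_, hβN, rfl⟩, ?_⟩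
    rw [hs.cohomologyMap_cls, hs.cohomologyMap_cls, ← map_mul, ← map_mul, ← map_add, ← map_add]
    exact cls_eq_of_eq_add e
  · intro r r' β h
    obtain ⟨r, rfl⟩ := cls_surjective r
    obtain ⟨r', rfl⟩ := cls_surjective r'
    obtain ⟨β, rfl⟩ := cls_surjective β
    rw [hs.cohomologyMap_cls, hs.cohomologyMap_cls, ← map_mul, ← map_mul, ← map_add, ← map_add,
      cls_eq_zero_iff] at h
    obtain ⟨b, hb⟩ := h
    obtain ⟨⟨a₁, h₁⟩, ⟨a₂, h₂⟩, ⟨a₃, h₃⟩⟩ := cyclic_injectivity hs hι hinj hfix hg hn hq he hc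
      hw hy hx hnA hsc r.2 r'.2 β.2 hb.symm
    exact ⟨cls_eq_zero_iff.mpr ⟨a₁, h₁.symm⟩, cls_eq_zero_iff.mpr ⟨a₂, h₂.symm⟩,
      cls_eq_zero_iff.mpr ⟨a₃, h₃.symm⟩⟩
  · rw [← map_natCast (cls B), ← map_zero (cls B)]
    exact congrArg (cls B) (Subtype.ext (by simpa using hpB))
  · obtain ⟨z, rfl⟩ := cls_surjective a
    exact congrArg (cls B) (Subtype.ext (hsgn h2 _))
  · obtain ⟨q, hq' | hq'⟩ := hyy h2
    · left
      rw [← map_mul, cls_eq_zero_iff]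
      exact ⟨q, hq'.symm⟩
    · right
      rw [← map_mul]
      exact cls_eq_of_eq_add hq'

end Cyclic

end DGRing

/-! ## Cochains of simplicial sets as differential graded rings -/

namespace SSet

/-- Row 0 and column 0 of `F` cancel by the case `i = 0` of `h`; what is left is the shifted array,
up to sign, and induction applies. With the simplicial identity for `h`, this is `d ∘ d = 0`. -/
lemma alternating_sum_sum_eq_zero {R : Type*} [CommRing R] (m : ℕ) (F : Fin (m + 1) → Fin m → R)
    (h : ∀ i j : Fin m, i ≤ j → F j.succ i = F i.castSucc j) :
    ∑ k : Fin (m + 1), (-1) ^ (k : ℕ) * ∑ j : Fin m, (-1) ^ (j : ℕ) * F k j = 0 := by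
  induction m with
  | zero => simp
  | succ m ih =>
    have ih := ih (fun k j ↦ F k.succ j.succ) fun i j hij ↦ by
      have := h i.succ j.succ (by simpa using hij)
      simpa using this
    have h0 : ∀ j : Fin (m + 1), F j.succ 0 = F 0 j := fun j ↦ h 0 j (Fin.zero_le _)
    rw [Fin.sum_univ_succ]
    have e : ∀ k : Fin (m + 1), (-1 : R) ^ (k.succ : ℕ) * ∑ j : Fin (m + 1), (-1) ^ (j : ℕ) *
        F k.succ j = (-1) ^ (k : ℕ) * (∑ j : Fin m, (-1) ^ (j : ℕ) * F k.succ j.succ) -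
          (-1) ^ (k : ℕ) * F 0 k := fun k ↦ by
      have : ∑ j : Fin m, (-1 : R) ^ ((j.succ : Fin (m + 1)) : ℕ) * F k.succ j.succ =
          -∑ j : Fin m, (-1 : R) ^ (j : ℕ) * F k.succ j.succ := by
        rw [← Finset.sum_neg_distrib]
        exact Finset.sum_congr rfl fun j _ ↦ by rw [Fin.val_succ, pow_succ]; ring
      rw [Fin.sum_univ_succ, h0, this, Fin.val_succ, pow_succ]
      simp only [Fin.val_zero, pow_zero]
      ring
    rw [Finset.sum_congr rfl fun k _ ↦ e k, Finset.sum_sub_distrib, ih]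
    simp

variable {X Y : SSet.{u}} {R : Type v} [CommRing R]

lemma Cochain.d_apply {n : ℕ} (f : X.Cochain R n) (σ : X _⦋n + 1⦌) :
    Cochain.d n f σ = ∑ k : Fin (n + 2), (-1) ^ (k : ℕ) * f (X.δ k σ) := rfl

lemma Cochain.d_d {n : ℕ} (f : X.Cochain R n) : Cochain.d (n + 1) (Cochain.d n f) = 0 := by
  funext σ
  refine alternating_sum_sum_eq_zero (n + 2) (fun k j ↦ f (X.δ j (X.δ k σ))) fun i j hij ↦ ?_
  exact congrArg f (SSet.δ_comp_δ_apply hij σ)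

lemma coboundary_coboundary (a : X.Cochains R) : coboundary (coboundary a) = 0 := by
  induction a using DirectSum.induction_on with
  | zero => simp
  | add a a' ha ha' => simp only [map_add, ha, ha', add_zero]
  | of i f => rw [coboundary_of, coboundary_of, Cochain.d_d, map_zero]

lemma signInvolution_mul (a b : X.Cochains R) :
    signInvolution (a * b) = signInvolution a * signInvolution b := by
  induction a using DirectSum.induction_on with
  | zero => simp
  | add a a' ha ha' => simp only [map_add, add_mul, ha, ha']
  | of i f =>
    induction b using DirectSum.induction_on with
    | zero => simp
    | add b b' hb hb' => simp only [map_add, mul_add, hb, hb']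
    | of j g =>
      rw [← of_cup rfl, signInvolution_of, signInvolution_of, signInvolution_of, of_cup rfl,
        smul_mul_smul_comm, pow_add]

lemma signInvolution_one : signInvolution (1 : X.Cochains R) = 1 := by
  refine (signInvolution_of _).trans ?_
  rw [pow_zero, one_smul]
  rfl

/-- The projection to the components of degree less than `N`. -/
noncomputable def cochainsTrunc (N : ℕ) : X.Cochains R →+ X.Cochains R :=
  DirectSum.toAddMonoid fun n ↦ if n < N then DirectSum.of (X.Cochain R) n else 0

lemma cochainsTrunc_of (N : ℕ) {n : ℕ} (f : X.Cochain R n) :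
    cochainsTrunc N (DirectSum.of (X.Cochain R) n f) =
      if n < N then DirectSum.of (X.Cochain R) n f else 0 := by
  rw [cochainsTrunc, DirectSum.toAddMonoid_of]
  split_ifs <;> rfl

lemma cochainsTrunc_cochainsTrunc (M N : ℕ) (a : X.Cochains R) :
    cochainsTrunc M (cochainsTrunc N a) = cochainsTrunc (min M N) a := by
  induction a using DirectSum.induction_on with
  | zero => simp
  | add a a' ha ha' => simp only [map_add, ha, ha']
  | of i f =>
    rw [cochainsTrunc_of, cochainsTrunc_of]
    by_cases h : i < N
    · simp [h, cochainsTrunc_of]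
    · simp [h]

noncomputable instance : DGRing (X.Cochains R) where
  d := coboundary
  sgn := { signInvolution with
    map_one' := signInvolution_one
    map_mul' := signInvolution_mul }
  trunc := cochainsTrunc
  d_mul := coboundary_mul
  d_d := coboundary_coboundary
  sgn_sgn := signInvolution_signInvolution
  d_sgn := coboundary_signInvolution
  trunc_zero a := by
    induction a using DirectSum.induction_on with
    | zero => simp
    | add a a' ha ha' => rw [map_add, ha, ha', add_zero]
    | of i f => simp [cochainsTrunc_of]
  trunc_trunc N a := by rw [cochainsTrunc_cochainsTrunc, min_self]
  d_trunc N a := by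
    induction a using DirectSum.induction_on with
    | zero => simp
    | add a a' ha ha' => simp only [map_add, ha, ha']
    | of i f =>
      rw [cochainsTrunc_of, coboundary_of, cochainsTrunc_of]
      by_cases h : i < N <;> simp [h, coboundary_of]
  exists_trunc a := by
    induction a using DirectSum.induction_on with
    | zero => exact ⟨0, map_zero _⟩
    | add a a' ha ha' =>
      obtain ⟨N, hN⟩ := ha
      obtain ⟨M, hM⟩ := ha'
      refine ⟨max N M, ?_⟩
      nth_rewrite 1 [← hN, ← hM]
      rw [map_add, cochainsTrunc_cochainsTrunc, cochainsTrunc_cochainsTrunc,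
        min_eq_right (le_max_left N M), min_eq_right (le_max_right N M), hN, hM]
    | of i f => exact ⟨i + 1, by simp [cochainsTrunc_of]⟩

lemma dgRing_d_of {n : ℕ} (f : X.Cochain R n) :
    DGRing.d (DirectSum.of (X.Cochain R) n f) =
      DirectSum.of (X.Cochain R) (n + 1) (Cochain.d n f) := coboundary_of f

lemma dgRing_sgn_of {n : ℕ} (f : X.Cochain R n) :
    DGRing.sgn (DirectSum.of (X.Cochain R) n f) =
      (-1 : ℤ) ^ n • DirectSum.of (X.Cochain R) n f := signInvolution_of f

lemma dgRing_trunc_of (N : ℕ) {n : ℕ} (f : X.Cochain R n) :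
    DGRing.trunc N (DirectSum.of (X.Cochain R) n f) =
      if n < N then DirectSum.of (X.Cochain R) n f else 0 := cochainsTrunc_of N f

lemma cochainsMap_isDGHom (φ : X ⟶ Y) : DGRing.IsDGHom (cochainsMap R φ) where
  map_d := cochainsMap_coboundary R φ
  map_sgn a := by
    induction a using DirectSum.induction_on with
    | zero => simp
    | add a a' ha ha' => simp only [map_add, ha, ha']
    | of i f => rw [dgRing_sgn_of, map_zsmul, cochainsMap_of, dgRing_sgn_of]
  map_trunc N a := by
    induction a using DirectSum.induction_on with
    | zero => simp
    | add a a' ha ha' => simp only [map_add, ha, ha']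
    | of i f =>
      rw [dgRing_trunc_of, cochainsMap_of, dgRing_trunc_of]
      split_ifs
      · rw [cochainsMap_of]
      · rw [map_zero]

lemma cochainsMap_comp {Z : SSet.{u}} (φ : X ⟶ Y) (ψ : Y ⟶ Z) (a : Z.Cochains R) :
    cochainsMap R (φ ≫ ψ) a = cochainsMap R φ (cochainsMap R ψ a) := by
  induction a using DirectSum.induction_on with
  | zero => simp
  | add a a' ha ha' => simp only [map_add, ha, ha']
  | of i f =>
    rw [cochainsMap_of, cochainsMap_of, cochainsMap_of]
    rfl

lemma cochainsMap_id (a : X.Cochains R) : cochainsMap R (𝟙 X) a = a := by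
  induction a using DirectSum.induction_on with
  | zero => simp
  | add a a' ha ha' => simp only [map_add, ha, ha']
  | of i f =>
    rw [cochainsMap_of]
    rfl

lemma cochainsMap_apply (φ : X ⟶ Y) (a : Y.Cochains R) (n : ℕ) (σ : X _⦋n⦌) :
    cochainsMap R φ a n σ = a n (φ.app _ σ) := by
  induction a using DirectSum.induction_on with
  | zero => rw [map_zero]; rfl
  | add a a' ha ha' =>
    rw [map_add, DirectSum.add_apply, DirectSum.add_apply]
    exact congrArg₂ (· + ·) ha ha'
  | of i f =>
    rw [cochainsMap_of]
    by_cases h : i = n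
    · subst h
      rw [DirectSum.of_eq_same, DirectSum.of_eq_same]
      rfl
    · rw [DirectSum.of_eq_of_ne _ _ _ (Ne.symm h), DirectSum.of_eq_of_ne _ _ _ (Ne.symm h)]
      rfl

lemma cochains_ext {a b : X.Cochains R} (h : ∀ n (σ : X _⦋n⦌), a n σ = b n σ) : a = b :=
  DFinsupp.ext fun n ↦ funext (h n)

/-! ## Invariant cochains -/

/-- The cochains invariant under a set of endomorphisms. -/
noncomputable def invariants (Φ : Set (X ⟶ X)) (R : Type v) [CommRing R] :
    Subring (X.Cochains R) where
  carrier := {a | ∀ φ ∈ Φ, cochainsMap R φ a = a}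
  mul_mem' ha hb φ hφ := by rw [map_mul, ha φ hφ, hb φ hφ]
  one_mem' φ _ := map_one _
  add_mem' ha hb φ hφ := by rw [map_add, ha φ hφ, hb φ hφ]
  zero_mem' φ _ := map_zero _
  neg_mem' ha φ hφ := by rw [map_neg, ha φ hφ]

variable {Φ : Set (X ⟶ X)} {Ψ : Set (Y ⟶ Y)}

lemma of_mem_invariants {n : ℕ} {f : X.Cochain R n}
    (hf : ∀ φ ∈ Φ, ∀ σ : X _⦋n⦌, f (φ.app _ σ) = f σ) :
    DirectSum.of (X.Cochain R) n f ∈ invariants Φ R := fun φ hφ ↦ by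
  rw [cochainsMap_of]
  exact congrArg _ (funext (hf φ hφ))

noncomputable instance : DGRing (invariants Φ R) where
  d := (DGRing.d.comp (invariants Φ R).subtype.toAddMonoidHom).codRestrict
    (invariants Φ R).toAddSubgroup fun a φ hφ ↦ by
      change cochainsMap R φ (DGRing.d (a : X.Cochains R)) = DGRing.d (a : X.Cochains R)
      rw [(cochainsMap_isDGHom φ).map_d, a.2 φ hφ]
  sgn := DGRing.sgn.restrict _ _ fun a ha φ hφ ↦ by
    rw [(cochainsMap_isDGHom φ).map_sgn, ha φ hφ]
  trunc N := ((DGRing.trunc N).comp (invariants Φ R).subtype.toAddMonoidHom).codRestrict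
    (invariants Φ R).toAddSubgroup fun a φ hφ ↦ by
      change cochainsMap R φ (DGRing.trunc N (a : X.Cochains R)) = DGRing.trunc N (a : X.Cochains R)
      rw [(cochainsMap_isDGHom φ).map_trunc, a.2 φ hφ]
  d_mul _ _ := Subtype.ext (DGRing.d_mul _ _)
  d_d _ := Subtype.ext (DGRing.d_d _)
  sgn_sgn _ := Subtype.ext (DGRing.sgn_sgn _)
  d_sgn _ := Subtype.ext (DGRing.d_sgn _)
  trunc_zero _ := Subtype.ext (DGRing.trunc_zero _)
  trunc_trunc _ _ := Subtype.ext (DGRing.trunc_trunc _ _)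
  d_trunc _ _ := Subtype.ext (DGRing.d_trunc _ _)
  exists_trunc a := (DGRing.exists_trunc (a : X.Cochains R)).imp fun _ h ↦ Subtype.ext h

/-- The restriction to invariants of a ring homomorphism that commutes with the structure of
differential graded rings. -/
lemma isDGHom_restrict {f : X.Cochains R →+* Y.Cochains R} (hf : DGRing.IsDGHom f)
    (h : ∀ a ∈ invariants Φ R, f a ∈ invariants Ψ R) :
    DGRing.IsDGHom (f.restrict (invariants Φ R) (invariants Ψ R) h) where
  map_d _ := Subtype.ext (hf.map_d _)
  map_sgn _ := Subtype.ext (hf.map_sgn _)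
  map_trunc _ _ := Subtype.ext (hf.map_trunc _ _)

lemma cochainsMap_mem_invariants {φ : X ⟶ Y}
    (h : ∀ α ∈ Φ, ∃ β ∈ Ψ, α ≫ φ = φ ≫ β) {a : Y.Cochains R} (ha : a ∈ invariants Ψ R) :
    cochainsMap R φ a ∈ invariants Φ R := fun α hα ↦ by
  obtain ⟨β, hβ, e⟩ := h α hα
  rw [← cochainsMap_comp, e, cochainsMap_comp, ha β hβ]

end SSet

/-! ## Simplicial sets with a free action and a cone operator -/

namespace SSet

/-- The simplicial set whose `n`-simplices are the `(n + 1)`-tuples of elements of `T`. -/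
def tuples (T : Type u) : SSet.{u} where
  obj n := Fin (n.unop.len + 1) → T
  map f := TypeCat.ofHom fun σ i ↦ σ (f.unop.toOrderHom i)

/-- The simplex of `tuples T` with given vertices. -/
def tuplesMk {T : Type u} {n : ℕ} (t : Fin (n + 1) → T) : (tuples T) _⦋n⦌ := t

/-- The vertices of a simplex of `tuples T`. -/
def tuplesVertex {T : Type u} {n : ℕ} (t : (tuples T) _⦋n⦌) : Fin (n + 1) → T := t

/-- The map of simplicial sets `tuples T ⟶ tuples T'` induced by a map `T → T'`. -/
def tuplesMap {T T' : Type u} (f : T → T') : tuples T ⟶ tuples T' where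
  app _ := TypeCat.ofHom fun t i ↦ f (t i)

/-- The vertices of a simplex. -/
def vertex {X : SSet.{u}} {n : SimplexCategory} (i : Fin (n.len + 1)) (σ : X.obj (Opposite.op n)) :
    X _⦋0⦌ :=
  X.map (SimplexCategory.const ⦋0⦌ n i).op σ

lemma vertex_map {X : SSet.{u}} {m n : SimplexCategory} (f : m ⟶ n) (i : Fin (m.len + 1))
    (σ : X.obj (Opposite.op n)) :
    vertex i (X.map f.op σ) = vertex (f.toOrderHom i) σ := by
  change (X.map f.op ≫ X.map _) σ = _
  rw [← X.map_comp, ← op_comp]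
  rfl

lemma vertex_app {X Y : SSet.{u}} (φ : X ⟶ Y) {n : SimplexCategory} (i : Fin (n.len + 1))
    (σ : X.obj (Opposite.op n)) :
    vertex i (φ.app _ σ) = φ.app _ (vertex i σ) :=
  (NatTrans.naturality_apply φ _ σ).symm

lemma vertex_zero {X : SSet.{u}} (σ : X _⦋0⦌) : vertex (n := ⦋0⦌) 0 σ = σ := by
  have : SimplexCategory.const ⦋0⦌ ⦋0⦌ 0 = 𝟙 _ := Subsingleton.elim _ _
  rw [vertex, this]
  simp

/-- The map to `tuples T` that extends a map from vertices to `T`. -/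
def toTuples {X : SSet.{u}} {T : Type u} (ρ : X _⦋0⦌ → T) : X ⟶ tuples T where
  app n := TypeCat.ofHom fun (σ : X.obj (Opposite.op n.unop)) i ↦ ρ (vertex i σ)
  naturality m n f := by
    ext σ
    funext i
    exact congrArg ρ (vertex_map f.unop i σ)

lemma tuplesVertex_toTuples {X : SSet.{u}} {T : Type u} (ρ : X _⦋0⦌ → T) {n : ℕ} (σ : X _⦋n⦌)
    (i : Fin (n + 1)) :
    tuplesVertex ((toTuples ρ).app _ σ) i = ρ (vertex (n := ⦋n⦌) i σ) := rfl

/-- An action of a group on a simplicial set. -/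
structure GroupAction (G : Type w) [Group G] (X : SSet.{u}) where
  hom : G → (X ⟶ X)
  hom_one : hom 1 = 𝟙 X
  hom_mul (g h : G) : hom (g * h) = hom h ≫ hom g

namespace GroupAction

variable {G : Type w} [Group G] {X : SSet.{u}} (act : GroupAction G X)

/-- The action of an element on simplices. -/
def smul {n : ℕ} (g : G) (σ : X _⦋n⦌) : X _⦋n⦌ := (act.hom g).app _ σ

lemma one_smul {n : ℕ} (σ : X _⦋n⦌) : act.smul 1 σ = σ := by
  rw [smul, act.hom_one]
  rfl

lemma mul_smul {n : ℕ} (g h : G) (σ : X _⦋n⦌) : act.smul (g * h) σ = act.smul g (act.smul h σ) := by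
  rw [smul, act.hom_mul]
  rfl

lemma δ_smul {n : ℕ} (k : Fin (n + 2)) (g : G) (σ : X _⦋n + 1⦌) :
    X.δ k (act.smul g σ) = act.smul g (X.δ k σ) := (SSet.δ_naturality_apply _ _ _).symm

lemma inv_smul_smul {n : ℕ} (g : G) (σ : X _⦋n⦌) : act.smul g⁻¹ (act.smul g σ) = σ := by
  rw [← mul_smul, inv_mul_cancel, one_smul]

lemma smul_inv_smul {n : ℕ} (g : G) (σ : X _⦋n⦌) : act.smul g (act.smul g⁻¹ σ) = σ := by
  rw [← mul_smul, mul_inv_cancel, one_smul]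

/-- The invariant cochains. -/
noncomputable abbrev inv (R : Type v) [CommRing R] : Subring (X.Cochains R) :=
  invariants (Set.range act.hom) R

/-- The action of `G` on tuples that is induced by an action of `G` on `T`. -/
def ofMulAction (T : Type u) [MulAction G T] : GroupAction G (tuples T) where
  hom g := tuplesMap fun t ↦ g • t
  hom_one := by
    ext n t
    exact funext fun i ↦ MulAction.one_smul _
  hom_mul g h := by
    ext n t
    exact funext fun i ↦ SemigroupAction.mul_smul _ _ _

end GroupAction

/-- A cone operator on a simplicial set. -/
structure Cone (X : SSet.{u}) where
  pt : X _⦋0⦌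
  cone {n : ℕ} (σ : X _⦋n⦌) : X _⦋n + 1⦌
  δ_zero {n : ℕ} (σ : X _⦋n⦌) : X.δ 0 (cone σ) = σ
  δ_succ {n : ℕ} (σ : X _⦋n + 1⦌) (j : Fin (n + 2)) : X.δ j.succ (cone σ) = cone (X.δ j σ)
  δ_one (σ : X _⦋0⦌) : X.δ 1 (cone σ) = pt

/-- The cone operator on tuples that adds a fixed first vertex. -/
def tuplesCone {T : Type u} (t₀ : T) : Cone (tuples T) where
  pt := tuplesMk fun _ ↦ t₀
  cone t := tuplesMk (Fin.cons t₀ (tuplesVertex t))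
  δ_zero t := rfl
  δ_succ {n} t j := by
    funext i
    refine Fin.cases ?_ (fun i ↦ ?_) i
    · rfl
    · change Fin.cons (α := fun _ ↦ T) t₀ (tuplesVertex t) (j.succ.succAbove i.succ) = _
      rw [Fin.succ_succAbove_succ]
      rfl
  δ_one t := by
    funext i
    obtain rfl : i = 0 := Subsingleton.elim (α := Fin 1) _ _
    rfl

/-! ### Comparison with tuples of group elements -/

section Comparison

variable {G : Type u} [Group G] {X : SSet.{u}} (act : GroupAction G X) (K : Cone X)
  (ρ : X _⦋0⦌ → G)

/-- The translate of the cone operator by a group element. -/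
def cone {n : ℕ} (g : G) (σ : X _⦋n⦌) : X _⦋n + 1⦌ := act.smul g (K.cone (act.smul g⁻¹ σ))

lemma δ_zero_cone {n : ℕ} (g : G) (σ : X _⦋n⦌) : X.δ 0 (cone act K g σ) = σ := by
  rw [cone, act.δ_smul, K.δ_zero, act.smul_inv_smul]

lemma δ_succ_cone {n : ℕ} (g : G) (σ : X _⦋n + 1⦌) (j : Fin (n + 2)) :
    X.δ j.succ (cone act K g σ) = cone act K g (X.δ j σ) := by
  rw [cone, act.δ_smul, K.δ_succ, act.δ_smul, cone]

lemma δ_one_cone (g : G) (σ : X _⦋0⦌) : X.δ 1 (cone act K g σ) = act.smul g K.pt := by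
  rw [cone, act.δ_smul, K.δ_one]

lemma smul_cone {n : ℕ} (h g : G) (σ : X _⦋n⦌) :
    act.smul h (cone act K g σ) = cone act K (h * g) (act.smul h σ) := by
  rw [cone, cone, mul_inv_rev, act.mul_smul, act.mul_smul, act.inv_smul_smul]

/-- The iterated cone over the vertices of a tuple. -/
def ofTuple (n : ℕ) (t : Fin (n + 1) → G) : X _⦋n⦌ :=
  match n with
  | 0 => act.smul (t 0) K.pt
  | n + 1 => cone act K (t 0) (ofTuple n fun i ↦ t i.succ)

/-- Face 0 of a cone is its base and the other faces are cones over faces of the base. Compatibility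
with faces is all that a cochain map needs. -/
lemma δ_ofTuple {n : ℕ} (t : Fin (n + 2) → G) (j : Fin (n + 2)) :
    X.δ j (ofTuple act K (n + 1) t) = ofTuple act K n fun i ↦ t (j.succAbove i) := by
  induction n with
  | zero =>
    refine Fin.cases ?_ (fun j ↦ ?_) j
    · exact δ_zero_cone _ _ _ _
    · obtain rfl : j = 0 := Subsingleton.elim (α := Fin 1) _ _
      exact δ_one_cone _ _ _ _
  | succ n ih =>
    refine Fin.cases ?_ (fun j ↦ ?_) j
    · rw [ofTuple, δ_zero_cone]; rfl
    · rw [ofTuple, δ_succ_cone, ih, ofTuple]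
      simp only [Fin.succ_succAbove_succ]
      rfl

lemma smul_ofTuple {n : ℕ} (g : G) (t : Fin (n + 1) → G) :
    act.smul g (ofTuple act K n t) = ofTuple act K n fun i ↦ g * t i := by
  induction n with
  | zero => rw [ofTuple, ofTuple, act.mul_smul]
  | succ n ih => rw [ofTuple, ofTuple, smul_cone, ih]

variable {ρ} (hρ : ∀ g v, ρ (act.smul g v) = g * ρ v) (hpt : ρ K.pt = 1)

lemma vertex_smul {n : ℕ} (g : G) (σ : X _⦋n⦌) (i : Fin (n + 1)) :
    vertex (n := ⦋n⦌) i (act.smul g σ) = act.smul g (vertex (n := ⦋n⦌) i σ) := vertex_app _ _ _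

lemma vertex_δ {n : ℕ} (σ : X _⦋n + 1⦌) (k : Fin (n + 2)) (i : Fin (n + 1)) :
    vertex (n := ⦋n⦌) i (X.δ k σ) = vertex (n := ⦋n + 1⦌) (k.succAbove i) σ :=
  vertex_map (SimplexCategory.δ k) i σ

include hρ hpt in
lemma vertex_ofTuple {n : ℕ} (t : Fin (n + 1) → G) (i : Fin (n + 1)) :
    ρ (vertex (n := ⦋n⦌) i (ofTuple act K n t)) = t i := by
  induction n with
  | zero =>
    obtain rfl : i = 0 := Subsingleton.elim (α := Fin 1) _ _
    rw [vertex_zero, ofTuple, hρ, hpt, mul_one]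
  | succ n ih =>
    refine Fin.cases ?_ (fun i ↦ ?_) i
    · have := ih (fun i ↦ t ((Fin.last _).succAbove i)) 0
      rw [← δ_ofTuple, vertex_δ] at this
      simpa using this
    · have := ih (fun i ↦ t ((0 : Fin (n + 2)).succAbove i)) i
      rw [← δ_ofTuple, vertex_δ] at this
      simpa using this

variable {R : Type v} [CommRing R] (ρ)

/-- The pullback of cochains along the cone operator. -/
def coneCochain {n : ℕ} (g : G) : X.Cochain R (n + 1) →+ X.Cochain R n where
  toFun f := fun σ ↦ f (cone act K g σ)
  map_zero' := rfl
  map_add' _ _ := rfl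

/-- The homotopy operator, given by the prisms that join a simplex `σ` to the iterated cone over the
images under `ρ` of its vertices. -/
def prism (n : ℕ) (f : X.Cochain R (n + 1)) : X.Cochain R n :=
  match n with
  | 0 => fun σ ↦ f (cone act K (ρ σ) σ)
  | n + 1 => fun σ ↦ f (cone act K (ρ (vertex (n := ⦋n + 1⦌) 0 σ)) σ) -
      prism n (coneCochain act K (ρ (vertex (n := ⦋n + 1⦌) 0 σ)) f) (X.δ 0 σ)

lemma prism_succ {n : ℕ} (f : X.Cochain R (n + 2)) (σ : X _⦋n + 1⦌) :
    prism act K ρ (n + 1) f σ = f (cone act K (ρ (vertex (n := ⦋n + 1⦌) 0 σ)) σ) -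
      prism act K ρ n (coneCochain act K (ρ (vertex (n := ⦋n + 1⦌) 0 σ)) f) (X.δ 0 σ) := rfl

lemma prism_add {n : ℕ} (f f' : X.Cochain R (n + 1)) (σ : X _⦋n⦌) :
    prism act K ρ n (f + f') σ = prism act K ρ n f σ + prism act K ρ n f' σ := by
  induction n with
  | zero => rfl
  | succ n ih =>
    rw [prism_succ, prism_succ, prism_succ, map_add, ih]
    exact add_sub_add_comm _ _ _ _

/-- The homotopy operator as an additive map. -/
def prismHom (n : ℕ) : X.Cochain R (n + 1) →+ X.Cochain R n :=
  AddMonoidHom.mk' (fun f ↦ prism act K ρ n f) fun f f' ↦ funext fun σ ↦ prism_add act K ρ f f' σ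

lemma prism_sub {n : ℕ} (f f' : X.Cochain R (n + 1)) (σ : X _⦋n⦌) :
    prism act K ρ n (f - f') σ = prism act K ρ n f σ - prism act K ρ n f' σ :=
  congrFun (map_sub (prismHom act K ρ n) f f') σ

variable {ρ}

-- Equivariance of `ρ` makes the apexes move with the simplex; hence the homotopy preserves
-- invariant cochains.
include hρ in
lemma prism_smul {n : ℕ} (f : X.Cochain R (n + 1)) (g : G) (σ : X _⦋n⦌) :
    prism act K ρ n f (act.smul g σ) =
      prism act K ρ n (Cochain.pullback (act.hom g) (n + 1) f) σ := by
  induction n with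
  | zero =>
    change f (cone act K (ρ (act.smul g σ)) (act.smul g σ)) = f (act.smul g (cone act K (ρ σ) σ))
    rw [hρ, smul_cone]
  | succ n ih =>
    rw [prism_succ, prism_succ, vertex_smul, hρ, act.δ_smul, ih, ← smul_cone]
    congr 2
    funext τ
    exact congrArg f (smul_cone act K _ _ _).symm

lemma d_cone {n : ℕ} (f : X.Cochain R (n + 1)) (g : G) :
    coneCochain act K g (Cochain.d (n + 1) f) = f - Cochain.d n (coneCochain act K g f) := by
  funext σ
  change ∑ k : Fin (n + 3), (-1) ^ (k : ℕ) * f (X.δ k (cone act K g σ)) =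
    f σ - ∑ k : Fin (n + 2), (-1) ^ (k : ℕ) * f (cone act K g (X.δ k σ))
  rw [Fin.sum_univ_succ, sub_eq_add_neg, ← Finset.sum_neg_distrib]
  simp only [Fin.val_zero, pow_zero, one_mul, δ_zero_cone, δ_succ_cone, Fin.val_succ, pow_succ]
  congr 1
  exact Finset.sum_congr rfl fun k _ ↦ by ring

lemma prism_d_zero (f : X.Cochain R 0) (σ : X _⦋0⦌) :
    prism act K ρ 0 (Cochain.d 0 f) σ = f σ -
      f (ofTuple act K 0 (tuplesVertex ((toTuples ρ).app _ σ))) := by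
  change ∑ k : Fin 2, (-1) ^ (k : ℕ) * f (X.δ k (cone act K (ρ σ) σ)) = _
  rw [Fin.sum_univ_two, δ_zero_cone, δ_one_cone, ofTuple, tuplesVertex_toTuples, vertex_zero]
  simp
  ring

omit [Group G] in
lemma toTuples_δ {n : ℕ} (σ : X _⦋n + 1⦌) (k : Fin (n + 2)) :
    tuplesVertex ((toTuples ρ).app _ (X.δ k σ)) =
      fun i ↦ tuplesVertex ((toTuples ρ).app _ σ) (k.succAbove i) := by
  funext i
  rw [tuplesVertex_toTuples, tuplesVertex_toTuples, vertex_δ]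

/-- All faces but the zeroth keep vertex 0 and so use the same apex `g`. Coning from `g` therefore
reduces the identity for `f` on `σ` to the one for the coned cochain on the zeroth face, one degree
lower. -/
lemma d_prism {n : ℕ} (f : X.Cochain R (n + 1)) (σ : X _⦋n + 1⦌) :
    Cochain.d n (prism act K ρ n f) σ + prism act K ρ (n + 1) (Cochain.d (n + 1) f) σ = f σ -
      f (ofTuple act K (n + 1) (tuplesVertex ((toTuples ρ).app _ σ))) := by
  set g := ρ (vertex (n := ⦋n + 1⦌) 0 σ) with hg
  have hQ : f (ofTuple act K (n + 1) (tuplesVertex ((toTuples ρ).app _ σ))) =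
      coneCochain act K g f (ofTuple act K n (tuplesVertex ((toTuples ρ).app _ (X.δ 0 σ)))) := by
    rw [toTuples_δ]
    rfl
  have hsucc : prism act K ρ (n + 1) (Cochain.d (n + 1) f) σ =
      f σ - Cochain.d n (coneCochain act K g f) σ -
        (prism act K ρ n f (X.δ 0 σ) - prism act K ρ n
          (Cochain.d n (coneCochain act K g f)) (X.δ 0 σ)) := by
    rw [prism_succ, d_cone, prism_sub]
    exact congrArg₂ (· - ·) (congrFun (d_cone act K f g) σ) rfl
  have hv : ∀ k : Fin (n + 1), vertex (n := ⦋n⦌) 0 (X.δ k.succ σ) = vertex (n := ⦋n + 1⦌) 0 σ := by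
    intro k
    rw [vertex_δ, Fin.succ_succAbove_zero]
  rw [hsucc, hQ]
  have hsum : ∀ f' : X.Cochain R n, Cochain.d n f' σ =
      f' (X.δ 0 σ) - ∑ k : Fin (n + 1), (-1) ^ (k : ℕ) * f' (X.δ k.succ σ) := fun f' ↦ by
    rw [Cochain.d_apply, Fin.sum_univ_succ, sub_eq_add_neg, ← Finset.sum_neg_distrib]
    simp only [Fin.val_zero, pow_zero, one_mul, Fin.val_succ, pow_succ]
    congr 1
    exact Finset.sum_congr rfl fun k _ ↦ by ring
  rw [hsum, hsum]
  cases n with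
  | zero =>
    have h1 : prism act K ρ 0 f (X.δ 1 σ) = coneCochain act K g f (X.δ 1 σ) := by
      have := hv 0
      rw [vertex_zero] at this
      change f (cone act K (ρ (X.δ 1 σ)) (X.δ 1 σ)) = f (cone act K g (X.δ 1 σ))
      rw [hg, ← this]
      rfl
    rw [prism_d_zero act K, Fin.sum_univ_one, Fin.sum_univ_one]
    simp only [Fin.succ_zero_eq_one, h1]
    ring
  | succ n =>
    have ih := d_prism (coneCochain act K g f) (X.δ 0 σ)
    have h1 : ∀ k : Fin (n + 2), prism act K ρ (n + 1) f (X.δ k.succ σ) =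
        coneCochain act K g f (X.δ k.succ σ) -
          prism act K ρ n (coneCochain act K g f) (X.δ k (X.δ 0 σ)) := fun k ↦ by
      rw [prism_succ, hv, SSet.δ_comp_δ_apply (Fin.zero_le k)]
      rfl
    simp only [h1, mul_sub, Finset.sum_sub_distrib]
    rw [Cochain.d_apply] at ih
    linear_combination ih


/-- The pullback of cochains along the iterated cones over tuples. -/
def tupleCochain {n : ℕ} : X.Cochain R n →+ (tuples G).Cochain R n where
  toFun f := fun t ↦ f (ofTuple act K n (tuplesVertex t))
  map_zero' := rfl
  map_add' _ _ := rfl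

variable (R) in
/-- The pullback along the iterated cones over tuples on the total complex. -/
noncomputable def restrictToTuples : X.Cochains R →+ (tuples G).Cochains R :=
  DirectSum.toAddMonoid fun n ↦ (DirectSum.of ((tuples G).Cochain R) n).comp (tupleCochain act K)

lemma restrictToTuples_of {n : ℕ} (f : X.Cochain R n) :
    restrictToTuples act K R (DirectSum.of (X.Cochain R) n f) =
      DirectSum.of ((tuples G).Cochain R) n (tupleCochain act K f) :=
  DirectSum.toAddMonoid_of _ _ _

lemma restrictToTuples_d (a : X.Cochains R) :
    restrictToTuples act K R (DGRing.d a) = DGRing.d (restrictToTuples act K R a) := by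
  induction a using DirectSum.induction_on with
  | zero => simp
  | add a a' ha ha' => simp only [map_add, ha, ha']
  | of n f =>
    rw [dgRing_d_of, restrictToTuples_of, restrictToTuples_of, dgRing_d_of]
    congr 1
    funext t
    change ∑ k : Fin (n + 2), (-1 : R) ^ (k : ℕ) * f _ = ∑ k : Fin (n + 2), (-1 : R) ^ (k : ℕ) * f _
    refine Finset.sum_congr rfl fun k _ ↦ ?_
    exact congrArg (fun σ ↦ (-1 : R) ^ (k : ℕ) * f σ) (δ_ofTuple act K (tuplesVertex t) k)

lemma restrictToTuples_mem_inv {a : X.Cochains R} (ha : a ∈ act.inv R) :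
    restrictToTuples act K R a ∈ (GroupAction.ofMulAction (G := G) G).inv R := by
  rintro _ ⟨g, rfl⟩
  have h : ∀ a : X.Cochains R, cochainsMap R ((GroupAction.ofMulAction (G := G) G).hom g)
      (restrictToTuples act K R a) = restrictToTuples act K R (cochainsMap R (act.hom g) a) := by
    intro a
    induction a using DirectSum.induction_on with
    | zero => simp
    | add a a' ha ha' => simp only [map_add, ha, ha']
    | of n f =>
      rw [restrictToTuples_of, cochainsMap_of, cochainsMap_of, restrictToTuples_of]
      congr 1
      funext t
      exact congrArg f (smul_ofTuple act K g (tuplesVertex t)).symm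
  rw [h, ha _ ⟨g, rfl⟩]

variable (R ρ) in
/-- The homotopy operator on the total complex. -/
noncomputable def totalPrism : X.Cochains R →+ X.Cochains R :=
  DirectSum.toAddMonoid fun n ↦ match n with
    | 0 => 0
    | n + 1 => (DirectSum.of (X.Cochain R) n).comp (prismHom act K ρ n)

lemma totalPrism_of_zero (f : X.Cochain R 0) :
    totalPrism act K ρ R (DirectSum.of (X.Cochain R) 0 f) = 0 := by
  rw [totalPrism, DirectSum.toAddMonoid_of]
  rfl

lemma totalPrism_of_succ {n : ℕ} (f : X.Cochain R (n + 1)) :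
    totalPrism act K ρ R (DirectSum.of (X.Cochain R) (n + 1) f) =
      DirectSum.of (X.Cochain R) n (prism act K ρ n f) := by
  rw [totalPrism, DirectSum.toAddMonoid_of]
  rfl

include hρ in
lemma totalPrism_mem_inv {a : X.Cochains R} (ha : a ∈ act.inv R) :
    totalPrism act K ρ R a ∈ act.inv R := by
  rintro _ ⟨g, rfl⟩
  have h : ∀ a : X.Cochains R, cochainsMap R (act.hom g) (totalPrism act K ρ R a) =
      totalPrism act K ρ R (cochainsMap R (act.hom g) a) := by
    intro a
    induction a using DirectSum.induction_on with
    | zero => simp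
    | add a a' ha ha' => simp only [map_add, ha, ha']
    | of n f =>
      cases n with
      | zero => rw [totalPrism_of_zero, cochainsMap_of, totalPrism_of_zero, map_zero]
      | succ n =>
        rw [totalPrism_of_succ, cochainsMap_of, cochainsMap_of, totalPrism_of_succ]
        congr 1
        funext σ
        exact prism_smul act K hρ f g σ
  rw [h, ha _ ⟨g, rfl⟩]

lemma d_totalPrism (a : X.Cochains R) :
    DGRing.d (totalPrism act K ρ R a) + totalPrism act K ρ R (DGRing.d a) =
      a - cochainsMap R (toTuples ρ) (restrictToTuples act K R a) := by
  induction a using DirectSum.induction_on with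
  | zero => simp
  | add a a' ha ha' =>
    simp only [map_add]
    rw [add_add_add_comm, ha, ha', add_sub_add_comm]
  | of n f =>
    rw [dgRing_d_of, restrictToTuples_of, cochainsMap_of, totalPrism_of_succ, ← map_sub]
    cases n with
    | zero =>
      rw [totalPrism_of_zero, map_zero, zero_add]
      congr 1
      funext σ
      exact prism_d_zero act K f σ
    | succ n =>
      rw [totalPrism_of_succ, dgRing_d_of, ← map_add]
      congr 1
      funext σ
      exact d_prism act K f σ

include hρ hpt in
lemma restrictToTuples_toTuples (a : (tuples G).Cochains R) :
    restrictToTuples act K R (cochainsMap R (toTuples ρ) a) = a := by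
  induction a using DirectSum.induction_on with
  | zero => simp
  | add a a' ha ha' => simp only [map_add, ha, ha']
  | of n f =>
    rw [cochainsMap_of, restrictToTuples_of]
    congr 1
    funext t
    exact congrArg f (funext fun i ↦ vertex_ofTuple act K hρ hpt (tuplesVertex t) i)

include hρ in
lemma toTuples_mem_inv {a : (tuples G).Cochains R}
    (ha : a ∈ (GroupAction.ofMulAction (G := G) G).inv R) :
    cochainsMap R (toTuples ρ) a ∈ act.inv R := by
  refine cochainsMap_mem_invariants ?_ ha
  rintro _ ⟨g, rfl⟩
  refine ⟨_, ⟨g, rfl⟩, ?_⟩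
  ext n σ
  funext i
  exact (congrArg ρ (vertex_app (act.hom g) i σ)).trans (hρ g _)

include K hpt in
/-- Invariant cochains on a simplicial set with a free action and a cone operator compute the
cohomology of the group. -/
theorem toTuples_isQuasiIso :
    DGRing.IsQuasiIso ((cochainsMap R (toTuples ρ)).restrict
      ((GroupAction.ofMulAction (G := G) G).inv R) (act.inv R)
      fun _ ↦ toTuples_mem_inv act hρ) := by
  refine DGRing.IsQuasiIso.of_homotopy (isDGHom_restrict (cochainsMap_isDGHom _) _)
    (AddMonoidHom.mk' (fun a ↦ ⟨_, restrictToTuples_mem_inv act K a.2⟩)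
      fun a b ↦ Subtype.ext (map_add _ _ _))
    (AddMonoidHom.mk' (fun a ↦ ⟨_, totalPrism_mem_inv act K hρ a.2⟩)
      fun a b ↦ Subtype.ext (map_add _ _ _)) ?_ ?_ ?_
  · exact fun a ↦ Subtype.ext (restrictToTuples_d act K (a : X.Cochains R))
  · exact fun a ↦ Subtype.ext (restrictToTuples_toTuples act K hρ hpt (a : (tuples G).Cochains R))
  · exact fun a ↦ Subtype.ext (d_totalPrism act K (a : X.Cochains R))

end Comparison

end SSet

/-! ## Cohomology of finite abelian groups -/

namespace SSet

variable {X : SSet.{u}} {p : ℕ}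

lemma natCast_cochains_eq_zero : (p : X.Cochains (ZMod p)) = 0 := by
  rw [← nsmul_one]
  change p • DirectSum.of (X.Cochain (ZMod p)) 0 GradedMonoid.GOne.one = 0
  rw [← map_nsmul]
  refine (congrArg _ (funext fun σ ↦ ?_)).trans (map_zero _)
  change p • (1 : ZMod p) = 0
  simp

lemma sgn_eq_self (h : p = 2) (a : X.Cochains (ZMod p)) : DGRing.sgn a = a := by
  subst h
  have h2 : ∀ a : X.Cochains (ZMod 2), -a = a := fun a ↦ by
    have : ((2 : ℕ) : X.Cochains (ZMod 2)) * a = 0 := by rw [natCast_cochains_eq_zero, zero_mul]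
    rw [neg_eq_iff_add_eq_zero, ← two_mul]
    exact_mod_cast this
  induction a using DirectSum.induction_on with
  | zero => simp
  | add a a' ha ha' => simp only [map_add, ha, ha']
  | of n f =>
    rw [dgRing_sgn_of]
    rcases neg_one_pow_eq_or ℤ n with h | h <;> rw [h]
    · rw [_root_.one_smul]
    · rw [neg_smul, _root_.one_smul, h2]

/-- Restriction of an action along a homomorphism. -/
def GroupAction.comap {G H : Type*} [Group G] [Group H] (act : GroupAction G X) (f : H →* G) :
    GroupAction H X where
  hom h := act.hom (f h)
  hom_one := by rw [map_one, act.hom_one]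
  hom_mul g h := by rw [map_mul, act.hom_mul]

lemma GroupAction.inv_le_comap_inv {G H : Type*} [Group G] [Group H] (act : GroupAction G X)
    (f : H →* G) (R : Type v) [CommRing R] : act.inv R ≤ (act.comap f).inv R := by
  rintro a ha _ ⟨h, rfl⟩
  exact ha _ ⟨f h, rfl⟩

/-- The vertex of a `0`-simplex of `tuples T`. -/
def tuplesPoint {T : Type u} (t : (tuples T) _⦋0⦌) : T := tuplesVertex t 0

variable (p) in
/-- The cohomology of the group `G` with coefficients `ZMod p`, computed by homogeneous cochains, is
Frobenius regular. -/
def IsRegularGroup (G : Type u) [Group G] : Prop :=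
  DGRing.IsRegular p ((GroupAction.ofMulAction (G := G) G).inv (ZMod p))

lemma isRegularGroup_iff {G : Type u} [Group G] (act : GroupAction G X) (K : Cone X)
    (ρ : X _⦋0⦌ → G) (hρ : ∀ g v, ρ (act.smul g v) = g * ρ v) (hpt : ρ K.pt = 1) :
    IsRegularGroup p G ↔ DGRing.IsRegular p (act.inv (ZMod p)) :=
  (toTuples_isQuasiIso act K hρ hpt).isRegular_iff

/-- `H` acts on tuples of `G` through the inverse of `e`, with the same invariants, and `e` is an
equivariant vertex map, so the comparison theorem applies. -/
lemma IsRegularGroup.of_mulEquiv {G H : Type u} [Group G] [Group H] (e : G ≃* H)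
    (h : IsRegularGroup p G) : IsRegularGroup p H := by
  rw [isRegularGroup_iff ((GroupAction.ofMulAction (G := G) G).comap e.symm.toMonoidHom)
    (tuplesCone 1) (fun v ↦ e (tuplesPoint v)) (fun g v ↦ ?_) (map_one e)]
  · have : Set.range ((GroupAction.ofMulAction (G := G) G).comap e.symm.toMonoidHom).hom =
        Set.range (GroupAction.ofMulAction (G := G) G).hom :=
      e.symm.surjective.range_comp (GroupAction.ofMulAction (G := G) G).hom
    change DGRing.IsRegular p (invariants (Set.range _) (ZMod p))
    rw [this]
    exact h
  · change e (e.symm g * tuplesPoint v) = _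
    rw [map_mul, e.apply_symm_apply]

/-! ### The trivial group -/

section Trivial

variable {T : Type u} [Unique T] {R : Type v} [CommRing R]

instance (n : ℕ) : Subsingleton ((tuples T) _⦋n⦌) :=
  inferInstanceAs (Subsingleton (Fin (n + 1) → T))

/-- The pullback of cochains along the cone operator on tuples. -/
def tuplesConeCochain (n : ℕ) : (tuples T).Cochain R (n + 1) →+ (tuples T).Cochain R n where
  toFun f := fun t ↦ f ((tuplesCone default).cone t)
  map_zero' := rfl
  map_add' _ _ := rfl

lemma tuplesConeCochain_d_zero (f : (tuples T).Cochain R 0) :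
    tuplesConeCochain 0 (Cochain.d 0 f) = 0 := by
  funext t
  change ∑ k : Fin 2, (-1) ^ (k : ℕ) * f ((tuples T).δ k ((tuplesCone default).cone t)) = 0
  rw [Fin.sum_univ_two, Subsingleton.elim ((tuples T).δ 0 ((tuplesCone default).cone t))
    ((tuples T).δ 1 ((tuplesCone default).cone t))]
  simp

lemma tuplesConeCochain_d {n : ℕ} (f : (tuples T).Cochain R (n + 1)) :
    tuplesConeCochain (n + 1) (Cochain.d (n + 1) f) = f - Cochain.d n (tuplesConeCochain n f) := by
  funext t
  change ∑ k : Fin (n + 3), (-1) ^ (k : ℕ) * f ((tuples T).δ k ((tuplesCone default).cone t)) =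
    f t - ∑ k : Fin (n + 2), (-1) ^ (k : ℕ) * f ((tuplesCone default).cone ((tuples T).δ k t))
  rw [Fin.sum_univ_succ, sub_eq_add_neg, ← Finset.sum_neg_distrib]
  simp only [Fin.val_zero, pow_zero, one_mul, Cone.δ_zero, Cone.δ_succ, Fin.val_succ, pow_succ]
  congr 1
  exact Finset.sum_congr rfl fun k _ ↦ by ring

/-- The cone operator is a homotopy from the identity to the projection onto degree 0: on 0-cochains
`h d` vanishes, as both faces of a 1-simplex coincide. -/
lemma exists_eq_of_zero_add_d {a : (tuples T).Cochains R} (ha : DGRing.d a = 0) :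
    ∃ b, a = DirectSum.of ((tuples T).Cochain R) 0 (a 0) + DGRing.d b := by
  let h : (tuples T).Cochains R →+ (tuples T).Cochains R := DirectSum.toAddMonoid fun n ↦
    match n with
    | 0 => 0
    | n + 1 => (DirectSum.of ((tuples T).Cochain R) n).comp (tuplesConeCochain n)
  have h0 : ∀ f : (tuples T).Cochain R 0, h (DirectSum.of ((tuples T).Cochain R) 0 f) = 0 :=
    fun f ↦ DirectSum.toAddMonoid_of _ _ _
  have hs : ∀ (n : ℕ) (f : (tuples T).Cochain R (n + 1)),
      h (DirectSum.of ((tuples T).Cochain R) (n + 1) f) =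
        DirectSum.of ((tuples T).Cochain R) n (tuplesConeCochain n f) :=
    fun n f ↦ DirectSum.toAddMonoid_of _ _ _
  have key : ∀ a : (tuples T).Cochains R, DGRing.d (h a) + h (DGRing.d a) =
      a - DirectSum.of ((tuples T).Cochain R) 0 (a 0) := by
    intro a
    induction a using DirectSum.induction_on with
    | zero => simp
    | add a a' ha ha' =>
      simp only [map_add, DirectSum.add_apply]
      rw [add_add_add_comm, ha, ha', add_sub_add_comm]
    | of n f =>
      cases n with
      | zero =>
        rw [h0, map_zero, dgRing_d_of, hs, tuplesConeCochain_d_zero, map_zero,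
          DirectSum.of_eq_same, sub_self, add_zero]
      | succ n =>
        rw [hs, dgRing_d_of, dgRing_d_of, hs, tuplesConeCochain_d, map_sub,
          DirectSum.of_eq_of_ne _ _ _ (by omega), map_zero]
        abel
  refine ⟨h a, ?_⟩
  have := key a
  rw [ha, map_zero, add_zero] at this
  rw [this]
  abel

lemma exists_natCast_eq [NeZero p] (f : (tuples T).Cochain (ZMod p) 0) :
    ∃ k : ℕ, DirectSum.of ((tuples T).Cochain (ZMod p)) 0 f = k := by
  refine ⟨(f (tuplesMk fun _ ↦ default)).val, ?_⟩
  rw [← nsmul_one]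
  change _ = _ • DirectSum.of ((tuples T).Cochain (ZMod p)) 0 GradedMonoid.GOne.one
  rw [← map_nsmul]
  refine congrArg _ (funext fun σ ↦ ?_)
  change _ = (f (tuplesMk fun _ ↦ default)).val • (1 : ZMod p)
  rw [nsmul_one, ZMod.natCast_zmod_val]
  exact congrArg f (Subsingleton.elim _ _)

end Trivial

/-- Every class is an integer multiple of 1. Because `p = 0`, a nonzero integer class comes from an
integer prime to `p` and is invertible by Bézout, so the image of ℤ serves as P with `m = 0`. -/
lemma isRegularGroup_of_subsingleton [Fact p.Prime] (G : Type u) [Group G] [Subsingleton G] :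
    IsRegularGroup p G := by
  let : Unique G := uniqueOfSubsingleton 1
  let B := (GroupAction.ofMulAction (G := G) G).inv (ZMod p)
  have hB : ∀ a : (tuples G).Cochains (ZMod p), a ∈ B := by
    rintro a _ ⟨g, rfl⟩
    obtain rfl : g = 1 := Subsingleton.elim _ _
    rw [GroupAction.hom_one, cochainsMap_id]
  have hpH : (p : DGRing.Cohomology B) = 0 := by
    rw [← map_natCast (DGRing.cls B), ← map_zero (DGRing.cls B)]
    exact congrArg (DGRing.cls B) (Subtype.ext (Subtype.ext natCast_cochains_eq_zero))
  have hcls : ∀ t : DGRing.Cohomology B, ∃ k : ℤ, (k : DGRing.Cohomology B) = t := by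
    intro t
    obtain ⟨z, rfl⟩ := DGRing.cls_surjective t
    obtain ⟨b, hb⟩ := exists_eq_of_zero_add_d (a := ((z : B) : (tuples G).Cochains (ZMod p)))
      (congrArg Subtype.val z.2)
    obtain ⟨k, hk⟩ := exists_natCast_eq (p := p) (((z : B) : (tuples G).Cochains (ZMod p)) 0)
    refine ⟨k, ?_⟩
    rw [Int.cast_natCast, ← map_natCast (DGRing.cls B)]
    refine (DGRing.cls_eq_of_eq_add (a := (⟨b, hB b⟩ : B)) (Subtype.ext ?_)).symm
    rw [hb, hk]
    rfl
  refine ⟨⟨(Int.castRingHom (DGRing.Cohomology B)).range, ?_, ?_, fun t ↦ ⟨0, hcls _⟩⟩, fun b ↦ ?_⟩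
  · rintro _ ⟨k, rfl⟩
    exact ⟨fun a ↦ Int.cast_comm k a, map_intCast _ k⟩
  · rintro _ ⟨k, rfl⟩ h0 a ha
    have hk : IsCoprime k (p : ℤ) := by
      refine ((Nat.prime_iff_prime_int.mp Fact.out).coprime_iff_not_dvd.mpr ?_).symm
      rintro ⟨l, rfl⟩
      exact h0 (by simp [hpH])
    obtain ⟨u, v, huv⟩ := hk
    have := congrArg (Int.cast (R := DGRing.Cohomology B)) huv
    push_cast at this
    rw [hpH, mul_zero, add_zero] at this
    rw [← one_mul a, ← this, mul_assoc]
    exact (congrArg (_ * ·) ha).trans (mul_zero _)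
  · refine ⟨b, 0, by simp, ?_, by simp, fun a ↦ ?_, by simp⟩
    · obtain ⟨k, rfl⟩ := hcls b
      exact map_intCast _ k
    · obtain ⟨k, rfl⟩ := hcls b
      exact Int.cast_comm k a

end SSet

namespace SSet

/-! ### Products with a cyclic group -/

section CyclicProduct

variable {p n : ℕ} {K : Type u} [Group K]

variable (n K) in
/-- The translation action of `ℤ / n × K` on its tuples. -/
def prodAction : GroupAction (Multiplicative (ZMod n) × K) (tuples (Multiplicative (ZMod n) × K)) :=
  GroupAction.ofMulAction _

variable (n K) in
/-- The translation action of `K` on the tuples of `ℤ / n × K`. -/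
def factorAction : GroupAction K (tuples (Multiplicative (ZMod n) × K)) :=
  (prodAction n K).comap (MonoidHom.inr _ _)

variable (n K) in
/-- The generator of the cyclic factor of `ℤ / n × K`. -/
def cyclicGenerator : Multiplicative (ZMod n) × K := (Multiplicative.ofAdd 1, 1)

/-- The component in `ℤ / n` of a vertex of a tuple. -/
def cyclicVertex {m : ℕ} (t : (tuples (Multiplicative (ZMod n) × K)) _⦋m⦌) (i : Fin (m + 1)) :
    ZMod n := (tuplesVertex t i).1.toAdd

lemma cyclicVertex_hom {m : ℕ} (γ : Multiplicative (ZMod n) × K)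
    (t : (tuples (Multiplicative (ZMod n) × K)) _⦋m⦌) (i : Fin (m + 1)) :
    cyclicVertex (((prodAction n K).hom γ).app _ t) i = γ.1.toAdd + cyclicVertex t i := rfl

lemma cyclicVertex_factor {m : ℕ} (k : K)
    (t : (tuples (Multiplicative (ZMod n) × K)) _⦋m⦌) (i : Fin (m + 1)) :
    cyclicVertex (((factorAction n K).hom k).app _ t) i = cyclicVertex t i :=
  zero_add (cyclicVertex t i)

lemma toAdd_cyclicGenerator_pow (j : ℕ) : (cyclicGenerator n K ^ j).1.toAdd = j := by
  rw [Prod.pow_fst, toAdd_pow, cyclicGenerator, toAdd_ofAdd, nsmul_one]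

lemma cyclicGenerator_pow_card : cyclicGenerator n K ^ n = 1 := by
  refine Prod.ext (Multiplicative.toAdd.injective ?_) ?_
  · rw [toAdd_cyclicGenerator_pow, ZMod.natCast_self]
    rfl
  · rw [Prod.pow_snd, cyclicGenerator, one_pow]
    rfl

variable (p n K)

/-- The inclusion of the `ℤ / n × K`-invariants into the `K`-invariants. -/
noncomputable def invInclusion :
    (prodAction n K).inv (ZMod p) →+* (factorAction n K).inv (ZMod p) :=
  Subring.inclusion ((prodAction n K).inv_le_comap_inv _ _)

lemma invInclusion_isDGHom : DGRing.IsDGHom (invInclusion p n K) where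
  map_d _ := rfl
  map_sgn _ := rfl
  map_trunc _ _ := rfl

lemma cochainsMap_generator_mem {a : (tuples (Multiplicative (ZMod n) × K)).Cochains (ZMod p)}
    (ha : a ∈ (factorAction n K).inv (ZMod p)) :
    cochainsMap (ZMod p) ((prodAction n K).hom (cyclicGenerator n K)) a ∈
      (factorAction n K).inv (ZMod p) := by
  refine cochainsMap_mem_invariants ?_ ha
  rintro _ ⟨k, rfl⟩
  refine ⟨_, ⟨k, rfl⟩, ?_⟩
  change (prodAction n K).hom _ ≫ _ = _ ≫ (prodAction n K).hom _
  rw [← GroupAction.hom_mul, ← GroupAction.hom_mul]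
  congr 1
  simp [cyclicGenerator]

/-- The action of the generator of the cyclic factor on the `K`-invariants. -/
noncomputable def cyclicAut : (factorAction n K).inv (ZMod p) →+* (factorAction n K).inv (ZMod p) :=
  (cochainsMap (ZMod p) ((prodAction n K).hom (cyclicGenerator n K))).restrict _ _ fun _ ↦
    cochainsMap_generator_mem p n K

lemma cyclicAut_isDGHom : DGRing.IsDGHom (cyclicAut p n K) :=
  isDGHom_restrict (cochainsMap_isDGHom _) _

lemma coe_cyclicAut_pow (j : ℕ) (a : (factorAction n K).inv (ZMod p)) :
    (((cyclicAut p n K ^ j) a : (factorAction n K).inv (ZMod p)) :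
      (tuples (Multiplicative (ZMod n) × K)).Cochains (ZMod p)) =
      cochainsMap (ZMod p) ((prodAction n K).hom (cyclicGenerator n K ^ j)) a := by
  induction j with
  | zero =>
    rw [pow_zero, pow_zero, GroupAction.hom_one, cochainsMap_id]
    rfl
  | succ j ih =>
    rw [DGRing.pow_succ_apply]
    refine (congrArg (cochainsMap (ZMod p) _) ih).trans ?_
    rw [← cochainsMap_comp, ← GroupAction.hom_mul, pow_succ]

lemma cyclicAut_pow_card : cyclicAut p n K ^ n = 1 := by
  ext a : 2
  rw [coe_cyclicAut_pow, cyclicGenerator_pow_card, GroupAction.hom_one, cochainsMap_id]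
  rfl

/-- Each element of the product is a power of the generator times an element of `K`, so invariance
under these two is full invariance. -/
lemma cyclicAut_eq_self_iff [NeZero n] (a : (factorAction n K).inv (ZMod p)) :
    cyclicAut p n K a = a ↔ ∃ b, invInclusion p n K b = a := by
  constructor
  · intro h
    refine ⟨⟨a, ?_⟩, rfl⟩
    rintro _ ⟨⟨c, k⟩, rfl⟩
    have e : ((c, k) : Multiplicative (ZMod n) × K) =
        cyclicGenerator n K ^ c.toAdd.val * MonoidHom.inr (Multiplicative (ZMod n)) K k := by
      refine Prod.ext (Multiplicative.toAdd.injective ?_) ?_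
      · rw [Prod.fst_mul, toAdd_mul, toAdd_cyclicGenerator_pow, ZMod.natCast_zmod_val]
        simp
      · rw [Prod.snd_mul, Prod.pow_snd, cyclicGenerator, one_pow, one_mul]
        rfl
    rw [e, GroupAction.hom_mul, cochainsMap_comp, ← coe_cyclicAut_pow,
      DGRing.pow_apply_of_fixed h]
    exact a.2 _ ⟨k, rfl⟩
  · rintro ⟨b, rfl⟩
    exact Subtype.ext (b.2 _ ⟨_, rfl⟩)

/-- The projection to the second factor on vertices. -/
def factorVertex (t : (tuples (Multiplicative (ZMod n) × K)) _⦋0⦌) : K := (tuplesPoint t).2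

/-- Inflation of cochains along the projection `ℤ / n × K → K`. -/
noncomputable def inflation :
    (GroupAction.ofMulAction (G := K) K).inv (ZMod p) →+* (prodAction n K).inv (ZMod p) :=
  (cochainsMap (ZMod p) (toTuples (factorVertex n K))).restrict _ _ fun a ha ↦ by
    refine cochainsMap_mem_invariants ?_ ha
    rintro _ ⟨g, rfl⟩
    exact ⟨_, ⟨g.2, rfl⟩, rfl⟩

lemma inflation_isDGHom : DGRing.IsDGHom (inflation p n K) :=
  isDGHom_restrict (cochainsMap_isDGHom _) _

/-- Projection of vertices to `K` is equivariant for the action of `K` alone, so the comparison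
theorem applies to the tuples of the larger group. -/
lemma inflation_isQuasiIso :
    DGRing.IsQuasiIso ((invInclusion p n K).comp (inflation p n K)) :=
  toTuples_isQuasiIso (factorAction n K) (tuplesCone 1) (ρ := factorVertex n K)
    (fun _ _ ↦ rfl) rfl

variable {p n K}

lemma IsRegularGroup.zmod_prod_of_coprime [Fact p.Prime] [NeZero n] (hn : n.Coprime p)
    (h : IsRegularGroup p K) : IsRegularGroup p (Multiplicative (ZMod n) × K) := by
  obtain ⟨k, -, hk⟩ := Nat.exists_mul_mod_eq_one_of_coprime hn (Fact.out : p.Prime).one_lt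
  have hk' : ((k : (factorAction n K).inv (ZMod p)) * n) = 1 := by
    have := congrArg (Nat.cast (R := (factorAction n K).inv (ZMod p))) (Nat.div_add_mod (n * k) p)
    rw [hk] at this
    push_cast at this
    have h0 : (p : (factorAction n K).inv (ZMod p)) = 0 := Subtype.ext natCast_cochains_eq_zero
    rw [h0, zero_mul, zero_add] at this
    rw [this, Nat.cast_comm]
  exact (DGRing.IsQuasiIso.of_cyclic_of_coprime (inflation_isDGHom p n K)
    (invInclusion_isDGHom p n K) (Subring.inclusion_injective _) (cyclicAut_eq_self_iff p n K)
    (cyclicAut_isDGHom p n K) (cyclicAut_pow_card p n K) (inflation_isQuasiIso p n K)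
    hk').isRegular_iff.mp h

/-- The `K`-invariant cochain of degree `m` given by a function of the components in `ℤ / n`. -/
noncomputable def cyclicCochain {m : ℕ} (F : (Fin (m + 1) → ZMod n) → ZMod p) :
    (factorAction n K).inv (ZMod p) :=
  ⟨DirectSum.of ((tuples (Multiplicative (ZMod n) × K)).Cochain (ZMod p)) m
    (fun t ↦ F (cyclicVertex t)), of_mem_invariants (by
      rintro _ ⟨k, rfl⟩ t
      exact congrArg F (funext fun i ↦ cyclicVertex_factor k t i))⟩

lemma cyclicCochain_add {m : ℕ} (F F' : (Fin (m + 1) → ZMod n) → ZMod p) :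
    (cyclicCochain (F + F') : (factorAction n K).inv (ZMod p)) =
      cyclicCochain F + cyclicCochain F' :=
  Subtype.ext (map_add (DirectSum.of _ m) _ _)

lemma cyclicCochain_sub {m : ℕ} (F F' : (Fin (m + 1) → ZMod n) → ZMod p) :
    (cyclicCochain (F - F') : (factorAction n K).inv (ZMod p)) =
      cyclicCochain F - cyclicCochain F' :=
  Subtype.ext (map_sub (DirectSum.of _ m) _ _)

lemma cyclicCochain_one :
    (cyclicCochain (m := 0) (fun _ ↦ 1) : (factorAction n K).inv (ZMod p)) = 1 := rfl

lemma d_cyclicCochain {m : ℕ} (F : (Fin (m + 1) → ZMod n) → ZMod p) :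
    DGRing.d (cyclicCochain F : (factorAction n K).inv (ZMod p)) =
      cyclicCochain fun v ↦ ∑ k : Fin (m + 2), (-1) ^ (k : ℕ) * F fun i ↦ v (k.succAbove i) :=
  Subtype.ext (dgRing_d_of _)

lemma cyclicCochain_mul {i j : ℕ} (F : (Fin (i + 1) → ZMod n) → ZMod p)
    (F' : (Fin (j + 1) → ZMod n) → ZMod p) :
    (cyclicCochain F * cyclicCochain F' : (factorAction n K).inv (ZMod p)) =
      cyclicCochain (m := i + j) fun v ↦ F (fun k ↦ v ⟨k, by omega⟩) *
        F' fun k ↦ v ⟨k + i, by omega⟩ :=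
  Subtype.ext (of_cup rfl _ _).symm

lemma sgn_cyclicCochain {m : ℕ} (F : (Fin (m + 1) → ZMod n) → ZMod p) :
    DGRing.sgn (cyclicCochain F : (factorAction n K).inv (ZMod p)) =
      (-1 : ℤ) ^ m • cyclicCochain F :=
  Subtype.ext (dgRing_sgn_of _)

lemma cyclicAut_pow_cyclicCochain {m : ℕ} (j : ℕ) (F : (Fin (m + 1) → ZMod n) → ZMod p) :
    (cyclicAut p n K ^ j) (cyclicCochain F) = cyclicCochain fun v ↦ F fun i ↦ (j : ZMod n) + v i := by
  refine Subtype.ext ((coe_cyclicAut_pow _ _ _ _ _).trans ((cochainsMap_of _ _ _).trans ?_))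
  refine congrArg (DirectSum.of _ m) (funext fun t ↦ congrArg F (funext fun i ↦ ?_))
  rw [cyclicVertex_hom, toAdd_cyclicGenerator_pow]

lemma cyclicAut_cyclicCochain {m : ℕ} (F : (Fin (m + 1) → ZMod n) → ZMod p) :
    cyclicAut p n K (cyclicCochain F) = cyclicCochain fun v ↦ F fun i ↦ 1 + v i := by
  have := cyclicAut_pow_cyclicCochain (K := K) 1 F
  rw [pow_one, Nat.cast_one] at this
  exact this

/-- For each vertex `v 0` exactly one `j < n` has `j + v 0 = -1`. -/
lemma cyclicNorm_indicator [NeZero n] :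
    DGRing.cyclicNorm (cyclicAut p n K) n
      (cyclicCochain (m := 0) fun v ↦ if v 0 = -1 then 1 else 0) = 1 := by
  have hsum : ∀ (s : Finset ℕ) (F : ℕ → (Fin 1 → ZMod n) → ZMod p),
      ∑ j ∈ s, (cyclicCochain (m := 0) (F j) : (factorAction n K).inv (ZMod p)) =
        cyclicCochain (m := 0) (∑ j ∈ s, F j) := fun s F ↦
    (map_sum (AddMonoidHom.mk' (fun F : (Fin 1 → ZMod n) → ZMod p ↦
      (cyclicCochain (m := 0) F : (factorAction n K).inv (ZMod p)))
      fun _ _ ↦ cyclicCochain_add _ _) F s).symm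
  rw [DGRing.cyclicNorm_apply]
  simp only [cyclicAut_pow_cyclicCochain]
  rw [hsum, ← cyclicCochain_one]
  congr 1
  funext v
  rw [Finset.sum_apply, Finset.sum_eq_single (-1 - v 0).val]
  · simp
  · intro j hj hne
    rw [if_neg]
    intro h
    apply hne
    rw [← h, add_sub_cancel_right, ZMod.val_natCast, Nat.mod_eq_of_lt (Finset.mem_range.mp hj)]
  · intro h
    exact absurd (Finset.mem_range.mpr (ZMod.val_lt _)) h

lemma val_one_add_cases [NeZero n] (a : ZMod n) :
    (a = -1 ∧ (1 + a).val = 0 ∧ a.val + 1 = n) ∨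
      (a ≠ -1 ∧ (1 + a).val = a.val + 1 ∧ a.val + 1 < n) := by
  have hlt := ZMod.val_lt a
  by_cases h : a.val + 1 = n
  · left
    have h0 : 1 + a = 0 := by
      rw [← ZMod.natCast_zmod_val a, add_comm, ← Nat.cast_one, ← Nat.cast_add, h,
        ZMod.natCast_self]
    exact ⟨(neg_eq_of_add_eq_zero_right h0).symm, by rw [h0, ZMod.val_zero], h⟩
  · right
    have h1 : (1 + a).val = a.val + 1 := by
      rw [← ZMod.natCast_zmod_val a, add_comm, ← Nat.cast_one, ← Nat.cast_add,
        ZMod.val_natCast, ZMod.val_natCast, Nat.mod_eq_of_lt hlt, Nat.mod_eq_of_lt (by omega)]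
    refine ⟨?_, h1, by omega⟩
    rintro rfl
    rw [add_neg_cancel, ZMod.val_zero] at h1
    omega

/-- Adding 1 preserves the order of two residues unless exactly one of them is `-1` and wraps to 0;
the sign of the change depends on which one it is. -/
lemma wrap_sub_cyclicAut [NeZero n] :
    (cyclicCochain (m := 1) fun v ↦ if (v 0).val < (v 1).val then 1 else 0) -
      cyclicAut p n K (cyclicCochain (m := 1) fun v ↦ if (v 0).val < (v 1).val then 1 else 0) =
      DGRing.d (cyclicCochain (m := 0) fun v ↦ if v 0 = -1 then 1 else 0) := by
  rw [cyclicAut_cyclicCochain, d_cyclicCochain, ← cyclicCochain_sub]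
  congr 1
  funext v
  rw [Fin.sum_univ_two]
  change (if (v 0).val < (v 1).val then (1 : ZMod p) else 0) -
    (if (1 + v 0).val < (1 + v 1).val then 1 else 0) =
    (-1) ^ 0 * (if v 1 = -1 then 1 else 0) + (-1) ^ 1 * (if v 0 = -1 then 1 else 0)
  rcases val_one_add_cases (v 0) with ⟨h₁, h₂, h₃⟩ | ⟨h₁, h₂, h₃⟩ <;>
  rcases val_one_add_cases (v 1) with ⟨h₁', h₂', h₃'⟩ | ⟨h₁', h₂', h₃'⟩ <;>
  rw [h₂, h₂'] <;> split_ifs <;> first | (exfalso; omega) | contradiction | norm_num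

/-- For n = p = 2 this is `y * y = x`, an equality of cochains and not only of classes. -/
lemma zmod_two_d_mul_d : ∀ a b c : ZMod 2,
    ((-1) ^ 0 * b + (-1) ^ 1 * a) * ((-1) ^ 0 * c + (-1) ^ 1 * b) =
      (-1) ^ 0 * (if b.val < c.val then 1 else 0) + (-1) ^ 1 * (if a.val < c.val then 1 else 0) +
        (-1) ^ 2 * (if a.val < b.val then (1 : ZMod 2) else 0) := by
  decide

/-- The upper binary digit of an element of `ℤ / 4`. -/
def zmodFourBit (a : ZMod 4) : ZMod 2 := if 2 ≤ a.val then 1 else 0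

/-- The product of the lower bits is the carry into the upper bit. So when 4 divides n, the upper
bit of a difference of vertices has coboundary `y * y`. -/
lemma zmodFourBit_add : ∀ a b : ZMod 4,
    ZMod.castHom (by decide : 2 ∣ 4) (ZMod 2) a * ZMod.castHom (by decide : 2 ∣ 4) (ZMod 2) b =
      zmodFourBit b - zmodFourBit (a + b) + zmodFourBit a := by
  decide

/-- The data for the descent are explicit: `e` is the indicator of `-1`, `c` the vertex modulo `p`,
and `w` compares the residues of two consecutive vertices. -/
lemma IsRegularGroup.zmod_prod_of_dvd [Fact p.Prime] [NeZero n] (hn : p ∣ n)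
    (h2 : p = 2 → n = 2 ∨ 4 ∣ n) (h : IsRegularGroup p K) :
    IsRegularGroup p (Multiplicative (ZMod n) × K) := by
  let χ : ZMod n →+* ZMod p := ZMod.castHom hn (ZMod p)
  let e : (factorAction n K).inv (ZMod p) := cyclicCochain (m := 0) fun v ↦ if v 0 = -1 then 1 else 0
  let c : (factorAction n K).inv (ZMod p) := cyclicCochain (m := 0) fun v ↦ χ (v 0)
  let w : (factorAction n K).inv (ZMod p) :=
    cyclicCochain (m := 1) fun v ↦ if (v 0).val < (v 1).val then 1 else 0
  have he : DGRing.cyclicNorm (cyclicAut p n K) n e = 1 := cyclicNorm_indicator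
  have hw : w - cyclicAut p n K w = DGRing.d e := wrap_sub_cyclicAut
  have hc : cyclicAut p n K c = c + 1 := by
    rw [cyclicAut_cyclicCochain, ← cyclicCochain_one, ← cyclicCochain_add]
    congr 1
    funext v
    exact (map_add χ 1 (v 0)).trans (by rw [map_one, add_comm]; rfl)
  have hp0 : (p : (factorAction n K).inv (ZMod p)) = 0 := Subtype.ext natCast_cochains_eq_zero
  -- `d c` is fixed by the generator because 1 is a cocycle.
  obtain ⟨y, hy⟩ := (cyclicAut_eq_self_iff p n K (DGRing.d c)).mp (by
    rw [(cyclicAut_isDGHom p n K).map_d, hc, map_add]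
    exact add_eq_left.mpr (one_mem (DGRing.cocycles _)))
  -- `d w` is fixed by the generator because `w` moves by the coboundary `d e`.
  obtain ⟨x, hx⟩ := (cyclicAut_eq_self_iff p n K (DGRing.d w)).mp (by
    rw [(cyclicAut_isDGHom p n K).map_d, show cyclicAut p n K w = w - DGRing.d e by
      rw [← hw]; abel, map_sub, DGRing.d_d, sub_zero])
  refine DGRing.IsRegular.of_cyclic (inflation_isDGHom p n K)
    (invInclusion_isDGHom p n K) (Subring.inclusion_injective _) (cyclicAut_eq_self_iff p n K)
    (cyclicAut_isDGHom p n K) (cyclicAut_pow_card p n K) (inflation_isQuasiIso p n K)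
    (e := e) (c := c) (w := w) he hc hw hy hx ?_ ?_ ?_ h
    (Subtype.ext natCast_cochains_eq_zero) (fun hp b ↦ Subtype.ext (sgn_eq_self hp _))
    fun hp ↦ ?_
  · obtain ⟨k, rfl⟩ := hn
    rw [Nat.cast_mul, hp0, zero_mul]
  · rw [sgn_cyclicCochain, pow_zero, one_zsmul]
  · rw [sgn_cyclicCochain, pow_one, neg_one_zsmul]
  · have hι : Function.Injective (invInclusion p n K) := Subring.inclusion_injective _
    subst hp
    rcases h2 rfl with rfl | h4
    · refine ⟨0, .inr (hι ?_)⟩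
      rw [map_zero, add_zero, map_mul, hy, hx, d_cyclicCochain, d_cyclicCochain, cyclicCochain_mul]
      congr 1
      funext v
      rw [Fin.sum_univ_two, Fin.sum_univ_two, Fin.sum_univ_three]
      have hχ : ∀ a, χ a = a := fun a ↦ by simp [χ]
      simp only [hχ]
      exact zmod_two_d_mul_d (v 0) (v 1) (v 2)
    · let θ : ZMod n → ZMod 4 := ZMod.castHom h4 (ZMod 4)
      let τ : ZMod 4 → ZMod 2 := zmodFourBit
      let q : (factorAction n K).inv (ZMod 2) := cyclicCochain (m := 1) fun v ↦ τ (θ (v 1 - v 0))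
      obtain ⟨q', hq'⟩ := (cyclicAut_eq_self_iff 2 n K q).mp (by
        rw [cyclicAut_cyclicCochain]
        congr 1
        funext v
        rw [add_sub_add_left_eq_sub])
      refine ⟨q', .inl (hι ?_)⟩
      rw [(invInclusion_isDGHom 2 n K).map_d, hq', map_mul, hy, d_cyclicCochain, d_cyclicCochain,
        cyclicCochain_mul]
      congr 1
      funext v
      rw [Fin.sum_univ_two, Fin.sum_univ_two, Fin.sum_univ_three]
      have hχ : ∀ a, χ a = ZMod.castHom (by decide : 2 ∣ 4) (ZMod 2) (θ a) := fun a ↦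
        (RingHom.congr_fun (ZMod.castHom_comp (by decide : 2 ∣ 4) h4) a).symm
      have := zmodFourBit_add (θ (v 1 - v 0)) (θ (v 2 - v 1))
      rw [← hχ, ← hχ, ← (map_add (ZMod.castHom h4 (ZMod 4)) _ _ : θ _ = θ _ + θ _), map_sub,
        map_sub, add_comm (v 1 - v 0), sub_add_sub_cancel] at this
      change ((-1) ^ 0 * χ (v 1) + (-1) ^ 1 * χ (v 0)) * ((-1) ^ 0 * χ (v 2) + (-1) ^ 1 * χ (v 1)) =
        (-1) ^ 0 * τ (θ (v 2 - v 1)) + (-1) ^ 1 * τ (θ (v 2 - v 0)) +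
          (-1) ^ 2 * τ (θ (v 1 - v 0))
      linear_combination this

end CyclicProduct

/-! ### Induction over the cyclic factors -/

/-- Prime powers suit the case p = 2, since a nontrivial power of 2 is 2 or divisible by 4. Exponent
0 gives a trivial factor, covered by the coprime case. -/
lemma IsRegularGroup.zmod_prime_pow_prod {p : ℕ} [Fact p.Prime] {K : Type u} [Group K]
    (h : IsRegularGroup p K) {q : ℕ} (hq : q.Prime) (e : ℕ) :
    IsRegularGroup p (Multiplicative (ZMod (q ^ e)) × K) := by
  have : NeZero (q ^ e) := ⟨pow_ne_zero _ hq.ne_zero⟩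
  by_cases he : e = 0
  · subst he
    exact h.zmod_prod_of_coprime (by simp)
  by_cases hqp : q = p
  · subst hqp
    refine h.zmod_prod_of_dvd (dvd_pow_self q he) ?_
    rintro rfl
    obtain rfl | ⟨k, rfl⟩ : e = 1 ∨ ∃ k, e = k + 2 := by
      obtain _ | _ | k := e
      exacts [absurd rfl he, .inl rfl, .inr ⟨k, rfl⟩]
    · exact .inl rfl
    · exact .inr ⟨2 ^ k, by ring⟩
  · exact h.zmod_prod_of_coprime
      (((Nat.coprime_primes hq (Fact.out : p.Prime)).mpr hqp).pow_left e)

lemma isRegularGroup_of_addEquiv (p : ℕ) [Fact p.Prime] (ι : Type) [Finite ι] :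
    ∀ (q e : ι → ℕ), (∀ i, (q i).Prime) → ∀ (G : Type u) [CommGroup G],
      (Additive G ≃+ ∀ i, ZMod (q i ^ e i)) → IsRegularGroup p G := by
  induction ι using Finite.induction_empty_option with
  | @of_equiv α β f ih =>
    intro q e hq G _ φ
    exact ih (q ∘ f) (e ∘ f) (fun i ↦ hq (f i)) G
      (φ.trans (RingEquiv.piCongrLeft (fun i ↦ ZMod (q i ^ e i)) f).symm.toAddEquiv)
  | h_empty =>
    intro q e hq G _ φ
    have : Subsingleton G := (Additive.ofMul.trans φ.toEquiv).subsingleton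
    exact isRegularGroup_of_subsingleton G
  | @h_option α _ ih =>
    intro q e hq G _ φ
    -- The complementary factor is lifted to the universe of `G`, where the induction hypothesis
    -- applies.
    let K : Type u := ULift.{u} (Multiplicative (∀ i, ZMod (q (some i) ^ e (some i))))
    have hK : IsRegularGroup p K := ih (fun i ↦ q (some i)) (fun i ↦ e (some i))
      (fun i ↦ hq (some i)) K
      ((MulEquiv.toAdditive MulEquiv.ulift).trans (AddEquiv.additiveMultiplicative _))
    let ψ : G →* Multiplicative (ZMod (q none ^ e none)) × K :=
      MonoidHom.mk' (fun g ↦ (.ofAdd (φ (.ofMul g) none), ⟨.ofAdd fun i ↦ φ (.ofMul g) (some i)⟩))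
        fun a b ↦ by
          simp only [ofMul_mul, map_add]
          rfl
    refine (hK.zmod_prime_pow_prod (hq none) (e none)).of_mulEquiv
      (MulEquiv.ofBijective ψ ⟨fun a b hab ↦ ?_, fun ⟨a, b⟩ ↦ ?_⟩).symm
    · refine Additive.ofMul.injective (φ.injective (funext fun i ↦ ?_))
      cases i with
      | none => exact congrArg Prod.fst hab
      | some i => exact congrFun (congrArg (fun x ↦ x.2.down.toAdd) hab) i
    · refine ⟨(φ.symm fun i ↦ match i with
        | none => a.toAdd
        | some i => b.down.toAdd i).toMul, ?_⟩
      simp only [ψ, MonoidHom.mk'_apply, ofMul_toMul, AddEquiv.apply_symm_apply]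
      rfl

/-- The cohomology of a finite abelian group is Frobenius regular. -/
theorem isRegularGroup_of_finite (p : ℕ) [Fact p.Prime] (G : Type u) [CommGroup G] [Finite G] :
    IsRegularGroup p G := by
  obtain ⟨ι, _, q, hq, e, ⟨φ⟩⟩ := AddCommGroup.equiv_directSum_zmod_of_finite (Additive G)
  classical
  exact isRegularGroup_of_addEquiv p ι q e hq G (φ.trans (DirectSum.addEquivProd _))

end SSet

/-! ## Singular simplices -/

namespace SSet

section Singular

variable {X Y : Type u} [TopologicalSpace X] [TopologicalSpace Y]

variable (X) in
/-- The singular simplicial set of a space. -/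
noncomputable abbrev sing : SSet.{u} := TopCat.toSSet.obj (TopCat.of X)

/-- The map of singular simplicial sets induced by a continuous map. -/
noncomputable abbrev singMap (f : C(X, Y)) : sing X ⟶ sing Y := TopCat.toSSet.map (TopCat.ofHom f)

/-- Singular simplices are continuous maps on the standard simplex. -/
noncomputable def singEquiv (n : ℕ) : (sing X) _⦋n⦌ ≃ C(_root_.stdSimplex ℝ (Fin (n + 1)), X) :=
  TopCat.toSSetObjEquiv _ _

lemma singEquiv_δ {n : ℕ} (k : Fin (n + 2)) (σ : (sing X) _⦋n + 1⦌)
    (u : _root_.stdSimplex ℝ (Fin (n + 1))) :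
    singEquiv n ((sing X).δ k σ) u = singEquiv (n + 1) σ (_root_.stdSimplex.map k.succAbove u) := rfl

lemma singEquiv_app (f : C(X, Y)) {n : ℕ} (σ : (sing X) _⦋n⦌) :
    singEquiv n ((singMap f).app _ σ) = f.comp (singEquiv n σ) := rfl

/-- The point `s * e₀ + (1 - s) * u` of the cone over a standard simplex. -/
noncomputable def joinPoint {n : ℕ} (x : unitInterval × _root_.stdSimplex ℝ (Fin (n + 1))) :
    _root_.stdSimplex ℝ (Fin (n + 2)) :=
  ⟨Fin.cons (x.1 : ℝ) fun i ↦ (1 - x.1) * x.2 i, by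
    constructor
    · refine Fin.cases x.1.2.1 fun i ↦ ?_
      exact mul_nonneg (sub_nonneg.mpr x.1.2.2) (x.2.2.1 i)
    · rw [Fin.sum_univ_succ]
      simp only [Fin.cons_zero, Fin.cons_succ]
      rw [← Finset.mul_sum, _root_.stdSimplex.sum_eq_one, mul_one, add_sub_cancel]⟩

lemma joinPoint_zero {n : ℕ} (x : unitInterval × _root_.stdSimplex ℝ (Fin (n + 1))) :
    joinPoint x 0 = x.1 := rfl

lemma joinPoint_succ {n : ℕ} (x : unitInterval × _root_.stdSimplex ℝ (Fin (n + 1))) (i : Fin (n + 1)) :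
    joinPoint x i.succ = (1 - x.1) * x.2 i := rfl

lemma stdSimplex_map_apply {n m : ℕ} (f : Fin n → Fin m) (s : _root_.stdSimplex ℝ (Fin n)) (y : Fin m) :
    _root_.stdSimplex.map f s y = ∑ i, if f i = y then s i else 0 := by
  have := congrFun (_root_.stdSimplex.map_coe f s) y
  rw [FunOnFinite.linearMap_apply_apply, Finset.sum_filter] at this
  exact this

lemma map_succ_joinPoint {n : ℕ} (u : _root_.stdSimplex ℝ (Fin (n + 1))) :
    _root_.stdSimplex.map (Fin.succAbove 0) u = joinPoint (0, u) := by
  refine _root_.stdSimplex.ext (funext fun y ↦ ?_)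
  rw [stdSimplex_map_apply]
  refine Fin.cases ?_ (fun y ↦ ?_) y
  · simp [joinPoint_zero]
  · simp [joinPoint_succ]

lemma map_joinPoint {n m : ℕ} (f : Fin (n + 1) → Fin (m + 1)) (g : Fin (n + 2) → Fin (m + 2))
    (hg : g 0 = 0) (hgs : ∀ i, g i.succ = (f i).succ)
    (x : unitInterval × _root_.stdSimplex ℝ (Fin (n + 1))) :
    _root_.stdSimplex.map g (joinPoint x) = joinPoint (x.1, _root_.stdSimplex.map f x.2) := by
  refine _root_.stdSimplex.ext (funext fun y ↦ ?_)
  rw [stdSimplex_map_apply, Fin.sum_univ_succ, hg, joinPoint_zero]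
  simp only [hgs, joinPoint_succ]
  refine Fin.cases ?_ (fun y ↦ ?_) y
  · simp [joinPoint_zero, Fin.succ_ne_zero]
  · rw [joinPoint_succ, stdSimplex_map_apply, Finset.mul_sum]
    simp [(Fin.succ_ne_zero _).symm]

/-- Away from the apex the base point is recovered on dividing by `1 - y 0`; at the apex any base
point will do. -/
lemma joinPoint_surjective {n : ℕ} : Function.Surjective (joinPoint (n := n)) := by
  intro y
  let s : unitInterval := ⟨y 0, y.2.1 0, _root_.stdSimplex.le_one y 0⟩
  have hy : y 0 + ∑ i : Fin (n + 1), y i.succ = 1 := by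
    rw [← Fin.sum_univ_succ, _root_.stdSimplex.sum_eq_one]
  by_cases h : y 0 = 1
  · refine ⟨(s, _root_.stdSimplex.vertex 0), _root_.stdSimplex.ext (funext fun i ↦ ?_)⟩
    refine Fin.cases rfl (fun i ↦ ?_) i
    rw [joinPoint_succ]
    change (1 - y 0) * _ = _
    rw [h, sub_self, zero_mul]
    rw [h, add_eq_left] at hy
    exact ((Finset.sum_eq_zero_iff_of_nonneg fun i _ ↦ y.2.1 _).mp hy i (Finset.mem_univ _)).symm
  · have h' : 1 - y 0 ≠ 0 := sub_ne_zero.mpr (Ne.symm h)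
    refine ⟨(s, ⟨fun i ↦ (1 - y 0)⁻¹ * y i.succ, fun i ↦ ?_, ?_⟩),
      _root_.stdSimplex.ext (funext fun i ↦ ?_)⟩
    · exact mul_nonneg (inv_nonneg.mpr (sub_nonneg.mpr (_root_.stdSimplex.le_one y 0))) (y.2.1 _)
    · rw [← Finset.mul_sum, inv_mul_eq_iff_eq_mul₀ h', mul_one, ← hy, add_sub_cancel_left]
    · refine Fin.cases rfl (fun i ↦ ?_) i
      exact mul_inv_cancel_left₀ h' _

lemma continuous_joinPoint {n : ℕ} : Continuous (joinPoint (n := n)) := by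
  refine Continuous.subtype_mk (continuous_pi (Fin.cases ?_ fun i ↦ ?_)) _
  · exact continuous_subtype_val.comp continuous_fst
  · exact (continuous_const.sub (continuous_subtype_val.comp continuous_fst)).mul
      ((continuous_apply i).comp (continuous_subtype_val.comp continuous_snd))

/-- A continuous surjection from a compact space to a Hausdorff space is a quotient map; maps on the
cone can thus be defined on the product. -/
lemma isQuotientMap_joinPoint {n : ℕ} : Topology.IsQuotientMap (joinPoint (n := n)) :=
  (continuous_joinPoint.isClosedMap).isQuotientMap continuous_joinPoint joinPoint_surjective

lemma joinPoint_eq_iff {n : ℕ} {x y : unitInterval × _root_.stdSimplex ℝ (Fin (n + 1))}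
    (h : joinPoint x = joinPoint y) : x.1 = y.1 ∧ (x.1 = 1 ∨ x.2 = y.2) := by
  have h₁ : x.1 = y.1 := Subtype.ext (congrArg (fun z : _root_.stdSimplex ℝ (Fin (n + 2)) ↦ z 0) h)
  refine ⟨h₁, or_iff_not_imp_left.mpr fun h₂ ↦ _root_.stdSimplex.ext (funext fun i ↦ ?_)⟩
  have := congrArg (fun z : _root_.stdSimplex ℝ (Fin (n + 2)) ↦ z i.succ) h
  simp only [joinPoint_succ, ← h₁] at this
  exact mul_left_cancel₀ (sub_ne_zero.mpr fun h ↦ h₂ (Subtype.ext h.symm)) this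

/-! ### The cone operator of a contraction -/

section ContractibleCone

variable {x₀ : X} (H : (ContinuousMap.id X).Homotopy (ContinuousMap.const X x₀))

/-- The map `(s, u) ↦ H (s, σ u)`. -/
noncomputable def contractSimplex {n : ℕ} (σ : C(_root_.stdSimplex ℝ (Fin (n + 1)), X)) :
    C(unitInterval × _root_.stdSimplex ℝ (Fin (n + 1)), X) :=
  H.toContinuousMap.comp ((ContinuousMap.id _).prodMap σ)

/-- `joinPoint` only identifies points with `s = 1`, and there the homotopy is constant. -/
lemma contractSimplex_factorsThrough {n : ℕ} (σ : C(_root_.stdSimplex ℝ (Fin (n + 1)), X)) :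
    Function.FactorsThrough (contractSimplex H σ) (joinPoint (n := n)) := by
  rintro ⟨s, u⟩ ⟨s', u'⟩ h
  obtain ⟨h₁, h₂⟩ := joinPoint_eq_iff h
  obtain rfl : s = s' := h₁
  change H (s, σ u) = H (s, σ u')
  rcases h₂ with h₂ | h₂
  · obtain rfl : s = 1 := h₂
    rw [H.apply_one, H.apply_one]
    rfl
  · rw [show u = u' from h₂]

/-- The cone over a singular simplex of a contractible space. -/
noncomputable def coneSimplex {n : ℕ} (σ : C(_root_.stdSimplex ℝ (Fin (n + 1)), X)) :
    C(_root_.stdSimplex ℝ (Fin (n + 2)), X) :=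
  Topology.IsQuotientMap.lift (f := ⟨_, continuous_joinPoint⟩) isQuotientMap_joinPoint
    (contractSimplex H σ) (contractSimplex_factorsThrough H σ)

lemma coneSimplex_joinPoint {n : ℕ} (σ : C(_root_.stdSimplex ℝ (Fin (n + 1)), X)) (s : unitInterval)
    (u : _root_.stdSimplex ℝ (Fin (n + 1))) : coneSimplex H σ (joinPoint (s, u)) = H (s, σ u) :=
  DFunLike.congr_fun (Topology.IsQuotientMap.lift_comp (f := ⟨_, continuous_joinPoint⟩)
    isQuotientMap_joinPoint (contractSimplex H σ) (contractSimplex_factorsThrough H σ)) (s, u)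

/-- The cone operator on the singular simplices of a contractible space. -/
noncomputable def singCone : Cone (sing X) where
  pt := (singEquiv 0).symm (ContinuousMap.const _ x₀)
  cone σ := (singEquiv _).symm (coneSimplex H (singEquiv _ σ))
  δ_zero {n} σ := by
    refine (singEquiv n).injective (ContinuousMap.ext fun u ↦ ?_)
    rw [singEquiv_δ, Equiv.apply_symm_apply, map_succ_joinPoint, coneSimplex_joinPoint, H.apply_zero]
    rfl
  δ_succ {n} σ j := by
    refine (singEquiv (n + 1)).injective (ContinuousMap.ext fun y ↦ ?_)
    obtain ⟨⟨s, u⟩, rfl⟩ := joinPoint_surjective y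
    rw [singEquiv_δ, Equiv.apply_symm_apply, Equiv.apply_symm_apply,
      map_joinPoint j.succAbove _ (by simp) (by simp), coneSimplex_joinPoint, coneSimplex_joinPoint,
      singEquiv_δ]
  δ_one σ := by
    refine (singEquiv 0).injective (ContinuousMap.ext fun y ↦ ?_)
    rw [singEquiv_δ, Equiv.apply_symm_apply, Equiv.apply_symm_apply]
    have : _root_.stdSimplex.map (Fin.succAbove 1) y = joinPoint (1, y) := by
      refine _root_.stdSimplex.ext (funext fun i ↦ ?_)
      have hy : y 0 = 1 := (Fin.sum_univ_one _).symm.trans (_root_.stdSimplex.sum_eq_one y)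
      rw [stdSimplex_map_apply, Fin.sum_univ_one, hy]
      refine Fin.cases ?_ (fun i ↦ ?_) i
      · rw [joinPoint_zero]
        rfl
      · rw [joinPoint_succ]
        simp [(Fin.succ_ne_zero _).symm]
    rw [this, coneSimplex_joinPoint, H.apply_one]
    rfl

end ContractibleCone

end Singular

end SSet

/-! ## Quotients of simplicial sets and of spaces by free actions -/

lemma DGRing.IsQuasiIso.of_bijective {A B : Type*} [Ring A] [DGRing A] [Ring B] [DGRing B]
    {f : A →+* B} (hf : DGRing.IsDGHom f) (h : Function.Bijective f) : DGRing.IsQuasiIso f where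
  toIsDGHom := hf
  exists_eq_add b hb := by
    obtain ⟨a, rfl⟩ := h.2 b
    refine ⟨a, 0, h.1 ?_, by rw [map_zero, add_zero]⟩
    rw [hf.map_d, hb, map_zero]
  exists_eq_d a _ b hab := by
    obtain ⟨a', rfl⟩ := h.2 b
    exact ⟨a', h.1 (by rw [hab, hf.map_d])⟩

namespace SSet

section Quotient

variable {X Y : SSet.{u}} {G : Type w} [Group G] {R : Type v} [CommRing R]

/-- The map `φ` exhibits `Y` as the quotient of `X` by the action of `G`. -/
structure GroupAction.IsQuotient (act : GroupAction G X) (φ : X ⟶ Y) : Prop where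
  surjective (n : ℕ) : Function.Surjective fun σ : X _⦋n⦌ ↦ φ.app _ σ
  hom_comp (g : G) : act.hom g ≫ φ = φ
  exists_smul_eq {n : ℕ} (σ σ' : X _⦋n⦌) : φ.app _ σ = φ.app _ σ' → ∃ g, act.smul g σ = σ'

variable {act : GroupAction G X} {φ : X ⟶ Y} (hφ : act.IsQuotient φ)

namespace GroupAction.IsQuotient

include hφ

/-- A lift of a simplex of the quotient. -/
noncomputable def lift {n : ℕ} (τ : Y _⦋n⦌) : X _⦋n⦌ := (hφ.surjective n τ).choose

lemma app_lift {n : ℕ} (τ : Y _⦋n⦌) : φ.app _ (hφ.lift τ) = τ := (hφ.surjective n τ).choose_spec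

/-- The pull-back of cochains of the quotient to invariant cochains. -/
noncomputable def pullback : Y.Cochains R →+* act.inv R :=
  (cochainsMap R φ).codRestrict _ fun a ↦ by
    rintro _ ⟨g, rfl⟩
    rw [← cochainsMap_comp, hφ.hom_comp]

/-- Lifts of a simplex differ by the group, so an invariant cochain descends by evaluation on any
chosen lift. -/
lemma pullback_bijective : Function.Bijective (hφ.pullback (R := R)) := by
  constructor
  · intro a b h
    refine cochains_ext fun n τ ↦ ?_
    have := congrArg (fun c : act.inv R ↦ (c : X.Cochains R) n (hφ.lift τ)) h
    change cochainsMap R φ a n _ = cochainsMap R φ b n _ at this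
    rwa [cochainsMap_apply, cochainsMap_apply, hφ.app_lift] at this
  · intro b
    refine ⟨DFinsupp.mapRange (fun n (f : X.Cochain R n) τ ↦ f (hφ.lift τ)) (fun _ ↦ rfl)
      (b : X.Cochains R), Subtype.ext (cochains_ext fun n σ ↦ ?_)⟩
    refine (cochainsMap_apply _ _ _ _).trans ?_
    change (b : X.Cochains R) n (hφ.lift (φ.app _ σ)) = _
    obtain ⟨g, hg⟩ := hφ.exists_smul_eq σ (hφ.lift (φ.app _ σ)) (hφ.app_lift _).symm
    rw [← hg]
    exact (cochainsMap_apply _ _ _ _).symm.trans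
      (congrArg (fun c : X.Cochains R ↦ c n σ) (b.2 _ ⟨g, rfl⟩))

lemma pullback_isQuasiIso : DGRing.IsQuasiIso (hφ.pullback (R := R)) :=
  .of_bijective
    { map_d a := Subtype.ext ((cochainsMap_isDGHom φ).map_d a)
      map_sgn a := Subtype.ext ((cochainsMap_isDGHom φ).map_sgn a)
      map_trunc N a := Subtype.ext ((cochainsMap_isDGHom φ).map_trunc N a) }
    hφ.pullback_bijective

/-- The preimage is supported on one chosen lift of each simplex, so each fibre sum has at most one
nonzero term. It need not be a cocycle. -/
lemma transfer_surjective : Function.Surjective (transfer R φ) := by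
  classical
  intro a
  refine ⟨DFinsupp.mapRange (fun n (f : Y.Cochain R n) (σ : X _⦋n⦌) ↦
    if σ = hφ.lift (φ.app _ σ) then f (φ.app _ σ) else 0)
    (fun n ↦ funext fun σ ↦ ite_self _) a, cochains_ext fun n τ ↦ ?_⟩
  change ∑ᶠ σ : {σ : X _⦋n⦌ // φ.app _ σ = τ},
    (if σ.1 = hφ.lift (φ.app _ σ.1) then a n (φ.app _ σ.1) else 0) = a n τ
  rw [finsum_eq_single _ ⟨hφ.lift τ, hφ.app_lift τ⟩]
  · simp only [hφ.app_lift, if_true]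
  · rintro ⟨σ, rfl⟩ hσ
    exact if_neg fun h ↦ hσ (Subtype.ext h)

end GroupAction.IsQuotient

lemma eq_zero_of_mul_eq_zero_of_isRegular {p : ℕ} [Fact p.Prime]
    (h : DGRing.IsRegular p (Y.Cochains (ZMod p))) {x t : Y.Cohomology (ZMod p)}
    (ht : ¬ IsNilpotent t) (hx : x * t = 0) : x = 0 :=
  IsFrobeniusRegular.eq_zero_of_mul_eq_zero h ht hx

lemma cohomologyMap_cohomologyMap_of_comp_eq_id {φ : X ⟶ Y} {ψ : Y ⟶ X} (h : φ ≫ ψ = 𝟙 X)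
    (x : X.Cohomology R) : cohomologyMap R φ (cohomologyMap R ψ x) = x := by
  obtain ⟨z, rfl⟩ := Ideal.Quotient.mk_surjective x
  refine congrArg (X.cohomologyClass R) (Subtype.ext ?_)
  change cochainsMap R φ (cochainsMap R ψ z) = z
  rw [← cochainsMap_comp, h, cochainsMap_id]

/-- Coboundaries vanish in degree 0, whereas the unit cochain takes the value 1 on a vertex. -/
lemma nontrivial_cohomology [Nontrivial R] (σ : X _⦋0⦌) : Nontrivial (X.Cohomology R) := by
  refine ⟨0, 1, fun h ↦ ?_⟩
  obtain ⟨a, ha⟩ : ∃ a, coboundary a = (1 : X.Cochains R) :=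
    Ideal.Quotient.eq_zero_iff_mem.mp (h.symm : X.cohomologyClass R 1 = 0)
  have h1 : DGRing.trunc 1 (1 : X.Cochains R) = 1 := dgRing_trunc_of 1 _
  have h0 : (1 : X.Cochains R) = 0 := by
    rw [← h1, ← ha]
    change DGRing.trunc 1 (DGRing.d a) = 0
    rw [← DGRing.d_trunc, DGRing.trunc_zero, map_zero]
  have h2 := congrArg (fun c : X.Cochains R ↦ c 0 σ) h0
  exact one_ne_zero (α := R) h2

end Quotient

/-! ### Singular simplices of a principal covering -/

section UniversalBundle

instance (n : ℕ) : ContractibleSpace (_root_.stdSimplex ℝ (Fin (n + 1))) :=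
  (convex_stdSimplex ℝ _).contractibleSpace ⟨_, single_mem_stdSimplex ℝ 0⟩

instance (n : ℕ) : LocallyPathConnectedSpace (_root_.stdSimplex ℝ (Fin (n + 1))) :=
  (convex_stdSimplex ℝ _).locallyPathConnectedSpace

variable {G : Type w} [Group G] {E : Type u} [TopologicalSpace E] [MulAction G E]

variable (G E) in
/-- The action of `G` on the singular simplices of a `G`-space. -/
noncomputable def singAction [ContinuousConstSMul G E] : GroupAction G (sing E) where
  hom g := singMap ⟨(g • ·), continuous_const_smul g⟩
  hom_one := by
    refine Eq.trans (congrArg _ ?_) (TopCat.toSSet.map_id _)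
    ext x
    exact one_smul G x
  hom_mul g h := by
    refine Eq.trans (congrArg _ ?_) (TopCat.toSSet.map_comp _ _)
    ext x
    exact mul_smul g h x

/-- Standard simplices are contractible and locally path connected, so they lift through the
covering; a lift is determined by its value at one vertex, and two such values differ by the group.
-/
lemma singAction_isQuotient [ContinuousConstSMul G E]
    (hE : IsQuotientCoveringMap (Quotient.mk (MulAction.orbitRel G E)) G) :
    (singAction G E).IsQuotient (singMap (bundleProj G E)) where
  surjective n τ := by
    obtain ⟨e, he⟩ := hE.surjective (singEquiv n τ (_root_.stdSimplex.vertex 0))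
    obtain ⟨F, ⟨-, hF⟩, -⟩ := hE.isCoveringMap.existsUnique_continuousMap_lifts _ _ e he
    refine ⟨(singEquiv n).symm F, (singEquiv n).injective (ContinuousMap.ext fun u ↦ ?_)⟩
    rw [singEquiv_app, Equiv.apply_symm_apply]
    exact congrFun hF u
  hom_comp g := by
    refine Eq.trans (TopCat.toSSet.map_comp _ _).symm (congrArg _ ?_)
    ext x
    exact hE.map_smul g
  exists_smul_eq {n} σ σ' h := by
    let u₀ : _root_.stdSimplex ℝ (Fin (n + 1)) := _root_.stdSimplex.vertex 0
    have h' : (bundleProj G E).comp (singEquiv n σ) = (bundleProj G E).comp (singEquiv n σ') :=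
      congrArg (singEquiv n) h
    obtain ⟨g, hg⟩ := hE.apply_eq_iff_mem_orbit.mp (DFunLike.congr_fun h' u₀).symm
    refine ⟨g, (singEquiv n).injective ?_⟩
    refine (hE.isCoveringMap.existsUnique_continuousMap_lifts
      ((bundleProj G E).comp (singEquiv n σ')) u₀ (singEquiv n σ' u₀) rfl).unique
      ⟨hg, ?_⟩ ⟨rfl, rfl⟩
    rw [← h']
    exact funext fun u ↦ hE.map_smul g

/-- Freeness assigns to each point its unique translation from a chosen point of its orbit; right
multiplication by a constant normalises the value at `e₀`. No continuity is needed, since only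
vertices are mapped. -/
lemma exists_equivariant (hE : IsQuotientCoveringMap (Quotient.mk (MulAction.orbitRel G E)) G)
    (e₀ : E) : ∃ ρ : E → G, (∀ g e, ρ (g • e) = g * ρ e) ∧ ρ e₀ = 1 := by
  have := hE.isCancelSMul
  have h : ∀ e : E, ∃ g : G, g • (Quotient.mk (MulAction.orbitRel G E) e).out = e := fun e ↦
    hE.apply_eq_iff_mem_orbit.mp (Quotient.out_eq _).symm
  choose ρ hρ using h
  refine ⟨fun e ↦ ρ e * (ρ e₀)⁻¹, fun g e ↦ ?_, mul_inv_cancel _⟩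
  refine Eq.trans (congrArg (· * (ρ e₀)⁻¹) ?_) (mul_assoc _ _ _)
  refine IsCancelSMul.right_cancel _ _ (Quotient.mk (MulAction.orbitRel G E) e).out ?_
  rw [mul_smul, hρ e]
  have := hρ (g • e)
  rwa [hE.map_smul g] at this

end UniversalBundle

/-- The cohomology of the classifying space of a finite abelian group is Frobenius regular. -/
theorem isRegular_cochains_classifyingQuotient (p : ℕ) [Fact p.Prime] {G : Type w} [CommGroup G]
    [Finite G] {E : Type u} [TopologicalSpace E] [MulAction G E] (hE : IsUniversalBundle G E) :
    DGRing.IsRegular p ((sing (ClassifyingQuotient G E)).Cochains (ZMod p)) := by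
  have := hE.contractible
  have : ContinuousConstSMul G E := hE.covering.toContinuousConstSMul
  obtain ⟨e₀, ⟨H⟩⟩ := id_nullhomotopic E
  obtain ⟨ρ, hρ, hρ₀⟩ := exists_equivariant hE.covering e₀
  have : Small.{u} G := inferInstance
  -- The comparison needs the group in the universe of `E`; being finite, `G` has a copy there.
  let e : Shrink.{u} G ≃* G := Shrink.mulEquiv
  let act : GroupAction (Shrink.{u} G) (sing E) := (singAction G E).comap e.toMonoidHom
  have hquot : act.IsQuotient (singMap (bundleProj G E)) :=
    { surjective := (singAction_isQuotient hE.covering).surjective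
      hom_comp g := (singAction_isQuotient hE.covering).hom_comp _
      exists_smul_eq σ σ' h := by
        obtain ⟨g, hg⟩ := (singAction_isQuotient hE.covering).exists_smul_eq σ σ' h
        refine ⟨e.symm g, ?_⟩
        rw [← hg]
        exact congrArg (fun g ↦ (singAction G E).smul g σ) (e.apply_symm_apply g) }
  refine hquot.pullback_isQuasiIso.isRegular_iff.mpr ((isRegularGroup_iff act (singCone H)
    (fun v ↦ e.symm (ρ (singEquiv 0 v (_root_.stdSimplex.vertex 0)))) (fun g v ↦ ?_) ?_).mp
    (isRegularGroup_of_finite p _))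
  · refine (congrArg e.symm (hρ (e g) _)).trans ?_
    rw [map_mul, e.symm_apply_apply]
    rfl
  · refine (congrArg e.symm ?_).trans (map_one e.symm)
    exact hρ₀

end SSet

/-! ## The shift assumption for a point -/

section ShiftAssumption

variable {G : Type w} [CommGroup G] [Finite G] {E : Type u} [TopologicalSpace E] [MulAction G E]

open SSet

variable (G E) in
/-- The section `BG → EG ×_G A` for a one-point space `A`. -/
def homotopyQuotientSection (A : Type u) [TopologicalSpace A] [MulAction G A] [Unique A] :
    C(ClassifyingQuotient G E, HomotopyQuotient G E A) where
  toFun := Quotient.map (fun e ↦ (e, default)) (by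
    rintro _ e ⟨g, rfl⟩
    exact ⟨g, Prod.ext rfl (Subsingleton.elim _ _)⟩)
  continuous_toFun := Continuous.quotient_map' (continuous_id.prodMk continuous_const) _

/-- The projection to BG and its section are mutually inverse, so multiplication by the pulled-back
class is faithful exactly when `t` is regular in H^*(BG). -/
lemma demonstratesShift_of_unique {p : ℕ} [Fact p.Prime] (hE : IsUniversalBundle G E)
    (A : Type u) [TopologicalSpace A] [MulAction G A] [Unique A]
    {t : SingularCohomology (ClassifyingQuotient G E) (ZMod p)} (ht : ¬ IsNilpotent t) :
    DemonstratesShift A t where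
  faithful := by
    let f := homotopyQuotientProj G E A
    let s := homotopyQuotientSection G E A
    have hfs : singMap s ≫ singMap f = 𝟙 _ := by
      refine (TopCat.toSSet.map_comp _ _).symm.trans (Eq.trans (congrArg _ ?_)
        (TopCat.toSSet.map_id _))
      ext x
      induction x using Quotient.inductionOn
      rfl
    have hsf : singMap f ≫ singMap s = 𝟙 _ := by
      refine (TopCat.toSSet.map_comp _ _).symm.trans (Eq.trans (congrArg _ ?_)
        (TopCat.toSSet.map_id _))
      ext x
      induction x using Quotient.inductionOn with
      | h x => exact congrArg (Quotient.mk _) (Prod.ext rfl (Subsingleton.elim _ _))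
    intro x x' hxx
    have h := congrArg (singularCohomologyMap (ZMod p) s) hxx
    simp only [map_mul] at h
    have hs : singularCohomologyMap (ZMod p) s (singularCohomologyMap (ZMod p) f t) = t :=
      cohomologyMap_cohomologyMap_of_comp_eq_id hfs t
    rw [hs, ← sub_eq_zero, ← sub_mul] at h
    have h₀ := congrArg (singularCohomologyMap (ZMod p) f) (sub_eq_zero.mp
      (eq_zero_of_mul_eq_zero_of_isRegular (isRegular_cochains_classifyingQuotient p hE) ht h))
    have hf : ∀ y, singularCohomologyMap (ZMod p) f (singularCohomologyMap (ZMod p) s y) = y :=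
      cohomologyMap_cohomologyMap_of_comp_eq_id hsf
    rwa [hf, hf] at h₀
  represented := by
    have : ContinuousConstSMul G E := hE.covering.toContinuousConstSMul
    obtain ⟨z, rfl⟩ := Ideal.Quotient.mk_surjective t
    obtain ⟨t', ht'⟩ := (singAction_isQuotient hE.covering).transfer_surjective (R := ZMod p) z
    have h : lowerCochain G E (ZMod p) t' = z := ht'
    exact ⟨t', h ▸ z.2, congrArg (singularClass _ _) (Subtype.ext h)⟩

end ShiftAssumption

theorem mainTheorem9 (p : ℕ) [Fact p.Prime] {G : Type w} [CommGroup G] [Finite G]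
    {E : Type u} [TopologicalSpace E] [MulAction G E] (hE : IsUniversalBundle G E) :
    ShiftAssumption G E PUnit.{u + 1} p ∧
      ∀ t : SingularCohomology (ClassifyingQuotient G E) (ZMod p),
        ¬ IsNilpotent t → DemonstratesShift PUnit.{u + 1} t := by
  have key : ∀ t : SingularCohomology (ClassifyingQuotient G E) (ZMod p),
      ¬ IsNilpotent t → DemonstratesShift PUnit.{u + 1} t := fun t ht ↦
    demonstratesShift_of_unique hE PUnit.{u + 1} ht
  have := hE.contractible
  obtain ⟨e⟩ : Nonempty E := inferInstance
  -- A point of `E` gives a vertex of BG, so the cohomology is nonzero and 1 is not nilpotent.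
  have : Nontrivial (SingularCohomology (ClassifyingQuotient G E) (ZMod p)) :=
    SSet.nontrivial_cohomology ((SSet.singEquiv 0).symm (.const _ (Quotient.mk _ e)))
  exact ⟨⟨1, key 1 not_isNilpotent_one⟩, key⟩
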